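/- Let $n\ge 0$ and let $F:\Sigma\to\mathbb R^{n+1}$ be a smooth proper immersion of an $n$-dimensional smooth manifold $\Sigma$ without boundary (not necessarily connected) which is two-sided, i.e. comes with a smooth unit normal field $N:\Sigma\to\mathbb R^{n+1}$. Write $x=F$ for the position vector, $A(X,Y)=\langle\nabla_XN,Y\rangle$ for the second fundamental form, $H=\operatorname{div}_\Sigma N$ for the mean curvature, and $d\mathcal A_\mu=e^{-|x|^2/4}\,d\mathcal A$ for the Gaussian area measure, where $\mathcal A$ is the area measure of the metric induced by $F$. Put $$Lu=\Delta u-\tfrac12\nabla_{x^T}u+|A|^2u+\tfrac12u,\qquad Q(u,v)=-\int_\Sigma u\,Lv\,d\mathcal A_\mu\qquad(u,v\in C_0^\infty(\Sigma)),$$ where $x^T$ is the tangential part of $x$, and let $\operatorname{Ind}Q\in\{0,1,2,\dots,\infty\}$ be the maximal dimension of a linear subspace $W\subset\{u\in C_0^\infty(\Sigma):\int_\Sigma u\,d\mathcal A_\mu=0\}$ on which $Q$ is negative definite. Assume that $\mathcal A_\mu(\Sigma)<\infty$, that $H=\tfrac12\langle x,N\rangle+C$ on $\Sigma$ for some constant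 $C\in\mathbb R$, and that $\Sigma$ is non-planar, i.e. not every connected component of $\Sigma$ is contained in a hyperplane (equivalently, $A\not\equiv0$). If $\operatorname{Ind}Q\le n$, then there is an integer $i$ with $n+1-\operatorname{Ind}Q\le i\le n$ such that $\Sigma=\Sigma_0\times\mathbb R^i$; that is, there are an $i$-dimensional linear subspace $K\subset\mathbb R^{n+1}$, a smooth proper immersion $F_0:\Sigma_0\to K^\perp$ of an $(n-i)$-dimensional smooth manifold $\Sigma_0$, and a diffeomorphism $\Phi:\Sigma_0\times K\to\Sigma$ with $F(\Phi(p,w))=F_0(p)+w$ for all $p\in\Sigma_0$, $w\in K$. Furthermore, $\operatorname{Ind}Q\neq0$ and $\operatorname{Ind}Q\neq1$. -/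

import Mathlib

open scoped Manifold ContDiff RealInnerProductSpace
open MeasureTheory

universe u

noncomputable section

namespace GaussianHypersurface

/-- The Euclidean space `ℝ^d`. -/
abbrev Euc (d : ℕ) : Type := EuclideanSpace ℝ (Fin d)

/-- `F` is a smooth proper immersion of the `m`-dimensional manifold `M` (without boundary) into
the finite-dimensional space `V`. -/
structure IsProperImmersion (m : ℕ) {M : Type u} [TopologicalSpace M] [ChartedSpace (Euc m) M]
    {V : Type*} [NormedAddCommGroup V] [NormedSpace ℝ V] (F : M → V) : Prop where
  smooth : ContMDiff (𝓡 m) 𝓘(ℝ, V) ∞ F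
  injective_mfderiv : ∀ p, Function.Injective (mfderiv (𝓡 m) 𝓘(ℝ, V) F p)
  proper : IsProperMap F

section Hypersurface

variable {n : ℕ} {M : Type u} [TopologicalSpace M] [ChartedSpace (Euc n) M]

/-- The derivative `∂ᵢ X (p)` of a vector-valued function on `M`, in the direction of the `i`-th
vector of the coordinate basis of `T_p M`. -/
def pderiv {V : Type*} [NormedAddCommGroup V] [NormedSpace ℝ V]
    (X : M → V) (p : M) (i : Fin n) : V :=
  mfderiv (𝓡 n) 𝓘(ℝ, V) X p (EuclideanSpace.single i (1 : ℝ) : Euc n)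

/-- The smooth unit normal field of a two-sided immersed hypersurface. -/
structure IsUnitNormal (F N : M → Euc (n + 1)) : Prop where
  smooth : ContMDiff (𝓡 n) 𝓘(ℝ, Euc (n + 1)) ∞ N
  norm_eq_one : ∀ p, ‖N p‖ = 1
  normal : ∀ p (i : Fin n), ⟪N p, pderiv F p i⟫ = 0

/-- The induced metric `g_{ij} = ⟨∂ᵢ F, ∂ⱼ F⟩` at `p`; its inverse is `g^{ij}`. -/
def metric (F : M → Euc (n + 1)) (p : M) : Matrix (Fin n) (Fin n) ℝ :=
  Matrix.of fun i j => ⟪pderiv F p i, pderiv F p j⟫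

/-- The divergence along the hypersurface, `div X = g^{ij} ⟨∂ᵢ X, ∂ⱼ F⟩`, of a field
`X` of vectors of the ambient space. -/
def divergence (F X : M → Euc (n + 1)) (p : M) : ℝ :=
  ∑ i, ∑ j, (metric F p)⁻¹ i j * ⟪pderiv X p i, pderiv F p j⟫

/-- The gradient `∇u = g^{ij} ∂ᵢu ∂ⱼF`, as a tangential field of vectors of the ambient space. -/
def gradient (F : M → Euc (n + 1)) (u : M → ℝ) (p : M) : Euc (n + 1) :=
  ∑ i, ∑ j, ((metric F p)⁻¹ i j * pderiv u p i) • pderiv F p j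

/-- The Laplace-Beltrami operator `Δu = div ∇u` of the induced metric. -/
def laplacian (F : M → Euc (n + 1)) (u : M → ℝ) (p : M) : ℝ :=
  divergence F (gradient F u) p

/-- The second fundamental form `A_{ij} = ⟨∂ᵢ N, ∂ⱼ F⟩`. -/
def secondFF (F N : M → Euc (n + 1)) (p : M) (i j : Fin n) : ℝ :=
  ⟪pderiv N p i, pderiv F p j⟫

/-- `|A|² = g^{ik} g^{jl} A_{ij} A_{kl}`. -/
def normSqA (F N : M → Euc (n + 1)) (p : M) : ℝ :=
  ∑ i, ∑ j, ∑ k, ∑ l, (metric F p)⁻¹ i k * (metric F p)⁻¹ j l *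
    secondFF F N p i j * secondFF F N p k l

/-- The mean curvature `H = div N`. -/
def meanCurvature (F N : M → Euc (n + 1)) (p : M) : ℝ :=
  divergence F N p

/-- The operator `L u = Δu - (1/2) ∇_{x^T} u + |A|² u + (1/2) u`, where `x` is the position
vector; as `∇u` is tangential, `∇_{x^T} u = ⟨x, ∇u⟩`. -/
def jacobiOp (F N : M → Euc (n + 1)) (u : M → ℝ) (p : M) : ℝ :=
  laplacian F u p - (1 / 2) * ⟪F p, gradient F u p⟫ + normSqA F N p * u p + (1 / 2) * u p

/-- `√(det g)` in the coordinates of the preferred chart at `x`, at the coordinate point `y`. -/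
def chartDensity (F : M → Euc (n + 1)) (x : M) (y : Euc n) : ℝ :=
  √(Matrix.det (Matrix.of fun i j : Fin n =>
    ⟪fderiv ℝ (F ∘ (chartAt (Euc n) x).symm) y (EuclideanSpace.single i 1),
      fderiv ℝ (F ∘ (chartAt (Euc n) x).symm) y (EuclideanSpace.single j 1)⟫))

/-- Every connected component lies in an affine hyperplane (and then, the immersion being proper,
it is that hyperplane). -/
def IsPlanar (F : M → Euc (n + 1)) : Prop :=
  ∀ p : M, ∃ (v : Euc (n + 1)) (c : ℝ), v ≠ 0 ∧ ∀ q ∈ connectedComponent p, ⟪v, F q⟫ = c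

/-- `Σ = Σ₀ × ℝ^i`: there are an `i`-dimensional linear subspace `K` of `ℝ^{n+1}`, a properly
immersed hypersurface `F₀ : M₀ → Kᗮ` of the orthogonal complement of `K`, and a diffeomorphism
of `M₀ × K` with `M` under which the immersion `F` becomes `(p, w) ↦ F₀ p + w`. -/
def SplitsOff (F : M → Euc (n + 1)) (i : ℕ) : Prop :=
  ∃ K : Submodule ℝ (Euc (n + 1)), Module.finrank ℝ K = i ∧
    ∃ (M₀ : Type u) (_ : TopologicalSpace M₀) (_ : T2Space M₀)
      (_ : ChartedSpace (Euc (n - i)) M₀) (_ : IsManifold (𝓡 (n - i)) ∞ M₀)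
      (F₀ : M₀ → Kᗮ) (Φ : (M₀ × K) ≃ₘ^∞⟮(𝓡 (n - i)).prod 𝓘(ℝ, K), 𝓡 n⟯ M),
      IsProperImmersion (n - i) F₀ ∧
        ∀ (p : M₀) (w : K), F (Φ (p, w)) = (F₀ p : Euc (n + 1)) + (w : Euc (n + 1))

variable [MeasurableSpace M]

/-- The area measure of the domain of the preferred chart at `x`: the image under the inverse
chart of the measure `√(det g) dy`. -/
def chartArea (F : M → Euc (n + 1)) (x : M) : Measure M :=
  ((volume.withDensity fun y => ENNReal.ofReal (chartDensity F x y)).restrict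
    (chartAt (Euc n) x).target).map (chartAt (Euc n) x).symm

/-- The area measure `𝒜` of the immersed hypersurface, as a measure on `M`. The measures
`chartArea F x` agree on the overlaps of the charts, and their least upper bound in the lattice of
measures on `M` is the measure which restricts to each of them. -/
def area (F : M → Euc (n + 1)) : Measure M :=
  ⨆ x : M, chartArea F x

/-- The Gaussian area measure `d𝒜_μ = e^{-|x|²/4} d𝒜`. -/
def gaussianArea (F : M → Euc (n + 1)) : Measure M :=
  (area F).withDensity fun p => ENNReal.ofReal (Real.exp (-‖F p‖ ^ 2 / 4))

/-- The bilinear form `Q(u, v) = -∫ u L v d𝒜_μ`. -/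
def Q (F N : M → Euc (n + 1)) (u v : M → ℝ) : ℝ :=
  -∫ p, u p * jacobiOp F N v p ∂(gaussianArea F)

/-- The functions `u ∈ C_0^∞(Σ)` with `∫ u d𝒜_μ = 0`. -/
structure IsMeanZeroTest (F : M → Euc (n + 1)) (u : M → ℝ) : Prop where
  smooth : ContMDiff (𝓡 n) 𝓘(ℝ, ℝ) ∞ u
  compactSupport : HasCompactSupport u
  integral_eq_zero : ∫ p, u p ∂(gaussianArea F) = 0

/-- `W` is a space of mean-zero test functions on which `Q` is negative definite. -/
def IsNegativeSubspace (F N : M → Euc (n + 1)) (W : Submodule ℝ (M → ℝ)) : Prop :=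
  (∀ u ∈ W, IsMeanZeroTest F u) ∧ ∀ u ∈ W, u ≠ 0 → Q F N u u < 0

/-- `Ind Q`: the supremum of the dimensions of the spaces of mean-zero test functions on
which `Q` is negative definite. -/
def indexQ (F N : M → Euc (n + 1)) : ℕ∞ :=
  ⨆ (W : Submodule ℝ (M → ℝ)) (_ : IsNegativeSubspace F N W), Cardinal.toENat (Module.rank ℝ W)

end Hypersurface

end GaussianHypersurface

end

set_option linter.unusedSectionVars false

/-! Write f_v = ⟨v, N⟩, let K be the space of vectors v with f_v ≡ 0 (`tangentDirections N`), and
let k = dim K. The theorem follows from the inequality n + 1 - k ≤ Ind Q together with the splitting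
of Σ along K, so that i = k.

Index. The Codazzi equation and H = ⟨x, N⟩/2 + C give Δf_v - ½∇_{x^T} f_v = -|A|² f_v
(`driftLaplacian_inner_normal`); hence L f_v = ½ f_v, while L1 = |A|² + ½. For ψ = c + f_v and a
cutoff φ, integration by parts turns Q(φψ, φψ) into the integral of ψ²|∇φ|² - c²φ²|A|² - 2cφ⟨∇φ,
∇f_v⟩ - ½φ²ψ² (`Q_mul_affineNormal_eq`). Since |∇f_v|² ≤ |A|²|v|², completing the square absorbs the
cross term into the |A|² term at the cost of |v|²|∇φ|², so no integrability of |A|² is needed. What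
is left is an error of order sup |∇φ|² times the finite Gaussian area, against -½∫φ²ψ²
(`Q_mul_affineNormal_le`). Non-planarity makes (c, v) ↦ c + f_v injective on ℝ × Kᗮ, and compactness
of the unit sphere there provides one φ that serves all (c, v) ≠ 0 (`exists_cutoff_negative`). So Q
is negative definite on a space of dimension n + 2 - k, and the mean-zero condition costs at most
one dimension (`finrank_le_indexQ`).

Splitting. Vectors of K are tangent to Σ at every point. Locally Σ is a graph over its tangent plane
and is invariant under small translations by K; properness makes the size of these translations
uniform over bounded regions, so all translations by K lift to Σ (`exists_translation`). Thus Σ is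
the product of K and the slice F⁻¹(Kᗮ) (`splitsOff_tangentDirections`).

Finally k ≤ n because N does not vanish, and Ind Q ≤ 1 would force k ≥ n: then N stays in a line, A
= 0 and Σ is planar (`isPlanar_of_le_finrank`). -/

noncomputable section

namespace GaussianHypersurface

/-! ### Traces, pseudo-inverses and Gram determinants of injective linear maps. -/

section LinearAlgebra

variable {V W : Type*} [NormedAddCommGroup V] [InnerProductSpace ℝ V] [FiniteDimensional ℝ V]
  [NormedAddCommGroup W] [InnerProductSpace ℝ W] [FiniteDimensional ℝ W]

/-- The trace of endomorphisms of a finite-dimensional space, as a continuous linear form. -/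
def traceCLM (V : Type*) [NormedAddCommGroup V] [InnerProductSpace ℝ V] [FiniteDimensional ℝ V] :
    (V →L[ℝ] V) →L[ℝ] ℝ :=
  LinearMap.toContinuousLinearMap
    ((LinearMap.trace ℝ V) ∘ₗ (ContinuousLinearMap.coeLM ℝ : (V →L[ℝ] V) →ₗ[ℝ] (V →ₗ[ℝ] V)))

lemma traceCLM_apply (A : V →L[ℝ] V) :
    traceCLM V A = LinearMap.trace ℝ V (A : V →ₗ[ℝ] V) := rfl

lemma traceCLM_eq_sum {ι : Type*} [Fintype ι] (b : OrthonormalBasis ι ℝ V) (A : V →L[ℝ] V) :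
    traceCLM V A = ∑ i, ⟪b i, A (b i)⟫ := by
  rw [traceCLM_apply, LinearMap.trace_eq_sum_inner _ b]; rfl

lemma traceCLM_comp_comm (A : V →L[ℝ] W) (B : W →L[ℝ] V) :
    traceCLM V (B ∘L A) = traceCLM W (A ∘L B) := by
  rw [traceCLM_apply, traceCLM_apply]
  exact LinearMap.trace_comp_comm' (A : V →ₗ[ℝ] W) (B : W →ₗ[ℝ] V)

lemma traceCLM_adjoint (A : V →L[ℝ] V) :
    traceCLM V (ContinuousLinearMap.adjoint A) = traceCLM V A := by
  rw [traceCLM_eq_sum (stdOrthonormalBasis ℝ V), traceCLM_eq_sum (stdOrthonormalBasis ℝ V)]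
  refine Finset.sum_congr rfl fun i _ => ?_
  rw [ContinuousLinearMap.adjoint_inner_right, real_inner_comm]

/-- The left inverse `(T* T)⁻¹ T*` of an injective linear map `T`. -/
def pinv (T : V →L[ℝ] W) : W →L[ℝ] V :=
  (ContinuousLinearMap.adjoint T ∘L T).inverse ∘L ContinuousLinearMap.adjoint T

variable {T : V →L[ℝ] W}

lemma isInvertible_of_injective {A : V →L[ℝ] V} (hA : Function.Injective A) :
    A.IsInvertible :=
  ⟨(LinearEquiv.ofInjectiveEndo (A : V →ₗ[ℝ] V) hA).toContinuousLinearEquiv, by ext; rfl⟩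

lemma isInvertible_adjoint_comp_self (hT : Function.Injective T) :
    (ContinuousLinearMap.adjoint T ∘L T).IsInvertible := by
  apply isInvertible_of_injective
  rw [injective_iff_map_eq_zero]
  intro v hv
  have h : ⟪ContinuousLinearMap.adjoint T (T v), v⟫ = 0 := by
    rw [show ContinuousLinearMap.adjoint T (T v) = 0 from hv, inner_zero_left]
  rw [ContinuousLinearMap.adjoint_inner_left, inner_self_eq_zero] at h
  exact hT (by rw [h, map_zero])

lemma pinv_apply_map (hT : Function.Injective T) (v : V) : pinv T (T v) = v :=
  (isInvertible_adjoint_comp_self hT).inverse_apply_self v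

lemma pinv_comp_self (hT : Function.Injective T) : pinv T ∘L T = ContinuousLinearMap.id ℝ V := by
  ext v; exact pinv_apply_map hT v

lemma pinv_apply_eq_zero {w : W} (h : ∀ v, ⟪w, T v⟫ = 0) : pinv T w = 0 := by
  have : ContinuousLinearMap.adjoint T w = 0 := by
    apply ext_inner_right ℝ
    intro v
    rw [ContinuousLinearMap.adjoint_inner_left, h, inner_zero_left]
  rw [pinv, ContinuousLinearMap.comp_apply, this, map_zero]

lemma inner_map_pinv (hT : Function.Injective T) (w : W) (v : V) :
    ⟪T (pinv T w), T v⟫ = ⟪w, T v⟫ := by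
  rw [← ContinuousLinearMap.adjoint_inner_left, ← ContinuousLinearMap.adjoint_inner_left]
  congr 1
  exact (isInvertible_adjoint_comp_self hT).self_apply_inverse _

/-- Applied after `T`, both sides become the orthogonal projection to the range of `T`, which a
reparametrization `A` does not change. This is what makes the tangential derivative independent of
coordinates. -/
lemma pinv_comp_equiv {V' : Type*} [NormedAddCommGroup V'] [InnerProductSpace ℝ V']
    [FiniteDimensional ℝ V'] (hT : Function.Injective T) {A : V' →L[ℝ] V}
    (hA : A.IsInvertible) : A ∘L pinv (T ∘L A) = pinv T := by
  ext w
  have hTA : Function.Injective (T ∘L A) := hT.comp hA.injective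
  apply hT
  apply sub_eq_zero.1
  rw [← map_sub, ← inner_self_eq_zero (𝕜 := ℝ)]
  set z := (A ∘L pinv (T ∘L A)) w - pinv T w
  have hz : T z = T (A (pinv (T ∘L A) w)) - T (pinv T w) := map_sub T _ _
  obtain ⟨z', hz'⟩ := hA.surjective z
  have h1 := inner_map_pinv hTA w z'
  have h2 := inner_map_pinv hT w z
  rw [ContinuousLinearMap.comp_apply, ContinuousLinearMap.comp_apply, hz'] at h1
  calc ⟪T z, T z⟫ = ⟪T (A (pinv (T ∘L A) w)) - T (pinv T w), T z⟫ := by rw [← hz]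
    _ = 0 := by rw [inner_sub_left, h1, h2, sub_self]

/-- The adjoint, as a continuous linear map. -/
def adjointL (V W : Type*) [NormedAddCommGroup V] [InnerProductSpace ℝ V] [FiniteDimensional ℝ V]
    [NormedAddCommGroup W] [InnerProductSpace ℝ W] [FiniteDimensional ℝ W] :
    (V →L[ℝ] W) →L[ℝ] (W →L[ℝ] V) :=
  LinearMap.toContinuousLinearMap
    { toFun := fun T => ContinuousLinearMap.adjoint T
      map_add' := fun A B => map_add _ A B
      map_smul' := fun c A => by
        rw [map_smulₛₗ]; rfl }

lemma contDiffAt_pinv (hT : Function.Injective T) :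
    ContDiffAt ℝ ∞ (pinv : (V →L[ℝ] W) → (W →L[ℝ] V)) T := by
  have hadj : ContDiff ℝ ∞
      (fun T : V →L[ℝ] W => (ContinuousLinearMap.adjoint T : W →L[ℝ] V)) :=
    (adjointL V W).contDiff
  have h1 : ContDiff ℝ ∞ (fun T : V →L[ℝ] W => ContinuousLinearMap.adjoint T ∘L T) :=
    hadj.clm_comp contDiff_id
  have h2 : ContDiffAt ℝ ∞ (fun T : V →L[ℝ] W => (ContinuousLinearMap.adjoint T ∘L T).inverse) T :=
    ContDiffAt.comp (g := ContinuousLinearMap.inverse)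
      (f := fun T : V →L[ℝ] W => ContinuousLinearMap.adjoint T ∘L T) T
      (isInvertible_adjoint_comp_self hT).contDiffAt_map_inverse h1.contDiffAt
  exact h2.clm_comp hadj.contDiffAt

/-- The Gram determinant `det (T* T)`. -/
def gramDet (T : V →L[ℝ] W) : ℝ :=
  (ContinuousLinearMap.adjoint T ∘L T).det

lemma gramDet_eq_det_gram {ι : Type*} [Fintype ι] [DecidableEq ι] (b : OrthonormalBasis ι ℝ V)
    (T : V →L[ℝ] W) : gramDet T = (Matrix.of fun i j => ⟪T (b i), T (b j)⟫).det := by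
  rw [gramDet, ContinuousLinearMap.det, ← LinearMap.det_toMatrix b.toBasis]
  congr 1
  ext i j
  rw [LinearMap.toMatrix_apply, b.coe_toBasis, b.coe_toBasis_repr_apply, b.repr_apply_apply]
  change ⟪b i, ContinuousLinearMap.adjoint T (T (b j))⟫ = ⟪T (b i), T (b j)⟫
  rw [ContinuousLinearMap.adjoint_inner_right]

lemma gramDet_pos (hT : Function.Injective T) : 0 < gramDet T := by
  classical
  let b := stdOrthonormalBasis ℝ V
  rw [gramDet_eq_det_gram b]
  have : LinearIndependent ℝ (fun i => T (b i)) :=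
    b.toBasis.linearIndependent.map' (T : V →ₗ[ℝ] W) (LinearMap.ker_eq_bot.2 hT)
      |> fun h => by simpa [Function.comp_def] using h
  exact (Matrix.posDef_gram_of_linearIndependent (𝕜 := ℝ) this).det_pos

/-- The square of the Jacobian factor by which the area densities of two charts differ. -/
lemma gramDet_comp (T : V →L[ℝ] W) (A : V →L[ℝ] V) : gramDet (T ∘L A) = A.det ^ 2 * gramDet T := by
  have hadj : (ContinuousLinearMap.adjoint A).det = A.det := by
    classical
    let b := stdOrthonormalBasis ℝ V
    rw [ContinuousLinearMap.det, ContinuousLinearMap.det, ← LinearMap.det_toMatrix b.toBasis,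
      ← LinearMap.det_toMatrix b.toBasis, ← Matrix.det_transpose]
    congr 1
    ext i j
    rw [Matrix.transpose_apply, LinearMap.toMatrix_apply, LinearMap.toMatrix_apply,
      b.coe_toBasis, b.coe_toBasis_repr_apply, b.coe_toBasis_repr_apply, b.repr_apply_apply,
      b.repr_apply_apply]
    exact (ContinuousLinearMap.adjoint_inner_right _ _ _).trans (real_inner_comm _ _)
  have hmul : ∀ A B : V →L[ℝ] V, (A ∘L B).det = A.det * B.det := fun A B =>
    LinearMap.det_comp (A : V →ₗ[ℝ] V) B
  rw [gramDet, ContinuousLinearMap.adjoint_comp, ContinuousLinearMap.comp_assoc, hmul, hadj,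
    ← ContinuousLinearMap.comp_assoc, hmul, gramDet]
  ring

lemma contDiff_det : ContDiff ℝ ∞ (fun A : V →L[ℝ] V => A.det) := by
  classical
  let b := stdOrthonormalBasis ℝ V
  have h : (fun A : V →L[ℝ] V => A.det) =
      fun A => (Matrix.of fun i j => ⟪b i, A (b j)⟫).det := by
    funext A
    rw [ContinuousLinearMap.det, ← LinearMap.det_toMatrix b.toBasis]
    congr 1
    ext i j
    rw [LinearMap.toMatrix_apply, b.coe_toBasis, b.coe_toBasis_repr_apply, b.repr_apply_apply]
    rfl
  rw [h]
  simp only [Matrix.det_apply, Matrix.of_apply]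
  refine ContDiff.sum fun σ _ => ContDiff.const_smul _ (contDiff_prod fun i _ => ?_)
  exact contDiff_const.inner ℝ (contDiff_id.clm_apply contDiff_const)

/-- Jacobi's formula at the identity. -/
lemma fderiv_det_one (B : V →L[ℝ] V) :
    fderiv ℝ (fun A : V →L[ℝ] V => A.det) (1 : V →L[ℝ] V) B = traceCLM V B := by
  classical
  let b := stdOrthonormalBasis ℝ V
  let Bm := LinearMap.toMatrix b.toBasis b.toBasis (B : V →ₗ[ℝ] V)
  have h1 : HasDerivAt (fun t : ℝ => (1 + t • B : V →L[ℝ] V).det)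
      (fderiv ℝ (fun A : V →L[ℝ] V => A.det) (1 : V →L[ℝ] V) B) 0 := by
    have h2 : HasDerivAt (fun t : ℝ => (1 + t • B : V →L[ℝ] V)) B 0 := by
      simpa using ((hasDerivAt_id (0 : ℝ)).smul_const B).const_add (1 : V →L[ℝ] V)
    have h3 := (contDiff_det (V := V)).differentiable (by simp) (1 + (0 : ℝ) • B)
    have := HasFDerivAt.comp_hasDerivAt (0 : ℝ) h3.hasFDerivAt h2
    rw [zero_smul, add_zero] at this
    exact this
  have h4 : (fun t : ℝ => (1 + t • B : V →L[ℝ] V).det) =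
      fun t => (Matrix.det (1 + (Polynomial.X : Polynomial ℝ) • Bm.map Polynomial.C)).eval t := by
    funext t
    rw [ContinuousLinearMap.det, ← LinearMap.det_toMatrix b.toBasis, ← Polynomial.coe_evalRingHom,
      RingHom.map_det]
    congr 1
    ext i j
    have : ((1 + t • B : V →L[ℝ] V) : V →ₗ[ℝ] V) = 1 + t • (B : V →ₗ[ℝ] V) := rfl
    rw [this, map_add, map_smul, LinearMap.toMatrix_one]
    by_cases hij : i = j <;> simp [Bm, hij, mul_comm t]
  rw [h4] at h1
  have h5 := h1.unique (Polynomial.hasDerivAt _ 0)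
  rw [h5, Matrix.derivative_det_one_add_X_smul, traceCLM_apply,
    LinearMap.trace_eq_matrix_trace ℝ b.toBasis]

/-- Jacobi's formula. -/
lemma fderiv_det {A : V →L[ℝ] V} (hA : A.IsInvertible) (B : V →L[ℝ] V) :
    fderiv ℝ (fun A : V →L[ℝ] V => A.det) A B = A.det * traceCLM V (A.inverse ∘L B) := by
  have hmul : ∀ A B : V →L[ℝ] V, (A ∘L B).det = A.det * B.det := fun A B =>
    LinearMap.det_comp (A : V →ₗ[ℝ] V) B
  -- Multiplicativity of the determinant moves the base point to the identity.
  have h : (fun A' : V →L[ℝ] V => A'.det) =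
      fun A' => A.det * (fun A' : V →L[ℝ] V => A'.det) (A.inverse ∘L A') := by
    funext A'
    simp only
    rw [← hmul, ← ContinuousLinearMap.comp_assoc, hA.self_comp_inverse,
      ContinuousLinearMap.id_comp]
  have h2 : HasFDerivAt (fun A' : V →L[ℝ] V => A.inverse ∘L A')
      (ContinuousLinearMap.compL ℝ V V V A.inverse) A :=
    (ContinuousLinearMap.compL ℝ V V V A.inverse).hasFDerivAt
  have h3 := (contDiff_det (V := V)).differentiable (by simp) (A.inverse ∘L A)
  have h4 : HasFDerivAt
      (fun A' : V →L[ℝ] V => A.det * (fun A' : V →L[ℝ] V => A'.det) (A.inverse ∘L A')) _ A :=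
    (h3.hasFDerivAt.comp A h2).const_mul A.det
  rw [h, h4.fderiv]
  rw [hA.inverse_comp_self]
  simp only [smul_apply, ContinuousLinearMap.comp_apply, smul_eq_mul]
  congr 1
  exact fderiv_det_one _

lemma contDiff_gramDet : ContDiff ℝ ∞ (gramDet : (V →L[ℝ] W) → ℝ) := by
  have hadj : ContDiff ℝ ∞
      (fun T : V →L[ℝ] W => (ContinuousLinearMap.adjoint T : W →L[ℝ] V)) :=
    (adjointL V W).contDiff
  exact contDiff_det.comp (hadj.clm_comp contDiff_id)

/-- The derivative of T*T in the direction B is T*B + B*T. Because (T*T)⁻¹ is self-adjoint, both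
summands contribute the same trace, hence the factor 2. -/
lemma fderiv_gramDet (hT : Function.Injective T) (B : V →L[ℝ] W) :
    fderiv ℝ (gramDet : (V →L[ℝ] W) → ℝ) T B = gramDet T * (2 * traceCLM V (pinv T ∘L B)) := by
  have hadj : HasFDerivAt
      (fun T : V →L[ℝ] W => (ContinuousLinearMap.adjoint T : W →L[ℝ] V))
      (adjointL V W) T := (adjointL V W).hasFDerivAt
  have h1 := hadj.clm_comp (hasFDerivAt_id T)
  have h2 := (contDiff_det (V := V)).differentiable (by simp) (ContinuousLinearMap.adjoint T ∘L T)
  have h3 : HasFDerivAt (gramDet : (V →L[ℝ] W) → ℝ) _ T :=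
    HasFDerivAt.comp (g := fun A : V →L[ℝ] V => A.det)
      (f := fun T : V →L[ℝ] W => ContinuousLinearMap.adjoint T ∘L T) T h2.hasFDerivAt h1
  have hinv := isInvertible_adjoint_comp_self hT
  set G := ContinuousLinearMap.adjoint T ∘L T with hG
  have hsymm : ContinuousLinearMap.adjoint G.inverse = G.inverse := by
    have hGs : ContinuousLinearMap.adjoint G = G := by
      rw [hG, ContinuousLinearMap.adjoint_comp, ContinuousLinearMap.adjoint_adjoint]
    symm
    apply ContinuousLinearMap.inverse_eq
    · have h := congrArg ContinuousLinearMap.adjoint hinv.inverse_comp_self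
      rwa [ContinuousLinearMap.adjoint_comp, hGs, ContinuousLinearMap.adjoint_id] at h
    · have h := congrArg ContinuousLinearMap.adjoint hinv.self_comp_inverse
      rwa [ContinuousLinearMap.adjoint_comp, hGs, ContinuousLinearMap.adjoint_id] at h
  have h4 : traceCLM V (G.inverse ∘L (ContinuousLinearMap.adjoint B ∘L T)) =
      traceCLM V (pinv T ∘L B) := by
    rw [← traceCLM_adjoint, ContinuousLinearMap.adjoint_comp, ContinuousLinearMap.adjoint_comp,
      ContinuousLinearMap.adjoint_adjoint, hsymm, traceCLM_comp_comm,
      ← ContinuousLinearMap.comp_assoc]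
    rfl
  rw [h3.fderiv]
  change fderiv ℝ _ G (ContinuousLinearMap.adjoint T ∘L B + ContinuousLinearMap.adjoint B ∘L T) = _
  rw [fderiv_det hinv, ContinuousLinearMap.comp_add, map_add, h4, ← ContinuousLinearMap.comp_assoc]
  change gramDet T * (traceCLM V (pinv T ∘L B) + _) = _
  ring

end LinearAlgebra

/-! ### The coordinate-free tangential derivative, and its agreement with the index formulas. -/

section TangentialDerivative

variable {n : ℕ} {M : Type u} [TopologicalSpace M] [ChartedSpace (Euc n) M]
  {W : Type*} [NormedAddCommGroup W] [NormedSpace ℝ W]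

/-- The expression of `X` in the preferred chart at `x`. -/
abbrev inChart (X : M → W) (x : M) : Euc n → W := X ∘ (chartAt (Euc n) x).symm

lemma inChart_apply_self {n : ℕ} {M W : Type*} [TopologicalSpace M]
    [ChartedSpace (Euc n) M] (X : M → W) (p : M) :
    (X ∘ (chartAt (Euc n) p).symm) (chartAt (Euc n) p p) = X p := by
  simp

/-- The derivative of `X` at `p` in the coordinates of the preferred chart at `p`. -/
def coordDeriv (n : ℕ) {M : Type u} [TopologicalSpace M] [ChartedSpace (Euc n) M]
    {W : Type*} [NormedAddCommGroup W] [NormedSpace ℝ W] (X : M → W) (p : M) : Euc n →L[ℝ] W :=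
  mfderiv (𝓡 n) 𝓘(ℝ, W) X p

lemma pderiv_eq (X : M → W) (p : M) (i : Fin n) :
    pderiv X p i = coordDeriv n X p (EuclideanSpace.single i 1) := rfl

/-- The derivative of `X` along the hypersurface, extended by zero to the normal vectors. It
does not depend on coordinates. -/
def tderiv (F : M → Euc (n + 1)) (X : M → W) (p : M) : Euc (n + 1) →L[ℝ] W :=
  coordDeriv n X p ∘L pinv (coordDeriv n F p)

section Translate

/-- The dictionary between indices and operators: contraction with g^{ij} computes the coordinates
of `pinv T w`, since those solve the normal equations with Gram matrix g. -/
lemma sum_inv_gram_mul_inner {T : Euc n →L[ℝ] Euc (n + 1)} (hT : Function.Injective T)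
    (w : Euc (n + 1)) (i : Fin n) :
    ∑ j, (Matrix.of fun i j : Fin n => ⟪T (EuclideanSpace.single i 1),
      T (EuclideanSpace.single j 1)⟫)⁻¹ i j * ⟪T (EuclideanSpace.single j 1), w⟫ =
      pinv T w i := by
  set G := Matrix.of fun i j : Fin n => ⟪T (EuclideanSpace.single i 1),
      T (EuclideanSpace.single j 1)⟫ with hG
  have hdet : G.det ≠ 0 := by
    have := gramDet_eq_det_gram (EuclideanSpace.basisFun (Fin n) ℝ) T
    simp only [EuclideanSpace.basisFun_apply] at this
    rw [← hG] at this
    rw [← this]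
    exact (gramDet_pos hT).ne'
  have h1 : ∀ j, ⟪T (EuclideanSpace.single j 1), w⟫ =
      G.mulVec (fun k => pinv T w k) j := by
    intro j
    rw [real_inner_comm, ← inner_map_pinv hT, real_inner_comm]
    conv_lhs => rw [← (EuclideanSpace.basisFun (Fin n) ℝ).sum_repr (pinv T w)]
    simp only [map_sum, map_smul, inner_sum, inner_smul_right, EuclideanSpace.basisFun_apply,
      EuclideanSpace.basisFun_repr, Matrix.mulVec, dotProduct, hG, Matrix.of_apply]
    exact Finset.sum_congr rfl fun k _ => mul_comm _ _
  simp only [h1]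
  change (G⁻¹.mulVec (G.mulVec fun k => pinv T w k)) i = _
  rw [Matrix.mulVec_mulVec, Matrix.nonsing_inv_mul _ (Ne.isUnit hdet), Matrix.one_mulVec]

variable {F : M → Euc (n + 1)} {p : M}

lemma clm_eq_sum (A : Euc n →L[ℝ] W) (v : Euc n) :
    A v = ∑ i, v i • A (EuclideanSpace.single i 1) := by
  conv_lhs => rw [← (EuclideanSpace.basisFun (Fin n) ℝ).sum_repr v]
  simp only [map_sum, map_smul, EuclideanSpace.basisFun_apply, EuclideanSpace.basisFun_repr]

lemma inner_gradient (hF : Function.Injective (coordDeriv n F p)) (f : M → ℝ) (w : Euc (n + 1)) :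
    ⟪gradient F f p, w⟫ = tderiv F f p w := by
  rw [gradient, tderiv, ContinuousLinearMap.comp_apply, clm_eq_sum]
  simp only [sum_inner, inner_smul_left, smul_eq_mul]
  refine Finset.sum_congr rfl fun i _ => ?_
  rw [← sum_inv_gram_mul_inner hF, Finset.sum_mul]
  refine Finset.sum_congr rfl fun j _ => ?_
  rw [metric]
  simp only [pderiv_eq, conj_trivial]
  ring

lemma sum_inv_metric_mul_inner (hF : Function.Injective (coordDeriv n F p))
    (B : Euc n →L[ℝ] Euc (n + 1)) :
    ∑ i, ∑ j, (metric F p)⁻¹ i j * ⟪B (EuclideanSpace.single i 1), pderiv F p j⟫ =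
      traceCLM _ (B ∘L pinv (coordDeriv n F p)) := by
  rw [← traceCLM_comp_comm, traceCLM_eq_sum (EuclideanSpace.basisFun (Fin n) ℝ)]
  refine Finset.sum_congr rfl fun i _ => ?_
  simp only [EuclideanSpace.basisFun_apply, ContinuousLinearMap.comp_apply]
  rw [EuclideanSpace.inner_single_left, map_one, one_mul, ← sum_inv_gram_mul_inner hF]
  refine Finset.sum_congr rfl fun j _ => ?_
  rw [metric, real_inner_comm]
  rfl

lemma divergence_eq_trace (hF : Function.Injective (coordDeriv n F p)) (X : M → Euc (n + 1)) :
    divergence F X p = traceCLM _ (tderiv F X p) :=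
  sum_inv_metric_mul_inner hF (coordDeriv n X p)

/-- The hypothesis `hN` expresses that dN takes tangential values. It lets the second pair of
indices be contracted into ⟨dN, dN⟩, leaving the trace of S*S for the shape operator S = `tderiv F N
p`. -/
lemma normSqA_eq_trace (hF : Function.Injective (coordDeriv n F p)) {N : M → Euc (n + 1)}
    (hN : ∀ v, coordDeriv n F p (pinv (coordDeriv n F p) (coordDeriv n N p v)) = coordDeriv n N p v) :
    normSqA F N p =
      traceCLM _ (ContinuousLinearMap.adjoint (tderiv F N p) ∘L tderiv F N p) := by
  have h := sum_inv_metric_mul_inner hF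
    (ContinuousLinearMap.adjoint (tderiv F N p) ∘L coordDeriv n N p)
  rw [ContinuousLinearMap.comp_assoc] at h
  refine Eq.trans ?_ h
  rw [normSqA]
  refine Finset.sum_congr rfl fun i _ => ?_
  rw [Finset.sum_comm]
  refine Finset.sum_congr rfl fun k _ => ?_
  have h1 : ∀ j, ∑ l, (metric F p)⁻¹ i k * (metric F p)⁻¹ j l *
      secondFF F N p i j * secondFF F N p k l =
      (metric F p)⁻¹ i k * (pinv (coordDeriv n F p) (pderiv N p k) j * ⟪pderiv N p i, pderiv F p j⟫)
      := by
    intro j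
    rw [← sum_inv_gram_mul_inner hF, Finset.sum_mul, Finset.mul_sum]
    refine Finset.sum_congr rfl fun l _ => ?_
    rw [secondFF, secondFF, real_inner_comm (pderiv F p l)]
    simp only [metric, pderiv_eq]
    ring
  simp only [h1, ← Finset.mul_sum]
  congr 1
  rw [ContinuousLinearMap.comp_apply, ContinuousLinearMap.adjoint_inner_left, tderiv,
    ContinuousLinearMap.comp_apply, pderiv_eq F, pinv_apply_map hF]
  have h2 := hN (EuclideanSpace.single k 1)
  rw [clm_eq_sum] at h2
  conv_rhs => rw [← h2]
  simp only [inner_sum, inner_smul_right]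
  rfl

end Translate

variable [IsManifold (𝓡 n) ∞ M]

/-- The derivative at `p` of the preferred chart at `x`. -/
def chartJacobian (n : ℕ) {M : Type u} [TopologicalSpace M] [ChartedSpace (Euc n) M] (x p : M) :
    Euc n →L[ℝ] Euc n :=
  mfderiv (𝓡 n) (𝓡 n) (chartAt (Euc n) x) p

lemma coordDeriv_eq_fderiv_comp {X : M → W} {p : M}
    (hX : MDifferentiableAt (𝓡 n) 𝓘(ℝ, W) X p) (x : M) (hp : p ∈ (chartAt (Euc n) x).source) :
    coordDeriv n X p = fderiv ℝ (inChart X x) (chartAt (Euc n) x p) ∘L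
      chartJacobian n x p := by
  set e := chartAt (Euc n) x with he
  have hdiff := mdifferentiable_chart (I := 𝓡 n) x
  have hp' : e p ∈ e.target := e.map_source hp
  have h1 : MDifferentiableAt (𝓡 n) 𝓘(ℝ, W) (X ∘ e.symm) (e p) := by
    apply MDifferentiableAt.comp (I' := 𝓡 n)
    · rwa [e.left_inv hp]
    · exact hdiff.mdifferentiableAt_symm hp'
  have h2 : X =ᶠ[nhds p] (X ∘ e.symm) ∘ e := by
    filter_upwards [e.open_source.mem_nhds hp] with q hq
    simp [e.left_inv hq]
  have h3 : mfderiv (𝓡 n) 𝓘(ℝ, W) X p = mfderiv (𝓡 n) 𝓘(ℝ, W) ((X ∘ e.symm) ∘ e) p :=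
    h2.mfderiv_eq
  rw [mfderiv_comp p h1 (hdiff.mdifferentiableAt hp)] at h3
  rw [mfderiv_eq_fderiv] at h3
  exact h3

lemma isInvertible_mfderiv_chartAt {x p : M} (hp : p ∈ (chartAt (Euc n) x).source) :
    (chartJacobian n x p).IsInvertible :=
  isInvertible_of_injective ((mdifferentiable_chart (I := 𝓡 n) x).mfderiv_injective hp)

/-- The tangential derivative in the coordinates of a chart. -/
def chartTderiv (F : M → Euc (n + 1)) (X : M → W) (x : M) (y : Euc n) : Euc (n + 1) →L[ℝ] W :=
  fderiv ℝ (inChart X x) y ∘L pinv (fderiv ℝ (inChart F x) y)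

variable {F : M → Euc (n + 1)}

lemma injective_fderiv_inChart (hF : IsProperImmersion n F) {x : M} {y : Euc n}
    (hy : y ∈ (chartAt (Euc n) x).target) : Function.Injective (fderiv ℝ (inChart F x) y) := by
  set e := chartAt (Euc n) x
  have hp : e.symm y ∈ e.source := e.map_target hy
  have h := coordDeriv_eq_fderiv_comp (hF.smooth.mdifferentiableAt (by simp)) x hp
  have h1 : Function.Injective (coordDeriv n F (e.symm y)) := hF.injective_mfderiv _
  rw [h, e.right_inv hy] at h1
  have hs := (isInvertible_mfderiv_chartAt hp).surjective
  intro a b hab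
  obtain ⟨a, rfl⟩ := hs a
  obtain ⟨b, rfl⟩ := hs b
  exact congrArg _ (h1 hab)

/-- The Jacobian of the change of chart cancels by `pinv_comp_equiv`. Hence one fixed chart computes
the tangential derivative at all points of its domain, which allows it to be differentiated again.
-/
lemma tderiv_eq_chartTderiv (hF : IsProperImmersion n F) {X : M → W} {p : M}
    (hX : MDifferentiableAt (𝓡 n) 𝓘(ℝ, W) X p) (x : M) (hp : p ∈ (chartAt (Euc n) x).source) :
    tderiv F X p = chartTderiv F X x (chartAt (Euc n) x p) := by
  rw [tderiv, coordDeriv_eq_fderiv_comp hX x hp,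
    coordDeriv_eq_fderiv_comp (hF.smooth.mdifferentiableAt (by simp)) x hp,
    ContinuousLinearMap.comp_assoc, pinv_comp_equiv
      (injective_fderiv_inChart hF ((chartAt (Euc n) x).map_source hp))
      (isInvertible_mfderiv_chartAt hp)]
  rfl

lemma contDiffOn_inChart {X : M → W} (hX : ContMDiff (𝓡 n) 𝓘(ℝ, W) ∞ X) (x : M) :
    ContDiffOn ℝ ∞ (inChart X x) (chartAt (Euc n) x).target :=
  contMDiffOn_iff_contDiffOn.1
    (hX.comp_contMDiffOn (contMDiffOn_chart_symm (I := 𝓡 n) (n := ∞) (x := x)))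

lemma contDiffOn_fderiv_inChart {X : M → W} (hX : ContMDiff (𝓡 n) 𝓘(ℝ, W) ∞ X) (x : M) :
    ContDiffOn ℝ ∞ (fderiv ℝ (inChart X x)) (chartAt (Euc n) x).target :=
  (contDiffOn_inChart hX x).fderiv_of_isOpen (chartAt (Euc n) x).open_target (by simp)

lemma contDiffOn_pinv_fderiv_inChart (hF : IsProperImmersion n F) (x : M) :
    ContDiffOn ℝ ∞ (fun y => pinv (fderiv ℝ (inChart F x) y)) (chartAt (Euc n) x).target :=
  fun y hy => (contDiffAt_pinv (injective_fderiv_inChart hF hy)).comp_contDiffWithinAt y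
    (contDiffOn_fderiv_inChart hF.smooth x y hy)

lemma contDiffOn_chartTderiv (hF : IsProperImmersion n F) {X : M → W}
    (hX : ContMDiff (𝓡 n) 𝓘(ℝ, W) ∞ X) (x : M) :
    ContDiffOn ℝ ∞ (chartTderiv F X x) (chartAt (Euc n) x).target :=
  (contDiffOn_fderiv_inChart hX x).clm_comp (contDiffOn_pinv_fderiv_inChart hF x)

lemma contMDiff_tderiv (hF : IsProperImmersion n F) {X : M → W}
    (hX : ContMDiff (𝓡 n) 𝓘(ℝ, W) ∞ X) :
    ContMDiff (𝓡 n) 𝓘(ℝ, Euc (n + 1) →L[ℝ] W) ∞ (tderiv F X) := by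
  intro x
  set e := chartAt (Euc n) x
  have hx : x ∈ e.source := mem_chart_source _ x
  have h1 : ContMDiffAt (𝓡 n) 𝓘(ℝ, Euc (n + 1) →L[ℝ] W) ∞ (chartTderiv F X x ∘ e) x := by
    apply ContMDiffAt.comp (I' := 𝓡 n)
    · exact ((contDiffOn_chartTderiv hF hX x).contDiffAt
        (e.open_target.mem_nhds (e.map_source hx))).contMDiffAt
    · exact (contMDiffOn_chart (I := 𝓡 n) (n := ∞) (x := x)).contMDiffAt
        (e.open_source.mem_nhds hx)
  refine h1.congr_of_eventuallyEq ?_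
  filter_upwards [e.open_source.mem_nhds hx] with q hq
  exact tderiv_eq_chartTderiv hF (hX.mdifferentiableAt (by simp)) x hq

/-- The coordinate vector representing the tangential part of `w`. -/
def coordVec (F : M → Euc (n + 1)) (p : M) (w : Euc (n + 1)) : Euc n :=
  pinv (fderiv ℝ (inChart F p) (chartAt (Euc n) p p)) w

lemma tderiv_apply (hF : IsProperImmersion n F) {X : M → W} {p : M}
    (hX : MDifferentiableAt (𝓡 n) 𝓘(ℝ, W) X p) (w : Euc (n + 1)) :
    tderiv F X p w = fderiv ℝ (inChart X p) (chartAt (Euc n) p p) (coordVec F p w) := by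
  rw [tderiv_eq_chartTderiv hF hX p (mem_chart_source _ p)]
  rfl

lemma differentiableAt_inChart {X : M → W} {p : M}
    (hX : MDifferentiableAt (𝓡 n) 𝓘(ℝ, W) X p) :
    DifferentiableAt ℝ (inChart X p) (chartAt (Euc n) p p) := by
  rw [← mdifferentiableAt_iff_differentiableAt]
  have hp := mem_chart_source (Euc n) p
  apply MDifferentiableAt.comp (I' := 𝓡 n)
  · rwa [(chartAt (Euc n) p).left_inv hp]
  · exact (mdifferentiable_chart (I := 𝓡 n) p).mdifferentiableAt_symm
      ((chartAt (Euc n) p).map_source hp)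

end TangentialDerivative

/-! ### Shape operator, Codazzi equation, and the drift equation for the components of the normal.
-/

section Geometry

variable {n : ℕ} {M : Type u} [TopologicalSpace M] [ChartedSpace (Euc n) M]
  [IsManifold (𝓡 n) ∞ M] {F N : M → Euc (n + 1)} {p : M}

section Rules

variable {W W' : Type*} [NormedAddCommGroup W] [NormedSpace ℝ W]
  [NormedAddCommGroup W'] [NormedSpace ℝ W']

lemma tderiv_const (c : W) : tderiv F (fun _ : M => c) p = 0 := by
  rw [tderiv, coordDeriv, mfderiv_const]
  exact ContinuousLinearMap.zero_comp _

lemma tderiv_comp (hF : IsProperImmersion n F) {g : W → W'} {X : M → W}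
    (hg : DifferentiableAt ℝ g (X p)) (hX : MDifferentiableAt (𝓡 n) 𝓘(ℝ, W) X p) :
    tderiv F (fun q => g (X q)) p = fderiv ℝ g (X p) ∘L tderiv F X p := by
  ext w
  have h : inChart X p (chartAt (Euc n) p p) = X p := inChart_apply_self (n := n) X p
  have hgX : MDifferentiableAt (𝓡 n) 𝓘(ℝ, W') (fun q => g (X q)) p :=
    hg.mdifferentiableAt.comp p hX
  rw [tderiv_apply hF hgX, ContinuousLinearMap.comp_apply, tderiv_apply hF hX]
  have hg' : DifferentiableAt ℝ g (inChart X p (chartAt (Euc n) p p)) := by rwa [h]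
  have := fderiv_comp (chartAt (Euc n) p p) hg' (differentiableAt_inChart hX)
  rw [h] at this
  exact congrArg (fun A => A (coordVec F p w)) this

lemma tderiv_prodMk (hF : IsProperImmersion n F) {X : M → W} {Y : M → W'}
    (hX : MDifferentiableAt (𝓡 n) 𝓘(ℝ, W) X p) (hY : MDifferentiableAt (𝓡 n) 𝓘(ℝ, W') Y p) :
    tderiv F (fun q => (X q, Y q)) p = (tderiv F X p).prod (tderiv F Y p) := by
  have hXY : MDifferentiableAt (𝓡 n) 𝓘(ℝ, W × W') (fun q => (X q, Y q)) p :=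
    hX.prodMk_space hY
  ext1 w
  rw [tderiv_apply hF hXY, ContinuousLinearMap.prod_apply, tderiv_apply hF hX,
    tderiv_apply hF hY]
  have := (differentiableAt_inChart hX).fderiv_prodMk (differentiableAt_inChart hY)
  exact congrArg (fun A => A (coordVec F p w)) this

/-- The one product rule from which those for inner products, scalar multiples, products and
evaluation of operators are read off. -/
lemma tderiv_bilinear {W'' : Type*} [NormedAddCommGroup W''] [NormedSpace ℝ W'']
    (hF : IsProperImmersion n F) (B : W →L[ℝ] W' →L[ℝ] W'') {X : M → W} {Y : M → W'}
    (hX : MDifferentiableAt (𝓡 n) 𝓘(ℝ, W) X p) (hY : MDifferentiableAt (𝓡 n) 𝓘(ℝ, W') Y p)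
    (w : Euc (n + 1)) :
    tderiv F (fun q => B (X q) (Y q)) p w =
      B (tderiv F X p w) (Y p) + B (X p) (tderiv F Y p w) := by
  have hB := B.isBoundedBilinearMap
  have hXY : MDifferentiableAt (𝓡 n) 𝓘(ℝ, W × W') (fun q => (X q, Y q)) p :=
    hX.prodMk_space hY
  have h := tderiv_comp hF (g := fun z : W × W' => B z.1 z.2)
    (hB.differentiableAt (X p, Y p)) hXY
  rw [h, tderiv_prodMk hF hX hY, hB.fderiv]
  simp [IsBoundedBilinearMap.deriv, add_comm]

variable {V : Type*} [NormedAddCommGroup V] [InnerProductSpace ℝ V]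

lemma tderiv_inner (hF : IsProperImmersion n F) {X Y : M → V}
    (hX : MDifferentiableAt (𝓡 n) 𝓘(ℝ, V) X p) (hY : MDifferentiableAt (𝓡 n) 𝓘(ℝ, V) Y p)
    (w : Euc (n + 1)) :
    tderiv F (fun q => ⟪X q, Y q⟫) p w = ⟪tderiv F X p w, Y p⟫ + ⟪X p, tderiv F Y p w⟫ :=
  tderiv_bilinear hF (innerSL ℝ) hX hY w

lemma tderiv_smul (hF : IsProperImmersion n F) {f : M → ℝ} {X : M → W}
    (hf : MDifferentiableAt (𝓡 n) 𝓘(ℝ, ℝ) f p) (hX : MDifferentiableAt (𝓡 n) 𝓘(ℝ, W) X p)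
    (w : Euc (n + 1)) :
    tderiv F (fun q => f q • X q) p w = tderiv F f p w • X p + f p • tderiv F X p w :=
  tderiv_bilinear hF (ContinuousLinearMap.lsmul ℝ ℝ) hf hX w

lemma tderiv_mul (hF : IsProperImmersion n F) {f g : M → ℝ}
    (hf : MDifferentiableAt (𝓡 n) 𝓘(ℝ, ℝ) f p) (hg : MDifferentiableAt (𝓡 n) 𝓘(ℝ, ℝ) g p)
    (w : Euc (n + 1)) :
    tderiv F (fun q => f q * g q) p w = tderiv F f p w * g p + f p * tderiv F g p w :=
  tderiv_bilinear hF (ContinuousLinearMap.mul ℝ ℝ) hf hg w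

lemma tderiv_clm_apply (hF : IsProperImmersion n F) {A : M → W →L[ℝ] W'} {X : M → W}
    (hA : MDifferentiableAt (𝓡 n) 𝓘(ℝ, W →L[ℝ] W') A p)
    (hX : MDifferentiableAt (𝓡 n) 𝓘(ℝ, W) X p) (w : Euc (n + 1)) :
    tderiv F (fun q => A q (X q)) p w = tderiv F A p w (X p) + A p (tderiv F X p w) :=
  tderiv_bilinear hF (ContinuousLinearMap.id ℝ (W →L[ℝ] W')) hA hX w

lemma tderiv_add (hF : IsProperImmersion n F) {X Y : M → W}
    (hX : MDifferentiableAt (𝓡 n) 𝓘(ℝ, W) X p) (hY : MDifferentiableAt (𝓡 n) 𝓘(ℝ, W) Y p) :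
    tderiv F (fun q => X q + Y q) p = tderiv F X p + tderiv F Y p := by
  have hXY : MDifferentiableAt (𝓡 n) 𝓘(ℝ, W × W) (fun q => (X q, Y q)) p :=
    hX.prodMk_space hY
  let g : W × W →L[ℝ] W := ContinuousLinearMap.fst ℝ W W + ContinuousLinearMap.snd ℝ W W
  have h := tderiv_comp hF (g := g) g.differentiableAt hXY
  rw [g.fderiv, tderiv_prodMk hF hX hY] at h
  exact h

end Rules

lemma injective_coordDeriv (hF : IsProperImmersion n F) (p : M) :
    Function.Injective (coordDeriv n F p) :=
  hF.injective_mfderiv p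

lemma inner_coordDeriv_normal (hN : IsUnitNormal F N) (p : M) (v : Euc n) :
    ⟪N p, coordDeriv n F p v⟫ = 0 := by
  rw [clm_eq_sum, inner_sum]
  refine Finset.sum_eq_zero fun i _ => ?_
  rw [inner_smul_right, show coordDeriv n F p (EuclideanSpace.single i 1) = pderiv F p i from rfl,
    hN.normal, mul_zero]

/-- The tangent space has dimension n in ℝ^{n+1}, so its orthogonal complement is a line, spanned by
`N p`. -/
lemma eq_smul_normal (hF : IsProperImmersion n F) (hN : IsUnitNormal F N) {z : Euc (n + 1)}
    (hz : ∀ v, ⟪z, coordDeriv n F p v⟫ = 0) : z = ⟪N p, z⟫ • N p := by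
  let R : Submodule ℝ (Euc (n + 1)) := LinearMap.range (coordDeriv n F p : Euc n →ₗ[ℝ] Euc (n + 1))
  have hR : Module.finrank ℝ R = n := by
    rw [LinearMap.finrank_range_of_inj (injective_coordDeriv hF p)]; simp
  have hR' : Module.finrank ℝ Rᗮ = 1 := by
    have := R.finrank_add_finrank_orthogonal
    simp only [finrank_euclideanSpace, Fintype.card_fin] at this
    omega
  have hmem : ∀ z : Euc (n + 1), (∀ v, ⟪z, coordDeriv n F p v⟫ = 0) → z ∈ Rᗮ := by
    rintro z hz
    rw [Submodule.mem_orthogonal']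
    rintro _ ⟨v, rfl⟩
    exact hz v
  have hN0 : N p ≠ 0 := by
    intro h
    have := hN.norm_eq_one p
    simp [h] at this
  have hNR : N p ∈ Rᗮ := hmem _ (inner_coordDeriv_normal hN p)
  obtain ⟨c, hc⟩ := (finrank_eq_one_iff_of_nonzero' (⟨N p, hNR⟩ : Rᗮ)
    (by simpa using hN0)).1 hR' ⟨z, hmem z hz⟩
  have hc' : c • N p = z := congrArg Subtype.val hc
  rw [← hc', inner_smul_right, real_inner_self_eq_norm_sq, hN.norm_eq_one]
  simp

/-- In other words, `tderiv F F p` is the orthogonal projection to the tangent space. -/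
lemma tderiv_self_add_normal (hF : IsProperImmersion n F) (hN : IsUnitNormal F N) (p : M)
    (w : Euc (n + 1)) : tderiv F F p w + ⟪N p, w⟫ • N p = w := by
  have h : ∀ v, ⟪w - tderiv F F p w, coordDeriv n F p v⟫ = 0 := by
    intro v
    rw [inner_sub_left, tderiv, ContinuousLinearMap.comp_apply,
      inner_map_pinv (injective_coordDeriv hF p), sub_self]
  have h1 := eq_smul_normal hF hN h
  have h2 : ⟪N p, w - tderiv F F p w⟫ = ⟪N p, w⟫ := by
    rw [inner_sub_right, tderiv, ContinuousLinearMap.comp_apply, inner_coordDeriv_normal hN,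
      sub_zero]
  rw [h2] at h1
  rw [← h1]; abel

lemma tderiv_normal {W : Type*} [NormedAddCommGroup W] [NormedSpace ℝ W] (hN : IsUnitNormal F N)
    (X : M → W) (p : M) : tderiv F X p (N p) = 0 := by
  rw [tderiv, ContinuousLinearMap.comp_apply,
    pinv_apply_eq_zero (inner_coordDeriv_normal hN p), map_zero]

lemma inner_normal_tderiv_self (hN : IsUnitNormal F N) (p : M) (w : Euc (n + 1)) :
    ⟪N p, tderiv F F p w⟫ = 0 := inner_coordDeriv_normal hN p _

lemma IsUnitNormal.mdifferentiableAt (hN : IsUnitNormal F N) (p : M) :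
    MDifferentiableAt (𝓡 n) 𝓘(ℝ, Euc (n + 1)) N p := hN.smooth.mdifferentiableAt (by simp)

lemma IsProperImmersion.mdifferentiableAt (hF : IsProperImmersion n F) (p : M) :
    MDifferentiableAt (𝓡 n) 𝓘(ℝ, Euc (n + 1)) F p := hF.smooth.mdifferentiableAt (by simp)

lemma inner_shape_normal (hF : IsProperImmersion n F) (hN : IsUnitNormal F N) (p : M)
    (w : Euc (n + 1)) : ⟪tderiv F N p w, N p⟫ = 0 := by
  have h := tderiv_inner hF (hN.mdifferentiableAt p) (hN.mdifferentiableAt p) w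
  have h1 : (fun q => ⟪N q, N q⟫) = fun _ : M => (1 : ℝ) := by
    funext q; rw [real_inner_self_eq_norm_sq, hN.norm_eq_one]; norm_num
  rw [h1, tderiv_const, real_inner_comm (tderiv F N p w)] at h
  have h' : (0 : ℝ) = ⟪tderiv F N p w, N p⟫ + ⟪tderiv F N p w, N p⟫ := h
  linarith

lemma inner_normal_shape (hF : IsProperImmersion n F) (hN : IsUnitNormal F N) (p : M)
    (w : Euc (n + 1)) : ⟪N p, tderiv F N p w⟫ = 0 := by
  rw [real_inner_comm, inner_shape_normal hF hN]

lemma isSymmSndFDerivAt_inChart {W : Type*} [NormedAddCommGroup W] [NormedSpace ℝ W] {X : M → W}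
    (hX : ContMDiff (𝓡 n) 𝓘(ℝ, W) ∞ X) (p : M) :
    IsSymmSndFDerivAt ℝ (inChart X p) (chartAt (Euc n) p p) :=
  ((contDiffOn_inChart hX p).contDiffAt ((chartAt (Euc n) p).open_target.mem_nhds
    ((chartAt (Euc n) p).map_source (mem_chart_source _ p)))).isSymmSndFDerivAt
      (by simpa using WithTop.coe_le_coe.2 (le_top : (2 : ℕ∞) ≤ ⊤))

lemma differentiableAt_fderiv_inChart {W : Type*} [NormedAddCommGroup W] [NormedSpace ℝ W]
    {X : M → W} (hX : ContMDiff (𝓡 n) 𝓘(ℝ, W) ∞ X) (p : M) :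
    DifferentiableAt ℝ (fderiv ℝ (inChart X p)) (chartAt (Euc n) p p) :=
  ((contDiffOn_fderiv_inChart hX p).contDiffAt ((chartAt (Euc n) p).open_target.mem_nhds
    ((chartAt (Euc n) p).map_source (mem_chart_source _ p)))).differentiableAt (by simp)

/-- The shape operator is symmetric. -/
lemma inner_shape_comm (hF : IsProperImmersion n F) (hN : IsUnitNormal F N) (p : M)
    (a b : Euc (n + 1)) : ⟪tderiv F N p a, b⟫ = ⟪a, tderiv F N p b⟫ := by
  set e := chartAt (Euc n) p with he
  set y := e p with hy
  have hyt : y ∈ e.target := e.map_source (mem_chart_source _ p)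
  -- Differentiating ⟨N, ∂F⟩ = 0 expresses A through the second derivatives of F, which are
  -- symmetric.
  have key : ∀ ξ η : Euc n, ⟪fderiv ℝ (inChart N p) y ξ, fderiv ℝ (inChart F p) y η⟫ =
      - ⟪N p, fderiv ℝ (fderiv ℝ (inChart F p)) y ξ η⟫ := by
    intro ξ η
    have h1 : (fun z => ⟪inChart N p z, fderiv ℝ (inChart F p) z η⟫) =ᶠ[nhds y]
        fun _ => (0 : ℝ) := by
      filter_upwards [e.open_target.mem_nhds hyt] with z hz
      have hs := e.map_target hz
      have h2 := coordDeriv_eq_fderiv_comp (hF.mdifferentiableAt (e.symm z)) p hs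
      obtain ⟨v, hv⟩ := (isInvertible_mfderiv_chartAt hs).surjective η
      have h3 := inner_coordDeriv_normal hN (e.symm z) v
      rw [h2, ContinuousLinearMap.comp_apply, hv, e.right_inv hz] at h3
      exact h3
    have h4 := (differentiableAt_inChart (hN.mdifferentiableAt p)).hasFDerivAt.inner ℝ
      ((differentiableAt_fderiv_inChart hF.smooth p).hasFDerivAt.clm_apply
        (hasFDerivAt_const (𝕜 := ℝ) η y))
    have h5 := h1.fderiv_eq (𝕜 := ℝ)
    rw [fderiv_fun_const] at h5
    have h6 := h4.fderiv
    rw [h5] at h6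
    have h7 := congrArg (fun A => A ξ) h6
    simp at h7
    exact eq_neg_of_add_eq_zero_right h7.symm
  have hsym := isSymmSndFDerivAt_inChart hF.smooth p
  have key2 : ∀ a b, ⟪tderiv F N p a, tderiv F F p b⟫ = ⟪tderiv F F p a, tderiv F N p b⟫ := by
    intro a b
    rw [real_inner_comm _ (tderiv F F p a), tderiv_apply hF (hN.mdifferentiableAt p),
      tderiv_apply hF (hN.mdifferentiableAt p), tderiv_apply hF (hF.mdifferentiableAt p),
      tderiv_apply hF (hF.mdifferentiableAt p), key, key, hsym.eq]
  have hb := tderiv_self_add_normal hF hN p b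
  have ha := tderiv_self_add_normal hF hN p a
  calc ⟪tderiv F N p a, b⟫ = ⟪tderiv F N p a, tderiv F F p b⟫ := by
        conv_lhs => rw [← hb]
        rw [inner_add_right, inner_smul_right, inner_shape_normal hF hN, mul_zero, add_zero]
    _ = ⟪tderiv F F p a, tderiv F N p b⟫ := key2 a b
    _ = ⟪a, tderiv F N p b⟫ := by
        conv_rhs => rw [← ha]
        rw [inner_add_left, inner_smul_left, inner_normal_shape hF hN, mul_zero, add_zero]

/-- The Codazzi equation. -/
lemma codazzi (hF : IsProperImmersion n F) (hN : IsUnitNormal F N) (p : M)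
    (a b : Euc (n + 1)) :
    tderiv F (tderiv F N) p a (tderiv F F p b) = tderiv F (tderiv F N) p b (tderiv F F p a) := by
  set e := chartAt (Euc n) p with he
  set y := e p with hy
  have hyt : y ∈ e.target := e.map_source (mem_chart_source _ p)
  have hS := contMDiff_tderiv hF hN.smooth
  have hSd : MDifferentiableAt (𝓡 n) 𝓘(ℝ, Euc (n + 1) →L[ℝ] Euc (n + 1)) (tderiv F N) p :=
    hS.mdifferentiableAt (by simp)
  -- In coordinates S ∘ dF = dN. Differentiating this relation gives (dS)(dF) = d²N - S(d²F), whose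
  -- right-hand side is symmetric.
  have h1 : (fun z => inChart (tderiv F N) p z ∘L fderiv ℝ (inChart F p) z) =ᶠ[nhds y]
      fderiv ℝ (inChart N p) := by
    filter_upwards [e.open_target.mem_nhds hyt] with z hz
    have hs := e.map_target hz
    simp only [inChart, Function.comp_apply]
    rw [tderiv_eq_chartTderiv hF (hN.mdifferentiableAt _) p hs, e.right_inv hz, chartTderiv,
      ContinuousLinearMap.comp_assoc]
    have := pinv_comp_self (injective_fderiv_inChart hF hz)
    simp only [inChart] at this
    rw [this, ContinuousLinearMap.comp_id]
  have h2 := (differentiableAt_inChart hSd).hasFDerivAt.clm_comp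
    (differentiableAt_fderiv_inChart hF.smooth p).hasFDerivAt
  have h3 := h1.fderiv_eq (𝕜 := ℝ)
  rw [h2.fderiv] at h3
  have key : ∀ ξ η : Euc n, fderiv ℝ (inChart (tderiv F N) p) y ξ (fderiv ℝ (inChart F p) y η) =
      fderiv ℝ (fderiv ℝ (inChart N p)) y ξ η -
        tderiv F N p (fderiv ℝ (fderiv ℝ (inChart F p)) y ξ η) := by
    intro ξ η
    have h4 := congrArg (fun A => A ξ η) h3
    simp only [add_apply, ContinuousLinearMap.comp_apply,
      ContinuousLinearMap.compL_apply, ContinuousLinearMap.flip_apply] at h4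
    have h5 : inChart (tderiv F N) p y = tderiv F N p := inChart_apply_self (n := n) _ p
    rw [h5] at h4
    rw [← h4]
    abel
  rw [tderiv_apply hF hSd, tderiv_apply hF hSd, tderiv_apply hF (hF.mdifferentiableAt p),
    tderiv_apply hF (hF.mdifferentiableAt p), key, key,
    (isSymmSndFDerivAt_inChart hF.smooth p).eq, (isSymmSndFDerivAt_inChart hN.smooth p).eq]

lemma gradient_eq_toDual_symm (hF : IsProperImmersion n F) (f : M → ℝ) (p : M) :
    gradient F f p = (InnerProductSpace.toDual ℝ (Euc (n + 1))).symm (tderiv F f p) := by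
  apply ext_inner_right ℝ
  intro w
  rw [inner_gradient (injective_coordDeriv hF p), InnerProductSpace.toDual_symm_apply]

lemma contMDiff_gradient (hF : IsProperImmersion n F) {f : M → ℝ}
    (hf : ContMDiff (𝓡 n) 𝓘(ℝ, ℝ) ∞ f) :
    ContMDiff (𝓡 n) 𝓘(ℝ, Euc (n + 1)) ∞ (gradient F f) := by
  have h : gradient F f =
      (InnerProductSpace.toDual ℝ (Euc (n + 1))).symm ∘ tderiv F f := by
    funext p; exact gradient_eq_toDual_symm hF f p
  rw [h]
  exact (InnerProductSpace.toDual ℝ (Euc (n + 1))).symm.toContinuousLinearEquiv.contDiff.contMDiff.comp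
    (contMDiff_tderiv hF hf)

lemma tderiv_self_gradient (hF : IsProperImmersion n F) (hN : IsUnitNormal F N) (f : M → ℝ)
    (p : M) : tderiv F F p (gradient F f p) = gradient F f p := by
  have h := tderiv_self_add_normal hF hN p (gradient F f p)
  rwa [real_inner_comm, inner_gradient (injective_coordDeriv hF p), tderiv_normal hN, zero_smul,
    add_zero] at h

lemma contMDiff_inner_normal (hN : IsUnitNormal F N) (v : Euc (n + 1)) :
    ContMDiff (𝓡 n) 𝓘(ℝ, ℝ) ∞ (fun q => ⟪v, N q⟫) :=
  (innerSL ℝ v).contDiff.contMDiff.comp hN.smooth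

/-- The derivative of ⟨v, N⟩ along w is ⟨v, S w⟩, and S is self-adjoint. -/
lemma gradient_inner_normal (hF : IsProperImmersion n F) (hN : IsUnitNormal F N)
    (v : Euc (n + 1)) (p : M) : gradient F (fun q => ⟪v, N q⟫) p = tderiv F N p v := by
  apply ext_inner_right ℝ
  intro w
  rw [inner_gradient (injective_coordDeriv hF p),
    tderiv_inner hF mdifferentiableAt_const (hN.mdifferentiableAt p), tderiv_const,
    inner_shape_comm hF hN]
  simp

lemma normSqA_eq_sum (hF : IsProperImmersion n F) (hN : IsUnitNormal F N) (p : M)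
    {ι : Type*} [Fintype ι] (b : OrthonormalBasis ι ℝ (Euc (n + 1))) :
    normSqA F N p = ∑ i, ‖tderiv F N p (b i)‖ ^ 2 := by
  rw [normSqA_eq_trace (injective_coordDeriv hF p), traceCLM_eq_sum b]
  · refine Finset.sum_congr rfl fun i _ => ?_
    rw [ContinuousLinearMap.comp_apply, ContinuousLinearMap.adjoint_inner_right,
      real_inner_self_eq_norm_sq]
  · intro v
    have h1 : coordDeriv n N p v = tderiv F N p (coordDeriv n F p v) := by
      rw [tderiv, ContinuousLinearMap.comp_apply, pinv_apply_map (injective_coordDeriv hF p)]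
    have h2 := tderiv_self_add_normal hF hN p (coordDeriv n N p v)
    rw [h1, real_inner_comm, inner_shape_normal hF hN, zero_smul, add_zero, ← h1] at h2
    exact h2

/-- The operator norm is bounded by the Hilbert–Schmidt norm. Together with `gradient_inner_normal`
this gives |∇⟨v, N⟩|² ≤ |A|²|v|². -/
lemma norm_shape_sq_le (hF : IsProperImmersion n F) (hN : IsUnitNormal F N) (p : M)
    (v : Euc (n + 1)) : ‖tderiv F N p v‖ ^ 2 ≤ normSqA F N p * ‖v‖ ^ 2 := by
  let b := EuclideanSpace.basisFun (Fin (n + 1)) ℝ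
  rw [normSqA_eq_sum hF hN p b, ← b.sum_sq_norm_inner_right (tderiv F N p v), Finset.sum_mul]
  refine Finset.sum_le_sum fun i _ => ?_
  rw [← inner_shape_comm hF hN, ← mul_pow]
  exact pow_le_pow_left₀ (norm_nonneg _) (norm_inner_le_norm _ _) 2

/-- The drift Laplacian `Δu - (1/2) ∇_{x^T} u`. -/
def driftLaplacian (F : M → Euc (n + 1)) (f : M → ℝ) (p : M) : ℝ :=
  laplacian F f p - (1 / 2) * ⟪F p, gradient F f p⟫

lemma jacobiOp_eq (F N : M → Euc (n + 1)) (f : M → ℝ) (p : M) :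
    jacobiOp F N f p = driftLaplacian F f p + normSqA F N p * f p + (1 / 2) * f p := rfl

/-- The components of the normal of a hypersurface with `H = ⟨x, N⟩ / 2 + C` are solutions of the
drift equation. -/
lemma driftLaplacian_inner_normal (hF : IsProperImmersion n F) (hN : IsUnitNormal F N) {C : ℝ}
    (hH : ∀ p, meanCurvature F N p = ⟪F p, N p⟫ / 2 + C) (v : Euc (n + 1)) (p : M) :
    driftLaplacian F (fun q => ⟪v, N q⟫) p = - normSqA F N p * ⟪v, N p⟫ := by
  let b := EuclideanSpace.basisFun (Fin (n + 1)) ℝ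
  have hS := contMDiff_tderiv hF hN.smooth
  have hSd : MDifferentiableAt (𝓡 n) 𝓘(ℝ, Euc (n + 1) →L[ℝ] Euc (n + 1)) (tderiv F N) p :=
    hS.mdifferentiableAt (by simp)
  set D := tderiv F (tderiv F N) p with hD
  have hgrad : gradient F (fun q => ⟪v, N q⟫) = fun q => tderiv F N q v :=
    funext fun q => gradient_inner_normal hF hN v q
  -- derivative of `S N = 0`
  have hDN : ∀ w, D w (N p) = - tderiv F N p (tderiv F N p w) := by
    intro w
    have h := tderiv_clm_apply hF hSd (hN.mdifferentiableAt p) w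
    have h0 : (fun q => tderiv F N q (N q)) = fun _ => 0 := funext fun q => tderiv_normal hN N q
    rw [h0, tderiv_const] at h
    exact eq_neg_of_add_eq_zero_left h.symm
  have hlap : laplacian F (fun q => ⟪v, N q⟫) p = ∑ i, ⟪b i, D (b i) v⟫ := by
    rw [laplacian, hgrad, divergence_eq_trace (injective_coordDeriv hF p), traceCLM_eq_sum b]
    refine Finset.sum_congr rfl fun i _ => ?_
    rw [tderiv_clm_apply hF hSd mdifferentiableAt_const, tderiv_const]
    simp [hD]
  -- derivative of the mean curvature
  have hDH : ∀ w, traceCLM _ (D w) = (1 / 2) * ⟪F p, tderiv F N p w⟫ := by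
    intro w
    have h1 : (fun q => traceCLM (Euc (n + 1)) (tderiv F N q)) =
        fun q => ⟪((1 : ℝ) / 2) • F q, N q⟫ + C := by
      funext q
      rw [← divergence_eq_trace (injective_coordDeriv hF q), inner_smul_left]
      exact (hH q).trans (by simp; ring)
    have h2 := tderiv_comp hF (g := traceCLM (Euc (n + 1))) (p := p)
      (traceCLM (Euc (n + 1))).differentiableAt hSd
    rw [(traceCLM (Euc (n + 1))).fderiv, h1] at h2
    have hF2 : MDifferentiableAt (𝓡 n) 𝓘(ℝ, Euc (n + 1)) (fun q => ((1 : ℝ) / 2) • F q) p :=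
      (hF.mdifferentiableAt p).const_smul _
    have hin : MDifferentiableAt (𝓡 n) 𝓘(ℝ, ℝ) (fun q => ⟪((1 : ℝ) / 2) • F q, N q⟫) p :=
      ((contDiff_inner (𝕜 := ℝ) (E := Euc (n + 1)) (n := 1)).differentiable
        (by simp) _).mdifferentiableAt.comp p (hF2.prodMk_space (hN.mdifferentiableAt p))
    rw [tderiv_add hF hin mdifferentiableAt_const, tderiv_const, add_zero] at h2
    have h3 := congrArg (fun A => A w) h2
    simp only [ContinuousLinearMap.comp_apply] at h3
    rw [← hD] at h3
    rw [← h3, tderiv_inner hF hF2 (hN.mdifferentiableAt p),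
      tderiv_smul hF mdifferentiableAt_const (hF.mdifferentiableAt p), tderiv_const]
    simp only [zero_apply, zero_smul, zero_add, inner_smul_left, conj_trivial]
    rw [real_inner_comm, inner_normal_tderiv_self hN]
    ring
  -- For the tangential part of v, Codazzi exchanges the two arguments of D = dS and turns the sum
  -- into the derivative of H along v. The correction term from the normal component of `b i`
  -- vanishes because S has tangential values.
  have htan : ∑ i, ⟪b i, D (b i) (tderiv F F p v)⟫ = (1 / 2) * ⟪F p, tderiv F N p v⟫ := by
    have h1 : ∀ i, ⟪b i, D (b i) (tderiv F F p v)⟫ =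
        ⟪b i, D v (b i)⟫ + ⟪N p, b i⟫ * ⟪b i, tderiv F N p (tderiv F N p v)⟫ := by
      intro i
      rw [hD, codazzi hF hN, ← hD]
      have h2 : tderiv F F p (b i) = b i - ⟪N p, b i⟫ • N p :=
        eq_sub_of_add_eq (tderiv_self_add_normal hF hN p (b i))
      rw [h2, map_sub, map_smul, hDN, inner_sub_right, inner_smul_right, inner_neg_right]
      ring
    simp only [h1]
    rw [Finset.sum_add_distrib, ← traceCLM_eq_sum b, hDH, b.sum_inner_mul_inner,
      inner_normal_shape hF hN, add_zero]
  -- For the normal part, differentiating S N = 0 gives D w N = -S(S w), whose trace is -|A|².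
  have hnor : ∑ i, ⟪b i, D (b i) (N p)⟫ = - normSqA F N p := by
    rw [normSqA_eq_sum hF hN p b, ← Finset.sum_neg_distrib]
    refine Finset.sum_congr rfl fun i _ => ?_
    rw [hDN, inner_neg_right, ← inner_shape_comm hF hN, real_inner_self_eq_norm_sq]
  rw [driftLaplacian, hlap, hgrad]
  have hv := tderiv_self_add_normal hF hN p v
  have h4 : ∀ i, ⟪b i, D (b i) v⟫ = ⟪b i, D (b i) (tderiv F F p v)⟫ +
      ⟪N p, v⟫ * ⟪b i, D (b i) (N p)⟫ := by
    intro i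
    conv_lhs => rw [← hv]
    rw [map_add, map_smul, inner_add_right, inner_smul_right]
  simp only [h4]
  rw [Finset.sum_add_distrib, ← Finset.mul_sum, htan, hnor, real_inner_comm v]
  ring

end Geometry

/-! ### The area measure in charts. -/

section Area

variable {n : ℕ} {M : Type u} [TopologicalSpace M] [ChartedSpace (Euc n) M]
  [IsManifold (𝓡 n) ∞ M] {F N : M → Euc (n + 1)}

lemma chartDensity_eq (F : M → Euc (n + 1)) (x : M) (y : Euc n) :
    chartDensity F x y = √(gramDet (fderiv ℝ (inChart F x) y)) := by
  have := gramDet_eq_det_gram (EuclideanSpace.basisFun (Fin n) ℝ) (fderiv ℝ (inChart F x) y)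
  simp only [EuclideanSpace.basisFun_apply] at this
  rw [this]
  rfl

lemma chartDensity_pos (hF : IsProperImmersion n F) {x : M} {y : Euc n}
    (hy : y ∈ (chartAt (Euc n) x).target) : 0 < chartDensity F x y := by
  rw [chartDensity_eq]
  exact Real.sqrt_pos.2 (gramDet_pos (injective_fderiv_inChart hF hy))

lemma contDiffOn_chartDensity (hF : IsProperImmersion n F) (x : M) :
    ContDiffOn ℝ ∞ (chartDensity F x) (chartAt (Euc n) x).target := by
  have h : chartDensity F x = fun y => √(gramDet (fderiv ℝ (inChart F x) y)) :=
    funext fun y => chartDensity_eq F x y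
  rw [h]
  exact (contDiff_gramDet.comp_contDiffOn (contDiffOn_fderiv_inChart hF.smooth x)).sqrt
    fun y hy => (gramDet_pos (injective_fderiv_inChart hF hy)).ne'

/-- Countability of the topology is not assumed; properness supplies it through the preimages of
balls, and with it countable covers by charts and partitions of unity. -/
lemma sigmaCompactSpace_of_proper (hF : IsProperImmersion n F) : SigmaCompactSpace M := by
  refine ⟨⟨fun k : ℕ => F ⁻¹' Metric.closedBall 0 k, fun k =>
    hF.proper.isCompact_preimage (isCompact_closedBall _ _), ?_⟩⟩
  rw [← Set.preimage_iUnion, Metric.iUnion_closedBall_nat, Set.preimage_univ]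

variable [MeasurableSpace M] [BorelSpace M]

lemma aemeasurable_chartAt_symm (x : M) (μ : Measure (Euc n)) :
    AEMeasurable (chartAt (Euc n) x).symm (μ.restrict (chartAt (Euc n) x).target) :=
  (chartAt (Euc n) x).continuousOn_symm.aemeasurable
    (chartAt (Euc n) x).open_target.measurableSet

lemma chartArea_apply (F : M → Euc (n + 1)) (x : M) {A : Set M} (hA : MeasurableSet A) :
    chartArea F x A = ∫⁻ y in (chartAt (Euc n) x).symm ⁻¹' A ∩ (chartAt (Euc n) x).target,
      ENNReal.ofReal (chartDensity F x y) := by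
  rw [chartArea, Measure.map_apply_of_aemeasurable (aemeasurable_chartAt_symm x _) hA,
    Measure.restrict_apply' (chartAt (Euc n) x).open_target.measurableSet,
    withDensity_apply']

lemma chartArea_inter_source (F : M → Euc (n + 1)) (x : M) {A : Set M} (hA : MeasurableSet A) :
    chartArea F x (A ∩ (chartAt (Euc n) x).source) = chartArea F x A := by
  rw [chartArea_apply F x hA,
    chartArea_apply F x (hA.inter (chartAt (Euc n) x).open_source.measurableSet)]
  congr 2
  ext y
  simp only [Set.mem_inter_iff, Set.mem_preimage]
  exact ⟨fun h => ⟨h.1.1, h.2⟩, fun h => ⟨⟨h.1, (chartAt (Euc n) x).map_target h.2⟩, h.2⟩⟩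

lemma measurableSet_preimage_chartAt_symm (x : M) {A : Set M} (hA : MeasurableSet A) :
    MeasurableSet ((chartAt (Euc n) x).symm ⁻¹' A ∩ (chartAt (Euc n) x).target) := by
  set e := chartAt (Euc n) x
  have h : Continuous (e.target.domRestrict e.symm) := e.continuousOn_symm.domRestrict
  have h1 := e.open_target.measurableSet.subtype_image (h.measurable hA)
  convert! h1 using 1
  ext y
  simp [and_comm]

/-- The area measures of two charts agree on the overlap. -/
lemma chartArea_eq_of_subset (hF : IsProperImmersion n F) (x x' : M) {A : Set M}
    (hA : MeasurableSet A) (h : A ⊆ (chartAt (Euc n) x).source)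
    (h' : A ⊆ (chartAt (Euc n) x').source) : chartArea F x A = chartArea F x' A := by
  rw [chartArea_apply F x hA, chartArea_apply F x' hA]
  set e := chartAt (Euc n) x with he
  set e' := chartAt (Euc n) x' with he'
  set s := e.symm ⁻¹' A ∩ e.target with hs
  have himage : (e' ∘ e.symm) '' s = e'.symm ⁻¹' A ∩ e'.target := by
    ext z
    constructor
    · rintro ⟨y, ⟨hyA, hyt⟩, rfl⟩
      have := h' hyA
      refine ⟨?_, e'.map_source this⟩
      simpa [e'.left_inv this] using hyA
    · rintro ⟨hzA, hzt⟩
      refine ⟨e (e'.symm z), ⟨?_, e.map_source (h hzA)⟩, ?_⟩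
      · simpa [e.left_inv (h hzA)] using hzA
      · simp [e.left_inv (h hzA), e'.right_inv hzt]
  have hdiff : ∀ y ∈ s, DifferentiableAt ℝ (e' ∘ e.symm) y := by
    rintro y ⟨hyA, hyt⟩
    rw [← mdifferentiableAt_iff_differentiableAt]
    exact ((mdifferentiable_chart (I := 𝓡 n) x').mdifferentiableAt (h' hyA)).comp (I' := 𝓡 n) y
      ((mdifferentiable_chart (I := 𝓡 n) x).mdifferentiableAt_symm hyt)
  have hinj : Set.InjOn (e' ∘ e.symm) s := by
    rintro y ⟨hyA, hyt⟩ z ⟨hzA, hzt⟩ hyz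
    exact e.symm.injOn hyt hzt (e'.injOn (h' hyA) (h' hzA) hyz)
  -- Change of variables under the transition map; its Jacobian is accounted for by `gramDet_comp`.
  have hcv := lintegral_image_eq_lintegral_abs_det_fderiv_mul volume
    (measurableSet_preimage_chartAt_symm x hA)
    (fun y hy => (hdiff y hy).hasFDerivAt.hasFDerivWithinAt) hinj
    (fun y => ENNReal.ofReal (chartDensity F x' y))
  rw [← himage, hcv]
  refine setLIntegral_congr_fun (measurableSet_preimage_chartAt_symm x hA) fun y hy => ?_
  have hyt' : e' (e.symm y) ∈ e'.target := e'.map_source (h' hy.1)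
  rw [← ENNReal.ofReal_mul (abs_nonneg _), chartDensity_eq, chartDensity_eq]
  congr 1
  have hFd : DifferentiableAt ℝ (inChart F x') ((e' ∘ e.symm) y) :=
    ((contDiffOn_inChart hF.smooth x').contDiffAt
      (e'.open_target.mem_nhds hyt')).differentiableAt (by simp)
  have hev : inChart F x =ᶠ[nhds y] inChart F x' ∘ (e' ∘ e.symm) := by
    have : e.symm ⁻¹' e'.source ∩ e.target ∈ nhds y := by
      rw [Set.inter_comm]
      exact (e.symm.isOpen_inter_preimage e'.open_source).mem_nhds ⟨hy.2, h' hy.1⟩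
    filter_upwards [this] with z hz
    simp only [inChart, Function.comp_apply]
    rw [← he', e'.left_inv hz.1]
  rw [hev.fderiv_eq, fderiv_comp y hFd (hdiff y hy), gramDet_comp,
    Real.sqrt_mul (sq_nonneg _), Real.sqrt_sq_eq_abs]

/-- A supremum of measures is hard to evaluate from above. The bound comes from a measure ν glued
from countably many chart measures along disjoint pieces: every chart measure is at most ν, so the
supremum is too, and on a chart domain ν agrees with the chart measure. -/
lemma area_inter_source (hF : IsProperImmersion n F) (x : M) {A : Set M}
    (hA : MeasurableSet A) :
    area F (A ∩ (chartAt (Euc n) x).source) = chartArea F x A := by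
  have := sigmaCompactSpace_of_proper hF
  apply le_antisymm
  · obtain ⟨s, hsc, hsu⟩ := countable_cover_nhds_of_sigmaCompact
      (fun x : M => chart_source_mem_nhds (Euc n) x)
    have hsne : s.Nonempty := by
      have : x ∈ ⋃ z ∈ s, (chartAt (Euc n) z).source := hsu ▸ Set.mem_univ x
      simp only [Set.mem_iUnion] at this
      exact ⟨_, this.choose_spec.choose⟩
    obtain ⟨z, rfl⟩ := hsc.exists_eq_range hsne
    let U : ℕ → Set M := fun k => (chartAt (Euc n) (z k)).source
    have hU : ⋃ k, U k = Set.univ := by rw [← hsu]; simp [U]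
    have hUm : ∀ k, MeasurableSet (U k) := fun k =>
      (chartAt (Euc n) (z k)).open_source.measurableSet
    let D : ℕ → Set M := disjointed U
    have hDm : ∀ k, MeasurableSet (D k) := MeasurableSet.disjointed hUm
    have hDU : ∀ k, D k ⊆ U k := disjointed_subset U
    have hD : ⋃ k, D k = Set.univ := by rw [iUnion_disjointed, hU]
    let ν : Measure M := Measure.sum fun k => (chartArea F (z k)).restrict (D k)
    have key : ∀ (x' : M) {A : Set M}, MeasurableSet A →
        chartArea F x' A = ν (A ∩ (chartAt (Euc n) x').source) := by
      intro x' A hA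
      have hAm := hA.inter (chartAt (Euc n) x').open_source.measurableSet
      rw [← chartArea_inter_source F x' hA]
      set B := A ∩ (chartAt (Euc n) x').source
      have hB : B = ⋃ k, B ∩ D k := by rw [← Set.inter_iUnion, hD, Set.inter_univ]
      conv_lhs => rw [hB]
      rw [measure_iUnion, Measure.sum_apply _ hAm]
      · refine tsum_congr fun k => ?_
        rw [Measure.restrict_apply hAm]
        exact chartArea_eq_of_subset hF _ _ (hAm.inter (hDm k))
          (fun q hq => hq.1.2) (fun q hq => hDU k hq.2)
      · exact fun i j hij => ((disjoint_disjointed U) hij).mono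
          Set.inter_subset_right Set.inter_subset_right
      · exact fun k => hAm.inter (hDm k)
    have hle : area F ≤ ν := by
      refine iSup_le fun x' => Measure.le_iff.2 fun A hA => ?_
      rw [key x' hA]
      exact measure_mono Set.inter_subset_left
    calc _ ≤ ν (A ∩ (chartAt (Euc n) x).source) := hle _
      _ = _ := (key x hA).symm
  · rw [← chartArea_inter_source F x hA]
    exact (le_iSup (fun x => chartArea F x) x : chartArea F x ≤ area F) _

lemma area_restrict_source (hF : IsProperImmersion n F) (x : M) :
    (area F).restrict (chartAt (Euc n) x).source = chartArea F x := by
  ext A hA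
  rw [Measure.restrict_apply hA, area_inter_source hF x hA]

/-- The density of the Gaussian area in the coordinates of a chart. -/
def chartWeight (F : M → Euc (n + 1)) (x : M) (y : Euc n) : ℝ :=
  chartDensity F x y * Real.exp (-‖inChart F x y‖ ^ 2 / 4)

lemma continuous_gaussianWeight (hF : IsProperImmersion n F) :
    Continuous fun p => Real.exp (-‖F p‖ ^ 2 / 4) := by
  have := hF.smooth.continuous
  fun_prop

/-- Integration of functions supported in the domain of a chart. -/
lemma integral_gaussianArea_eq (hF : IsProperImmersion n F) (x : M) {f : M → ℝ}
    (hf : Continuous f) (h0 : ∀ p, p ∉ (chartAt (Euc n) x).source → f p = 0) :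
    ∫ p, f p ∂(gaussianArea F) =
      ∫ y in (chartAt (Euc n) x).target, chartWeight F x y * inChart f x y := by
  set e := chartAt (Euc n) x
  have hw := continuous_gaussianWeight hF
  rw [← setIntegral_eq_integral_of_forall_compl_eq_zero h0, gaussianArea,
    restrict_withDensity e.open_source.measurableSet, area_restrict_source hF,
    integral_withDensity_eq_integral_toReal_smul hw.measurable.ennreal_ofReal (by simp),
    chartArea, integral_map (aemeasurable_chartAt_symm x _),
    restrict_withDensity e.open_target.measurableSet,
    integral_withDensity_eq_integral_toReal_smul₀]
  · refine setIntegral_congr_fun e.open_target.measurableSet fun y hy => ?_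
    simp only [smul_eq_mul, chartWeight, inChart, Function.comp_apply]
    rw [ENNReal.toReal_ofReal (chartDensity_pos hF hy).le, ENNReal.toReal_ofReal (Real.exp_pos _).le]
    ring
  · exact ((contDiffOn_chartDensity hF x).continuousOn.aemeasurable
      e.open_target.measurableSet).ennreal_ofReal
  · simp
  · apply Continuous.aestronglyMeasurable
    simp only [ENNReal.toReal_ofReal (Real.exp_pos _).le]
    exact hw.smul hf

/-- Used to see that a continuous function that does not vanish identically has positive L² norm. -/
lemma isOpenPosMeasure_gaussianArea (hF : IsProperImmersion n F) :
    (gaussianArea F).IsOpenPosMeasure := by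
  refine ⟨fun U hU ⟨p, hp⟩ h0 => ?_⟩
  have hw := continuous_gaussianWeight hF
  rw [gaussianArea, withDensity_apply_eq_zero hw.measurable.ennreal_ofReal] at h0
  have h1 : {p | ENNReal.ofReal (Real.exp (-‖F p‖ ^ 2 / 4)) ≠ 0} ∩ U = U := by
    refine Set.inter_eq_right.2 fun q _ => ?_
    simp [Real.exp_pos]
  rw [h1] at h0
  have h2 : chartArea F p U = 0 :=
    le_antisymm (h0 ▸ (le_iSup (fun x => chartArea F x) p : chartArea F p ≤ area F) U) zero_le
  rw [chartArea_apply F p hU.measurableSet] at h2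
  set e := chartAt (Euc n) p
  have hopen : IsOpen (e.symm ⁻¹' U ∩ e.target) := by
    rw [Set.inter_comm]; exact e.symm.isOpen_inter_preimage hU
  rw [setLIntegral_eq_zero_iff' hopen.measurableSet] at h2
  · have h3 : volume (e.symm ⁻¹' U ∩ e.target) = 0 := by
      rw [← nonpos_iff_eq_zero, ← show volume {y | ¬ (y ∈ e.symm ⁻¹' U ∩ e.target →
        ENNReal.ofReal (chartDensity F p y) = 0)} = 0 from h2]
      refine measure_mono fun y hy => ?_
      simp only [Set.mem_ofPred_eq, Classical.not_imp]
      exact ⟨hy, by simpa using chartDensity_pos hF hy.2⟩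
    refine hopen.measure_ne_zero volume ⟨e p, ?_, e.map_source (mem_chart_source _ p)⟩ h3
    simpa [e] using hp
  · exact (((contDiffOn_chartDensity hF p).continuousOn.mono
      Set.inter_subset_right).aemeasurable hopen.measurableSet).ennreal_ofReal

end Area

/-! ### The divergence theorem and integration by parts for the Gaussian area. -/

section DivergenceTheorem

lemma integral_fderiv_apply_eq_zero {V : Type*} [NormedAddCommGroup V] [InnerProductSpace ℝ V]
    [FiniteDimensional ℝ V] [MeasurableSpace V] [BorelSpace V] {f : V → ℝ} (hf : ContDiff ℝ 1 f)
    (hs : HasCompactSupport f) (v : V) : ∫ y, fderiv ℝ f y v = 0 := by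
  have hint : Integrable (fun y => fderiv ℝ f y v) :=
    ((hf.continuous_fderiv (by simp)).clm_apply continuous_const).integrable_of_hasCompactSupport
      (hs.fderiv_apply ℝ v)
  have h := integral_mul_fderiv_eq_neg_fderiv_mul_of_integrable (𝕜 := ℝ)
    (f := fun _ : V => (1 : ℝ)) (g := f) (v := v) (μ := volume) (by simp)
    (by simpa using hint)
    (by simpa using hf.continuous.integrable_of_hasCompactSupport hs)
    (fun _ _ => differentiableAt_const _) (fun y _ => hf.differentiable (by simp) y)
  simpa using h

/-- The divergence theorem for compactly supported vector fields on a Euclidean space. -/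
lemma integral_trace_fderiv_eq_zero {V : Type*} [NormedAddCommGroup V] [InnerProductSpace ℝ V]
    [FiniteDimensional ℝ V] [MeasurableSpace V] [BorelSpace V] {Z : V → V} (hZ : ContDiff ℝ 1 Z)
    (hs : HasCompactSupport Z) : ∫ y, traceCLM V (fderiv ℝ Z y) = 0 := by
  let b := stdOrthonormalBasis ℝ V
  have hcomp : ∀ i, ContDiff ℝ 1 (fun y => ⟪b i, Z y⟫) := fun i => contDiff_const.inner ℝ hZ
  have hsupp : ∀ i, HasCompactSupport (fun y => ⟪b i, Z y⟫) := fun i =>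
    hs.comp_left (g := fun z => ⟪b i, z⟫) (inner_zero_right _)
  have h1 : ∀ y, traceCLM V (fderiv ℝ Z y) = ∑ i, fderiv ℝ (fun y => ⟪b i, Z y⟫) y (b i) := by
    intro y
    rw [traceCLM_eq_sum b]
    refine Finset.sum_congr rfl fun i _ => ?_
    have h := ((innerSL ℝ (b i)).hasFDerivAt.comp y
      (hZ.differentiable (by simp) y).hasFDerivAt).fderiv
    change _ = (fderiv ℝ (innerSL ℝ (b i) ∘ Z) y) (b i)
    rw [h]
    rfl
  simp only [h1]
  rw [integral_finsetSum]
  · exact Finset.sum_eq_zero fun i _ => integral_fderiv_apply_eq_zero (hcomp i) (hsupp i) (b i)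
  · exact fun i _ => (((hcomp i).continuous_fderiv (by simp)).clm_apply
      continuous_const).integrable_of_hasCompactSupport ((hsupp i).fderiv_apply ℝ (b i))

lemma traceCLM_smulRight {V : Type*} [NormedAddCommGroup V] [InnerProductSpace ℝ V]
    [FiniteDimensional ℝ V] (l : V →L[ℝ] ℝ) (X : V) : traceCLM V (l.smulRight X) = l X := by
  let b := stdOrthonormalBasis ℝ V
  rw [traceCLM_eq_sum b]
  conv_rhs => rw [← b.sum_repr' X]
  simp [inner_smul_right, mul_comm]

variable {n : ℕ} {M : Type u} [TopologicalSpace M] [ChartedSpace (Euc n) M]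
  [IsManifold (𝓡 n) ∞ M] {F N : M → Euc (n + 1)}

/-- The logarithmic derivative of the density of the Gaussian area. -/
lemma hasFDerivAt_chartWeight (hF : IsProperImmersion n F) {x : M} {y : Euc n}
    (hy : y ∈ (chartAt (Euc n) x).target) :
    ∃ w' : Euc n →L[ℝ] ℝ, HasFDerivAt (chartWeight F x) w' y ∧ ∀ ξ, w' ξ = chartWeight F x y *
      (traceCLM _ (pinv (fderiv ℝ (inChart F x) y) ∘L
        fderiv ℝ (fderiv ℝ (inChart F x)) y ξ) -
        (1 / 2) * ⟪inChart F x y, fderiv ℝ (inChart F x) y ξ⟫) := by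
  have ht := (chartAt (Euc n) x).open_target.mem_nhds hy
  have hinj := injective_fderiv_inChart hF hy
  have hg := gramDet_pos hinj
  have h1 : HasFDerivAt (inChart F x) _ y :=
    (((contDiffOn_inChart hF.smooth x).contDiffAt ht).differentiableAt (by simp)).hasFDerivAt
  have h2 : HasFDerivAt (fderiv ℝ (inChart F x)) _ y :=
    (((contDiffOn_fderiv_inChart hF.smooth x).contDiffAt ht).differentiableAt
      (by simp)).hasFDerivAt
  have h3 := (((contDiff_gramDet.differentiable (by simp)
    (fderiv ℝ (inChart F x) y)).hasFDerivAt.comp y h2).sqrt hg.ne')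
  have h4 := ((h1.norm_sq.neg.mul_const (1 / 4 : ℝ))).exp
  have h5 := h3.mul h4
  have hw : chartWeight F x = fun y => √(gramDet (fderiv ℝ (inChart F x) y)) *
      Real.exp (-‖inChart F x y‖ ^ 2 * (1 / 4)) := by
    funext z
    rw [chartWeight, chartDensity_eq]
    congr 2
    ring
  refine ⟨_, by rw [hw]; exact h5, fun ξ => ?_⟩
  have hs := Real.sq_sqrt hg.le
  have hs' := (Real.sqrt_pos.2 hg).ne'
  rw [hw]
  simp only [add_apply, smul_apply, ContinuousLinearMap.comp_apply, smul_eq_mul,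
    Function.comp_apply, neg_apply, Pi.neg_apply]
  rw [fderiv_gramDet hinj]
  simp only [innerSL_apply_apply, nsmul_eq_mul]
  field_simp
  rw [hs]
  push_cast
  ring

variable (F) in
/-- The vector field `w X`, where the tangential field `Y` is `dF (X)` in the coordinates of a
chart and `w` is the density of the Gaussian area, extended by zero. -/
def chartField (Y : M → Euc (n + 1)) (x : M) : Euc n → Euc n :=
  (chartAt (Euc n) x).target.indicator fun y =>
    chartWeight F x y • pinv (fderiv ℝ (inChart F x) y) (inChart Y x y)

/-- The classical formula div Y = w⁻¹ ∂ᵢ(w Xⁱ), with the Gaussian factor in w producing the term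
-½⟨x, Y⟩. The trace of d²F(X, ·) in the divergence of Y = dF(X) matches the logarithmic derivative
of the area density along X, by symmetry of second derivatives. -/
lemma trace_fderiv_chartField (hF : IsProperImmersion n F) {Y : M → Euc (n + 1)}
    (hY : ContMDiff (𝓡 n) 𝓘(ℝ, Euc (n + 1)) ∞ Y) (htan : ∀ p, tderiv F F p (Y p) = Y p)
    {x : M} {y : Euc n} (hy : y ∈ (chartAt (Euc n) x).target) :
    traceCLM _ (fderiv ℝ (chartField F Y x) y) = chartWeight F x y *
      (divergence F Y ((chartAt (Euc n) x).symm y) -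
        (1 / 2) * ⟪inChart F x y, inChart Y x y⟫) := by
  set e := chartAt (Euc n) x with he
  have ht := e.open_target.mem_nhds hy
  set T : Euc n → Euc n →L[ℝ] Euc (n + 1) := fderiv ℝ (inChart F x) with hT
  have hinj := injective_fderiv_inChart hF hy
  set X : Euc n → Euc n := fun z => pinv (T z) (inChart Y x z) with hX
  have hXs : ContDiffOn ℝ ∞ X e.target :=
    (contDiffOn_pinv_fderiv_inChart hF x).clm_apply (contDiffOn_inChart hY x)
  have hTX : inChart Y x =ᶠ[nhds y] fun z => T z (X z) := by
    filter_upwards [ht] with z hz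
    have h := htan (e.symm z)
    rw [tderiv_eq_chartTderiv hF (hF.mdifferentiableAt _) x (e.map_target hz),
      ← he, e.right_inv hz] at h
    exact h.symm
  have hXd : HasFDerivAt X _ y := ((hXs.contDiffAt ht).differentiableAt (by simp)).hasFDerivAt
  have hTd : HasFDerivAt T _ y :=
    (((contDiffOn_fderiv_inChart hF.smooth x).contDiffAt ht).differentiableAt
      (by simp)).hasFDerivAt
  obtain ⟨w', hw', hw'eq⟩ := hasFDerivAt_chartWeight hF hy
  have hZ : chartField F Y x =ᶠ[nhds y] fun z => chartWeight F x z • X z := by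
    filter_upwards [ht] with z hz
    rw [chartField, Set.indicator_of_mem hz]
  have hsym : IsSymmSndFDerivAt ℝ (inChart F x) y :=
    ((contDiffOn_inChart hF.smooth x).contDiffAt ht).isSymmSndFDerivAt
      (by simpa using WithTop.coe_le_coe.2 (le_top : (2 : ℕ∞) ≤ ⊤))
  have hdiv : divergence F Y (e.symm y) =
      traceCLM _ (pinv (T y) ∘L fderiv ℝ T y (X y)) + traceCLM _ (fderiv ℝ X y) := by
    rw [divergence_eq_trace (injective_coordDeriv hF _),
      tderiv_eq_chartTderiv hF (hY.mdifferentiableAt (by simp)) x (e.map_target hy), ← he,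
      e.right_inv hy, chartTderiv, ← traceCLM_comp_comm, ← map_add]
    congr 1
    ext1 ξ
    have h := (hTd.clm_apply hXd).fderiv
    rw [ContinuousLinearMap.comp_apply, hTX.fderiv_eq, h]
    simp only [add_apply, ContinuousLinearMap.comp_apply, ContinuousLinearMap.flip_apply, map_add]
    rw [pinv_apply_map hinj, hsym.eq ξ (X y), add_comm]
  rw [hZ.fderiv_eq, (hw'.fun_smul hXd).fderiv, map_add, map_smul, traceCLM_smulRight, hw'eq, hdiv,
    hTX.self_of_nhds, smul_eq_mul]
  ring

variable [MeasurableSpace M] [BorelSpace M]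

lemma contMDiff_divergence (hF : IsProperImmersion n F) {Y : M → Euc (n + 1)}
    (hY : ContMDiff (𝓡 n) 𝓘(ℝ, Euc (n + 1)) ∞ Y) :
    ContMDiff (𝓡 n) 𝓘(ℝ, ℝ) ∞ (divergence F Y) := by
  have h : divergence F Y = traceCLM (Euc (n + 1)) ∘ tderiv F Y :=
    funext fun p => divergence_eq_trace (injective_coordDeriv hF p) Y
  rw [h]
  exact (traceCLM _).contDiff.contMDiff.comp (contMDiff_tderiv hF hY)

/-- The integrand of the divergence theorem for the Gaussian area. -/
def gaussianDiv (F Y : M → Euc (n + 1)) (p : M) : ℝ :=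
  divergence F Y p - (1 / 2) * ⟪F p, Y p⟫

lemma continuous_gaussianDiv (hF : IsProperImmersion n F) {Y : M → Euc (n + 1)}
    (hY : ContMDiff (𝓡 n) 𝓘(ℝ, Euc (n + 1)) ∞ Y) : Continuous (gaussianDiv F Y) :=
  (contMDiff_divergence hF hY).continuous.sub
    (continuous_const.mul (hF.smooth.continuous.inner hY.continuous))

lemma tderiv_eq_zero_of_notMem_tsupport {W : Type*} [NormedAddCommGroup W] [NormedSpace ℝ W]
    {X : M → W} {p : M} (hp : p ∉ tsupport X) : tderiv F X p = 0 := by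
  have h : X =ᶠ[nhds p] fun _ => 0 := by
    rw [notMem_tsupport_iff_eventuallyEq] at hp; exact hp
  have h2 : coordDeriv n X p = coordDeriv n (fun _ : M => (0 : W)) p := h.mfderiv_eq
  have h3 := tderiv_const (F := F) (p := p) (0 : W)
  rw [tderiv] at h3 ⊢
  rw [h2, h3]

lemma gaussianDiv_eq_zero (hF : IsProperImmersion n F) {Y : M → Euc (n + 1)} {p : M}
    (hp : p ∉ tsupport Y) : gaussianDiv F Y p = 0 := by
  rw [gaussianDiv, divergence_eq_trace (injective_coordDeriv hF p),
    tderiv_eq_zero_of_notMem_tsupport hp, image_eq_zero_of_notMem_tsupport hp]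
  simp

lemma integral_gaussianDiv_eq_zero_of_subset [T2Space M] (hF : IsProperImmersion n F)
    {Y : M → Euc (n + 1)}
    (hY : ContMDiff (𝓡 n) 𝓘(ℝ, Euc (n + 1)) ∞ Y) (htan : ∀ p, tderiv F F p (Y p) = Y p)
    (hs : HasCompactSupport Y) {x : M} (hx : tsupport Y ⊆ (chartAt (Euc n) x).source) :
    ∫ p, gaussianDiv F Y p ∂(gaussianArea F) = 0 := by
  set e := chartAt (Euc n) x with he
  rw [integral_gaussianArea_eq hF x (continuous_gaussianDiv hF hY)
    (fun p hp => gaussianDiv_eq_zero hF fun h => hp (hx h))]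
  have hK : IsCompact (e '' tsupport Y) :=
    IsCompact.image_of_continuousOn hs (e.continuousOn.mono hx)
  have hzero : ∀ y ∉ e '' tsupport Y, chartField F Y x y = 0 := by
    intro y hy
    by_cases hyt : y ∈ e.target
    · rw [chartField, Set.indicator_of_mem hyt]
      have : inChart Y x y = 0 := by
        exact image_eq_zero_of_notMem_tsupport (f := Y)
          fun h => hy ⟨_, h, e.right_inv hyt⟩
      rw [this, map_zero, smul_zero]
    · exact Set.indicator_of_notMem hyt _
  have hev : ∀ y ∉ e '' tsupport Y, chartField F Y x =ᶠ[nhds y] fun _ => 0 := fun y hy => by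
    filter_upwards [hK.isClosed.isOpen_compl.mem_nhds hy] with z hz using hzero z hz
  -- Extension by zero remains smooth because the image of the support is compact, hence closed,
  -- inside the chart target.
  have hZ : ContDiff ℝ 1 (chartField F Y x) := by
    rw [contDiff_iff_contDiffAt]
    intro y
    by_cases hy : y ∈ e '' tsupport Y
    · have hyt : y ∈ e.target := by
        obtain ⟨p, hp, rfl⟩ := hy
        exact e.map_source (hx hp)
      have ht := e.open_target.mem_nhds hyt
      have hw : ContDiffOn ℝ ∞ (chartWeight F x) e.target :=
        (contDiffOn_chartDensity hF x).mul
          (((contDiffOn_inChart hF.smooth x).norm_sq ℝ).neg.div_const 4).exp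
      have h1 := hw.smul ((contDiffOn_pinv_fderiv_inChart hF x).clm_apply
        (contDiffOn_inChart hY x))
      refine ((h1.contDiffAt ht).of_le (by simp)).congr_of_eventuallyEq ?_
      filter_upwards [ht] with z hz
      rw [chartField, Set.indicator_of_mem hz]
      rfl
    · exact contDiffAt_const.congr_of_eventuallyEq (hev y hy)
  have hZs : HasCompactSupport (chartField F Y x) := HasCompactSupport.intro hK hzero
  have h0 := integral_trace_fderiv_eq_zero hZ hZs
  rw [← setIntegral_eq_integral_of_forall_compl_eq_zero (s := e.target)] at h0
  · rw [← h0]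
    refine setIntegral_congr_fun e.open_target.measurableSet fun y hy => ?_
    rw [trace_fderiv_chartField hF hY htan hy]
    rfl
  · intro y hy
    have : y ∉ e '' tsupport Y := by
      rintro ⟨p, hp, rfl⟩
      exact hy (e.map_source (hx hp))
    rw [(hev y this).fderiv_eq]
    simp

lemma tderiv_sum {W ι : Type*} [NormedAddCommGroup W] [NormedSpace ℝ W]
    (hF : IsProperImmersion n F) {X : ι → M → W} (s : Finset ι)
    (hX : ∀ i, ContMDiff (𝓡 n) 𝓘(ℝ, W) ∞ (X i)) (p : M) :
    tderiv F (fun q => ∑ i ∈ s, X i q) p = ∑ i ∈ s, tderiv F (X i) p := by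
  classical
  induction s using Finset.induction_on with
  | empty => simpa using tderiv_const (0 : W)
  | insert i s hi ih =>
    simp only [Finset.sum_insert hi]
    rw [tderiv_add hF ((hX i).mdifferentiableAt (by simp)), ih]
    have : ContMDiff (𝓡 n) 𝓘(ℝ, W) ∞ (fun q => ∑ i ∈ s, X i q) :=
      contMDiff_finsetSum fun i _ => hX i
    exact this.mdifferentiableAt (by simp)

/-- The divergence theorem for compactly supported tangential fields and the Gaussian area. -/
lemma integral_gaussianDiv_eq_zero [T2Space M] (hF : IsProperImmersion n F)
    [IsFiniteMeasure (gaussianArea F)] {Y : M → Euc (n + 1)}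
    (hY : ContMDiff (𝓡 n) 𝓘(ℝ, Euc (n + 1)) ∞ Y) (htan : ∀ p, tderiv F F p (Y p) = Y p)
    (hs : HasCompactSupport Y) : ∫ p, gaussianDiv F Y p ∂(gaussianArea F) = 0 := by
  have := sigmaCompactSpace_of_proper hF
  obtain ⟨ρ, hρ⟩ := SmoothPartitionOfUnity.exists_isSubordinate (𝓡 n) (s := Set.univ)
    isClosed_univ (fun x : M => (chartAt (Euc n) x).source)
    (fun x => (chartAt (Euc n) x).open_source)
    (fun x _ => Set.mem_iUnion.2 ⟨x, mem_chart_source _ x⟩)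
  have hfin := ρ.locallyFinite.finite_nonempty_inter_compact hs
  -- Only finitely many members of the partition meet the compact support of Y, so the decomposition
  -- of Y is a finite sum.
  set t := hfin.toFinset with ht
  have hsum : Y = fun q => ∑ i ∈ t, ρ i q • Y q := by
    funext q
    by_cases hq : q ∈ tsupport Y
    · rw [← Finset.sum_smul]
      have h1 : ∑ i ∈ t, ρ i q = 1 := by
        rw [← ρ.sum_eq_one (Set.mem_univ q)]
        symm
        apply finsum_eq_sum_of_support_subset
        intro i hi
        simp only [ht, Set.Finite.coe_toFinset]
        exact ⟨q, hi, hq⟩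
      rw [h1, one_smul]
    · rw [image_eq_zero_of_notMem_tsupport hq]; simp
  have hρY : ∀ i, ContMDiff (𝓡 n) 𝓘(ℝ, Euc (n + 1)) ∞ (fun q => ρ i q • Y q) := fun i =>
    (ρ i).contMDiff.smul hY
  have hdivsum : ∀ p, gaussianDiv F Y p = ∑ i ∈ t, gaussianDiv F (fun q => ρ i q • Y q) p := by
    intro p
    simp only [gaussianDiv, divergence_eq_trace (injective_coordDeriv hF p),
      Finset.sum_sub_distrib, ← Finset.mul_sum, ← inner_sum, ← map_sum]
    rw [← tderiv_sum hF t hρY, ← hsum, ← congrFun hsum p]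
  have hsupp : ∀ i, tsupport (fun q => ρ i q • Y q) ⊆ tsupport Y := fun i =>
    closure_mono (Function.support_smul_subset_right (ρ i) Y)
  have hcpt : ∀ i, HasCompactSupport (fun q => ρ i q • Y q) := fun i =>
    IsCompact.of_isClosed_subset hs (isClosed_tsupport _) (hsupp i)
  simp only [hdivsum]
  rw [integral_finsetSum]
  · refine Finset.sum_eq_zero fun i _ => ?_
    refine integral_gaussianDiv_eq_zero_of_subset hF (hρY i) (fun p => ?_) (hcpt i) (x := i) ?_
    · rw [map_smul, htan]
    · exact (closure_mono (Function.support_smul_subset_left (ρ i) Y)).trans (hρ i)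
  · intro i _
    refine (continuous_gaussianDiv hF (hρY i)).integrable_of_hasCompactSupport
      (HasCompactSupport.intro (hcpt i) fun p hp => gaussianDiv_eq_zero hF hp)

/-- Integration by parts for the drift Laplacian. -/
lemma integral_mul_driftLaplacian_add [T2Space M] (hF : IsProperImmersion n F)
    (hN : IsUnitNormal F N) [IsFiniteMeasure (gaussianArea F)] {f g : M → ℝ}
    (hf : ContMDiff (𝓡 n) 𝓘(ℝ, ℝ) ∞ f) (hg : ContMDiff (𝓡 n) 𝓘(ℝ, ℝ) ∞ g)
    (hs : HasCompactSupport f) :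
    Integrable (fun p => f p * driftLaplacian F g p + ⟪gradient F f p, gradient F g p⟫)
      (gaussianArea F) ∧
    ∫ p, f p * driftLaplacian F g p + ⟪gradient F f p, gradient F g p⟫ ∂(gaussianArea F) = 0 := by
  have hgrad := contMDiff_gradient hF hg
  have hY : ContMDiff (𝓡 n) 𝓘(ℝ, Euc (n + 1)) ∞ (fun q => f q • gradient F g q) := hf.smul hgrad
  have hYs : HasCompactSupport (fun q => f q • gradient F g q) := hs.smul_right
  -- The divergence theorem is applied to the field f∇g.
  have h := integral_gaussianDiv_eq_zero hF hY
    (fun p => by rw [map_smul, tderiv_self_gradient hF hN]) hYs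
  have hpt : ∀ p, gaussianDiv F (fun q => f q • gradient F g q) p =
      f p * driftLaplacian F g p + ⟪gradient F f p, gradient F g p⟫ := by
    intro p
    have h1 : tderiv F (fun q => f q • gradient F g q) p =
        (tderiv F f p).smulRight (gradient F g p) + f p • tderiv F (gradient F g) p := by
      ext1 w
      rw [tderiv_smul hF (hf.mdifferentiableAt (by simp)) (hgrad.mdifferentiableAt (by simp))]
      rfl
    rw [gaussianDiv, divergence_eq_trace (injective_coordDeriv hF p), h1, map_add, map_smul,
      traceCLM_smulRight, ← inner_gradient (injective_coordDeriv hF p),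
      ← divergence_eq_trace (injective_coordDeriv hF p), driftLaplacian, laplacian,
      inner_smul_right, smul_eq_mul]
    ring
  have hint : Integrable (gaussianDiv F (fun q => f q • gradient F g q)) (gaussianArea F) :=
    (continuous_gaussianDiv hF hY).integrable_of_hasCompactSupport
      (HasCompactSupport.intro hYs fun p hp => gaussianDiv_eq_zero hF hp)
  rw [show gaussianDiv F (fun q => f q • gradient F g q) = _ from funext hpt] at hint
  simp only [hpt] at h
  exact ⟨hint, h⟩

end DivergenceTheorem

/-! ### Planarity criteria and the space K of everywhere tangent directions. -/

section Planar

variable {n : ℕ} {M : Type u} [TopologicalSpace M] [ChartedSpace (Euc n) M]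
  [IsManifold (𝓡 n) ∞ M] {F N : M → Euc (n + 1)}

/-- Composing with dF cancels the pseudo-inverse, so the coordinate derivative itself vanishes. -/
lemma isLocallyConstant_of_tderiv_eq_zero (hF : IsProperImmersion n F)
    {W : Type*} [NormedAddCommGroup W] [NormedSpace ℝ W] {X : M → W}
    (hX : ContMDiff (𝓡 n) 𝓘(ℝ, W) ∞ X) (h0 : ∀ p, tderiv F X p = 0) : IsLocallyConstant X := by
  rw [IsLocallyConstant.iff_eventually_eq]
  intro x
  set e := chartAt (Euc n) x with he
  have hx : x ∈ e.source := mem_chart_source _ x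
  have hfd : Set.EqOn (fderiv ℝ (inChart X x)) 0 e.target := by
    intro y hy
    have h1 := h0 (e.symm y)
    rw [tderiv_eq_chartTderiv hF (hX.mdifferentiableAt (by simp)) x (e.map_target hy), ← he,
      e.right_inv hy, chartTderiv] at h1
    have h2 := congrArg (fun A => A ∘L fderiv ℝ (inChart F x) y) h1
    simp only [ContinuousLinearMap.zero_comp] at h2
    rwa [ContinuousLinearMap.comp_assoc, pinv_comp_self (injective_fderiv_inChart hF hy),
      ContinuousLinearMap.comp_id] at h2
  obtain ⟨r, hr, hball⟩ := Metric.isOpen_iff.1 e.open_target (e x) (e.map_source hx)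
  have hcont : ∀ᶠ q in nhds x, e q ∈ Metric.ball (e x) r :=
    (e.continuousAt hx).eventually (Metric.ball_mem_nhds _ hr)
  filter_upwards [hcont, e.open_source.mem_nhds hx] with q hq hqs
  have h3 := Metric.isOpen_ball.is_const_of_fderiv_eq_zero
    (convex_ball (e x) r).isPreconnected
    (((contDiffOn_inChart hX x).differentiableOn (by simp)).mono hball)
    (hfd.mono hball) hq (Metric.mem_ball_self hr)
  simpa [inChart, ← he, e.left_inv hqs, e.left_inv hx] using h3

/-- If A = 0, then N and ⟨N, F⟩ are locally constant, hence constant on components, and they define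
the hyperplane. -/
lemma isPlanar_of_normSqA_eq_zero (hF : IsProperImmersion n F) (hN : IsUnitNormal F N)
    (h0 : ∀ p, normSqA F N p = 0) : IsPlanar F := by
  have hS : ∀ p, tderiv F N p = 0 := by
    intro p
    ext1 v
    have h := norm_shape_sq_le hF hN p v
    rw [h0, zero_mul] at h
    have h2 : ‖tderiv F N p v‖ = 0 := by
      have := sq_nonneg ‖tderiv F N p v‖
      exact pow_eq_zero_iff (two_ne_zero) |>.1 (le_antisymm h this)
    simpa using h2
  have hNc := isLocallyConstant_of_tderiv_eq_zero hF hN.smooth hS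
  have hin : ContMDiff (𝓡 n) 𝓘(ℝ, ℝ) ∞ (fun q => ⟪N q, F q⟫) :=
    (contDiff_inner (𝕜 := ℝ) (E := Euc (n + 1))).contMDiff.comp (hN.smooth.prodMk_space hF.smooth)
  have hc : IsLocallyConstant (fun q => ⟪N q, F q⟫) := by
    refine isLocallyConstant_of_tderiv_eq_zero hF hin fun p => ?_
    ext1 w
    rw [tderiv_inner hF (hN.mdifferentiableAt p) (hF.mdifferentiableAt p), hS,
      inner_normal_tderiv_self hN]
    simp
  intro p
  refine ⟨N p, ⟪N p, F p⟫, ?_, fun q hq => ?_⟩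
  · intro h
    have := hN.norm_eq_one p
    simp [h] at this
  · have h1 := hNc.apply_eq_of_isPreconnected isPreconnected_connectedComponent hq
      mem_connectedComponent
    have h2 := hc.apply_eq_of_isPreconnected isPreconnected_connectedComponent hq
      mem_connectedComponent
    rw [← h2, h1]

/-- The constant fields which are tangent to the hypersurface. -/
def tangentDirections (N : M → Euc (n + 1)) : Submodule ℝ (Euc (n + 1)) :=
  ⨅ p, (ℝ ∙ N p)ᗮ

lemma mem_tangentDirections {v : Euc (n + 1)} :
    v ∈ tangentDirections N ↔ ∀ p, ⟪v, N p⟫ = 0 := by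
  simp only [tangentDirections, Submodule.mem_iInf, Submodule.mem_orthogonal_singleton_iff_inner_left]

lemma normal_mem_orthogonal (N : M → Euc (n + 1)) (p : M) :
    N p ∈ (tangentDirections N)ᗮ := by
  rw [Submodule.mem_orthogonal]
  exact fun v hv => mem_tangentDirections.1 hv p

lemma finrank_tangentDirections_le [Nonempty M] (hN : IsUnitNormal F N) :
    Module.finrank ℝ (tangentDirections N) ≤ n := by
  obtain ⟨p⟩ := ‹Nonempty M›
  have hp : N p ≠ 0 := fun h => by
    have := hN.norm_eq_one p
    simp [h] at this
  have h1 : tangentDirections N ≤ (ℝ ∙ N p)ᗮ := iInf_le _ p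
  have h2 := (ℝ ∙ N p).finrank_add_finrank_orthogonal
  rw [finrank_span_singleton hp, finrank_euclideanSpace, Fintype.card_fin] at h2
  have h3 := Submodule.finrank_mono h1
  omega

/-- Here Kᗮ is at most a line and contains N. It also contains the range of S, because ⟨v, S w⟩ is
the derivative of ⟨v, N⟩ = 0 for v in K. As S w is orthogonal to N as well, S = 0. -/
lemma isPlanar_of_le_finrank (hF : IsProperImmersion n F) (hN : IsUnitNormal F N)
    (h : n ≤ Module.finrank ℝ (tangentDirections N)) : IsPlanar F := by
  refine isPlanar_of_normSqA_eq_zero hF hN fun p => ?_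
  have hp : N p ≠ 0 := fun h => by
    have := hN.norm_eq_one p
    simp [h] at this
  have h2 := (tangentDirections N).finrank_add_finrank_orthogonal
  rw [finrank_euclideanSpace, Fintype.card_fin] at h2
  have h3 : Module.finrank ℝ (tangentDirections N)ᗮ ≤ 1 := by omega
  rw [finrank_le_one_iff] at h3
  obtain ⟨z, hz⟩ := h3
  have hS : ∀ w, tderiv F N p w = 0 := by
    intro w
    have hmem : tderiv F N p w ∈ (tangentDirections N)ᗮ := by
      rw [Submodule.mem_orthogonal]
      intro v hv
      rw [← inner_shape_comm hF hN, ← gradient_inner_normal hF hN,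
        show (fun q => ⟪v, N q⟫) = fun _ : M => (0 : ℝ) from
          funext (mem_tangentDirections.1 hv), inner_gradient (injective_coordDeriv hF p),
        tderiv_const]
      rfl
    obtain ⟨a, ha⟩ := hz ⟨_, hmem⟩
    obtain ⟨b, hb⟩ := hz ⟨_, normal_mem_orthogonal N p⟩
    have ha' : a • (z : Euc (n + 1)) = tderiv F N p w := congrArg Subtype.val ha
    have hb' : b • (z : Euc (n + 1)) = N p := congrArg Subtype.val hb
    have hb0 : b ≠ 0 := by
      rintro rfl
      rw [zero_smul] at hb'
      exact hp hb'.symm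
    have h4 := inner_shape_normal hF hN p w
    have h5 : tderiv F N p w = (a / b) • N p := by
      rw [← ha', ← hb', smul_smul, div_mul_cancel₀ _ hb0]
    rw [h5, inner_smul_left, real_inner_self_eq_norm_sq, hN.norm_eq_one] at h4
    have h6 : a / b = 0 := by simpa using h4
    rw [h5, h6, zero_smul]
  rw [normSqA_eq_sum hF hN p (EuclideanSpace.basisFun (Fin (n + 1)) ℝ)]
  simp [hS]

end Planar

/-! ### The quadratic form on the functions φ(c + ⟨v, N⟩). -/

section Index

variable {n : ℕ} {M : Type u} [TopologicalSpace M] [ChartedSpace (Euc n) M]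
  [IsManifold (𝓡 n) ∞ M] {F N : M → Euc (n + 1)}

lemma gradient_mul (hF : IsProperImmersion n F) {f g : M → ℝ}
    (hf : ContMDiff (𝓡 n) 𝓘(ℝ, ℝ) ∞ f) (hg : ContMDiff (𝓡 n) 𝓘(ℝ, ℝ) ∞ g) (p : M) :
    gradient F (fun q => f q * g q) p = g p • gradient F f p + f p • gradient F g p := by
  apply ext_inner_right ℝ
  intro w
  rw [inner_add_left, inner_smul_left, inner_smul_left, inner_gradient (injective_coordDeriv hF p),
    inner_gradient (injective_coordDeriv hF p), inner_gradient (injective_coordDeriv hF p),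
    tderiv_mul hF (hf.mdifferentiableAt (by simp)) (hg.mdifferentiableAt (by simp))]
  simp only [conj_trivial]
  ring

/-- The function `c + ⟨v, N⟩`. -/
def affineNormal (N : M → Euc (n + 1)) (c : ℝ) (v : Euc (n + 1)) (p : M) : ℝ := c + ⟪v, N p⟫

lemma contMDiff_affineNormal (hN : IsUnitNormal F N) (c : ℝ) (v : Euc (n + 1)) :
    ContMDiff (𝓡 n) 𝓘(ℝ, ℝ) ∞ (affineNormal N c v) :=
  contMDiff_const.add (contMDiff_inner_normal hN v)

lemma gradient_affineNormal (hF : IsProperImmersion n F) (hN : IsUnitNormal F N) (c : ℝ)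
    (v : Euc (n + 1)) (p : M) :
    gradient F (affineNormal N c v) p = gradient F (fun q => ⟪v, N q⟫) p := by
  rw [gradient_eq_toDual_symm hF, gradient_eq_toDual_symm hF]
  congr 1
  have := tderiv_add hF (mdifferentiableAt_const (c := c))
    ((contMDiff_inner_normal hN v).mdifferentiableAt (by simp) (x := p))
  rw [tderiv_const, zero_add] at this
  exact this

lemma affineNormal_sq_le (hN : IsUnitNormal F N) (c : ℝ) (v : Euc (n + 1)) (p : M) :
    affineNormal N c v p ^ 2 ≤ 2 * (c ^ 2 + ‖v‖ ^ 2) := by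
  have h : ⟪v, N p⟫ ^ 2 ≤ ‖v‖ ^ 2 := by
    rw [sq_le_sq, abs_norm]
    calc |⟪v, N p⟫| ≤ ‖v‖ * ‖N p‖ := abs_real_inner_le_norm _ _
      _ = ‖v‖ := by rw [hN.norm_eq_one, mul_one]
  rw [affineNormal]
  nlinarith [sq_nonneg (c - ⟪v, N p⟫)]

lemma continuous_normSqA (hF : IsProperImmersion n F) (hN : IsUnitNormal F N) :
    Continuous (normSqA F N) := by
  have h : normSqA F N = fun p => ∑ i, ‖tderiv F N p
      (EuclideanSpace.basisFun (Fin (n + 1)) ℝ i)‖ ^ 2 :=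
    funext fun p => normSqA_eq_sum hF hN p _
  rw [h]
  have := (contMDiff_tderiv hF hN.smooth).continuous
  fun_prop

variable [T2Space M] [MeasurableSpace M] [BorelSpace M]

/-- Completing the square in a. The case A = 0 is separate because one divides by A. -/
lemma neg_sq_mul_sub_le {A B g : ℝ} (hA : 0 ≤ A) (hB : 0 ≤ B) (h : g ^ 2 ≤ A * B) (a : ℝ) :
    -(a ^ 2 * A) - 2 * a * g ≤ B := by
  rcases hA.eq_or_lt with rfl | hA
  · have : g = 0 := by
      rw [zero_mul] at h
      exact pow_eq_zero_iff two_ne_zero |>.1 (le_antisymm h (sq_nonneg g))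
    rw [this]; simpa using hB
  · have h1 : 0 ≤ A * (B + a ^ 2 * A + 2 * a * g) := by nlinarith [sq_nonneg (g + a * A)]
    have h2 := nonneg_of_mul_nonneg_right h1 hA
    linarith

lemma normSqA_nonneg (hF : IsProperImmersion n F) (hN : IsUnitNormal F N) (p : M) :
    0 ≤ normSqA F N p := by
  rw [normSqA_eq_sum hF hN p (EuclideanSpace.basisFun (Fin (n + 1)) ℝ)]
  positivity

/-- The integrand which remains of `-u L u`, for `u = φ (c + ⟨v, N⟩)`, after integrations by
parts. -/
def stabilityIntegrand (F N : M → Euc (n + 1)) (φ : M → ℝ) (c : ℝ) (v : Euc (n + 1)) (p : M) : ℝ :=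
  affineNormal N c v p ^ 2 * ‖gradient F φ p‖ ^ 2 - (c * φ p) ^ 2 * normSqA F N p -
    2 * (c * φ p) * ⟪gradient F φ p, gradient F (fun q => ⟪v, N q⟫) p⟫ -
    (1 / 2) * (φ p * affineNormal N c v p) ^ 2

/-- The negative term -(cφ)²|A|² pays for the cross term: since |∇⟨v, N⟩|² ≤ |A|²|v|², their sum is
at most |v|²|∇φ|². This bound contains no |A|². The constant 3 is 2 from |c + ⟨v, N⟩|² ≤ 2(c² +
|v|²) plus 1 from the square. -/
lemma stabilityIntegrand_le (hF : IsProperImmersion n F) (hN : IsUnitNormal F N)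
    {φ : M → ℝ} {ε : ℝ} {p : M} (hε : ‖gradient F φ p‖ ≤ ε) (c : ℝ) (v : Euc (n + 1)) :
    stabilityIntegrand F N φ c v p ≤
      3 * (c ^ 2 + ‖v‖ ^ 2) * ε ^ 2 - (1 / 2) * (φ p * affineNormal N c v p) ^ 2 := by
  have h1 := affineNormal_sq_le hN c v p
  have h2 : ‖gradient F (fun q => ⟪v, N q⟫) p‖ ^ 2 ≤ normSqA F N p * ‖v‖ ^ 2 := by
    rw [gradient_inner_normal hF hN]
    exact norm_shape_sq_le hF hN p v
  have h3 : ‖gradient F φ p‖ ^ 2 ≤ ε ^ 2 := pow_le_pow_left₀ (norm_nonneg _) hε 2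
  have hA := normSqA_nonneg hF hN p
  have h5 : ⟪gradient F φ p, gradient F (fun q => ⟪v, N q⟫) p⟫ ^ 2 ≤
      normSqA F N p * (‖v‖ ^ 2 * ‖gradient F φ p‖ ^ 2) := by
    have h7 := pow_le_pow_left₀ (abs_nonneg _)
      (abs_real_inner_le_norm (gradient F φ p) (gradient F (fun q => ⟪v, N q⟫) p)) 2
    rw [sq_abs, mul_pow] at h7
    calc _ ≤ _ := h7
      _ ≤ ‖gradient F φ p‖ ^ 2 * (normSqA F N p * ‖v‖ ^ 2) := by gcongr
      _ = _ := by ring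
  have h4 := neg_sq_mul_sub_le hA (by positivity) h5 (c * φ p)
  have h13 : affineNormal N c v p ^ 2 * ‖gradient F φ p‖ ^ 2 ≤
      2 * (c ^ 2 + ‖v‖ ^ 2) * ε ^ 2 :=
    mul_le_mul h1 h3 (sq_nonneg _) (by positivity)
  have h14 : ‖v‖ ^ 2 * ‖gradient F φ p‖ ^ 2 ≤ (c ^ 2 + ‖v‖ ^ 2) * ε ^ 2 :=
    mul_le_mul (by linarith [sq_nonneg c]) h3 (sq_nonneg _) (by positivity)
  rw [stabilityIntegrand]
  linarith

lemma continuous_stabilityIntegrand (hF : IsProperImmersion n F) (hN : IsUnitNormal F N)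
    {φ : M → ℝ} (hφ : ContMDiff (𝓡 n) 𝓘(ℝ, ℝ) ∞ φ) (c : ℝ) (v : Euc (n + 1)) :
    Continuous (stabilityIntegrand F N φ c v) := by
  have h1 := hφ.continuous
  have h2 := (contMDiff_affineNormal hN c v).continuous
  have h3 := (contMDiff_gradient hF hφ).continuous
  have h4 := (contMDiff_gradient hF (contMDiff_inner_normal hN v)).continuous
  have h5 := continuous_normSqA hF hN
  unfold stabilityIntegrand
  fun_prop

lemma hasCompactSupport_stabilityIntegrand (hF : IsProperImmersion n F)
    {φ : M → ℝ} (hs : HasCompactSupport φ) (c : ℝ) (v : Euc (n + 1)) :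
    HasCompactSupport (stabilityIntegrand F N φ c v) :=
  HasCompactSupport.intro hs fun p hp => by
    rw [stabilityIntegrand, gradient_eq_toDual_symm hF φ, tderiv_eq_zero_of_notMem_tsupport hp,
      image_eq_zero_of_notMem_tsupport hp]
    simp

/-- The integrand of the integration by parts formula. -/
def partsIntegrand (F : M → Euc (n + 1)) (f g : M → ℝ) (p : M) : ℝ :=
  f p * driftLaplacian F g p + ⟪gradient F f p, gradient F g p⟫

/-- Three integrations by parts, kept as pointwise identities: for the pair (u, u), where u = φ(c +
f) and f = ⟨v, N⟩, for (φu, f), and for (φ², f). The last two eliminate |∇f|² and the term linear in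
f|A|² by means of the drift equation for f. -/
lemma neg_mul_jacobiOp_eq (hF : IsProperImmersion n F) (hN : IsUnitNormal F N) {C : ℝ}
    (hH : ∀ p, meanCurvature F N p = ⟪F p, N p⟫ / 2 + C)
    {φ : M → ℝ} (hφ : ContMDiff (𝓡 n) 𝓘(ℝ, ℝ) ∞ φ) (c : ℝ) (v : Euc (n + 1)) (p : M) :
    -(φ p * affineNormal N c v p * jacobiOp F N (fun p => φ p * affineNormal N c v p) p) =
      stabilityIntegrand F N φ c v p -
        partsIntegrand F (fun p => φ p * affineNormal N c v p)
          (fun p => φ p * affineNormal N c v p) p +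
        partsIntegrand F (fun p => φ p * (φ p * affineNormal N c v p)) (fun q => ⟪v, N q⟫) p +
        c * partsIntegrand F (fun p => φ p * φ p) (fun q => ⟪v, N q⟫) p := by
  have hψ := contMDiff_affineNormal hN c v
  have hLf := driftLaplacian_inner_normal hF hN hH v p
  have hgψ := gradient_affineNormal hF hN c v p
  have hgu := gradient_mul hF hφ hψ p
  have hg2 := gradient_mul hF hφ (hφ.mul hψ) p
  have hg3 := gradient_mul hF hφ hφ p
  have hψp : ⟪v, N p⟫ = affineNormal N c v p - c := by rw [affineNormal]; ring
  rw [hgψ] at hgu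
  simp only [Pi.mul_apply] at hg2
  rw [show φ * affineNormal N c v = fun p => φ p * affineNormal N c v p from rfl, hgu] at hg2
  rw [stabilityIntegrand, partsIntegrand, partsIntegrand, partsIntegrand, jacobiOp_eq, hg2, hg3,
    hgu, hLf, hψp]
  simp only [inner_add_left, inner_add_right, inner_smul_left, inner_smul_right,
    conj_trivial, real_inner_self_eq_norm_sq]
  rw [real_inner_comm (gradient F φ p)]
  ring

lemma integral_sub_add_add_const_mul {α : Type*} [MeasurableSpace α] {μ : Measure α}
    {f g h k : α → ℝ} (hf : Integrable f μ) (hg : Integrable g μ) (hh : Integrable h μ)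
    (hk : Integrable k μ) (c : ℝ) :
    ∫ p, (f p - g p + h p + c * k p) ∂μ =
      ∫ p, f p ∂μ - ∫ p, g p ∂μ + ∫ p, h p ∂μ + c * ∫ p, k p ∂μ := by
  have h1 : ∫ p, (f p - g p + h p + c * k p) ∂μ =
      ∫ p, (f p - g p + h p) ∂μ + ∫ p, c * k p ∂μ :=
    integral_add ((hf.sub hg).add hh) (hk.const_mul c)
  have h2 : ∫ p, (f p - g p + h p) ∂μ = ∫ p, (f p - g p) ∂μ + ∫ p, h p ∂μ :=
    integral_add (hf.sub hg) hh
  rw [h1, h2, integral_sub hf hg, integral_const_mul]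

lemma Q_mul_affineNormal_eq (hF : IsProperImmersion n F) (hN : IsUnitNormal F N) {C : ℝ}
    (hH : ∀ p, meanCurvature F N p = ⟪F p, N p⟫ / 2 + C) [IsFiniteMeasure (gaussianArea F)]
    {φ : M → ℝ} (hφ : ContMDiff (𝓡 n) 𝓘(ℝ, ℝ) ∞ φ) (hs : HasCompactSupport φ) (c : ℝ)
    (v : Euc (n + 1)) :
    Q F N (fun p => φ p * affineNormal N c v p) (fun p => φ p * affineNormal N c v p) =
      ∫ p, stabilityIntegrand F N φ c v p ∂(gaussianArea F) := by
  have hf := contMDiff_inner_normal hN v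
  have hψ := contMDiff_affineNormal hN c v
  have hu : ContMDiff (𝓡 n) 𝓘(ℝ, ℝ) ∞ (fun p => φ p * affineNormal N c v p) := hφ.mul hψ
  have hu2 : ContMDiff (𝓡 n) 𝓘(ℝ, ℝ) ∞ (fun p => φ p * (φ p * affineNormal N c v p)) := hφ.mul hu
  have hu3 : ContMDiff (𝓡 n) 𝓘(ℝ, ℝ) ∞ (fun p => φ p * φ p) := hφ.mul hφ
  have H : ∀ {f g : M → ℝ}, ContMDiff (𝓡 n) 𝓘(ℝ, ℝ) ∞ f → ContMDiff (𝓡 n) 𝓘(ℝ, ℝ) ∞ g →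
      HasCompactSupport f → Integrable (partsIntegrand F f g) (gaussianArea F) ∧
        ∫ p, partsIntegrand F f g p ∂(gaussianArea F) = 0 :=
    fun hf hg hs => integral_mul_driftLaplacian_add hF hN hf hg hs
  obtain ⟨hi1, hz1⟩ := H hu hu hs.mul_right
  obtain ⟨hi2, hz2⟩ := H hu2 hf hs.mul_right
  obtain ⟨hi3, hz3⟩ := H hu3 hf hs.mul_right
  have hRi : Integrable (stabilityIntegrand F N φ c v) (gaussianArea F) :=
    (continuous_stabilityIntegrand hF hN hφ c v).integrable_of_hasCompactSupport
      (hasCompactSupport_stabilityIntegrand hF hs c v)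
  rw [Q, ← integral_neg, integral_congr_ae (Filter.Eventually.of_forall
    (neg_mul_jacobiOp_eq hF hN hH hφ c v)), integral_sub_add_add_const_mul hRi hi1 hi2 hi3,
    hz1, hz2, hz3]
  ring

/-- The stability inequality for the functions `φ (c + ⟨v, N⟩)`. -/
lemma Q_mul_affineNormal_le (hF : IsProperImmersion n F) (hN : IsUnitNormal F N) {C : ℝ}
    (hH : ∀ p, meanCurvature F N p = ⟪F p, N p⟫ / 2 + C) [IsFiniteMeasure (gaussianArea F)]
    {φ : M → ℝ} (hφ : ContMDiff (𝓡 n) 𝓘(ℝ, ℝ) ∞ φ) (hs : HasCompactSupport φ)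
    {ε : ℝ} (hε : ∀ p, ‖gradient F φ p‖ ≤ ε) (c : ℝ) (v : Euc (n + 1)) :
    Q F N (fun p => φ p * affineNormal N c v p) (fun p => φ p * affineNormal N c v p) ≤
      3 * (c ^ 2 + ‖v‖ ^ 2) * ε ^ 2 * (gaussianArea F).real Set.univ -
        (1 / 2) * ∫ p, (φ p * affineNormal N c v p) ^ 2 ∂(gaussianArea F) := by
  have hui : Integrable (fun p => (φ p * affineNormal N c v p) ^ 2) (gaussianArea F) := by
    have hc : Continuous fun p => (φ p * affineNormal N c v p) ^ 2 :=
      (hφ.continuous.mul (contMDiff_affineNormal hN c v).continuous).pow 2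
    refine hc.integrable_of_hasCompactSupport (HasCompactSupport.intro hs fun p hp => ?_)
    rw [image_eq_zero_of_notMem_tsupport hp]
    simp
  have hRi : Integrable (stabilityIntegrand F N φ c v) (gaussianArea F) :=
    (continuous_stabilityIntegrand hF hN hφ c v).integrable_of_hasCompactSupport
      (hasCompactSupport_stabilityIntegrand hF hs c v)
  -- The constant error term is integrable because the Gaussian area is finite.
  have hmono := integral_mono hRi ((integrable_const (3 * (c ^ 2 + ‖v‖ ^ 2) * ε ^ 2)).sub
    (hui.const_mul (1 / 2))) fun p => stabilityIntegrand_le hF hN (hε p) c v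
  rw [Q_mul_affineNormal_eq hF hN hH hφ hs]
  refine hmono.trans (le_of_eq ?_)
  rw [integral_sub' (integrable_const _) (hui.const_mul _), integral_const, integral_const_mul (1 / 2 : ℝ),
    smul_eq_mul]
  ring

end Index

/-! ### Cutoffs and the lower bound for the index. -/

section IndexBound

variable {n : ℕ} {M : Type u} [TopologicalSpace M] [ChartedSpace (Euc n) M]
  [IsManifold (𝓡 n) ∞ M] {F N : M → Euc (n + 1)}

lemma norm_tderiv_self_le (hF : IsProperImmersion n F) (p : M) (w : Euc (n + 1)) :
    ‖tderiv F F p w‖ ≤ ‖w‖ := by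
  have h : ⟪tderiv F F p w, tderiv F F p w⟫ = ⟪w, tderiv F F p w⟫ :=
    inner_map_pinv (injective_coordDeriv hF p) w _
  rw [real_inner_self_eq_norm_sq] at h
  have h1 := real_inner_le_norm w (tderiv F F p w)
  rw [← h, sq] at h1
  rcases (norm_nonneg (tderiv F F p w)).eq_or_lt with h0 | h0
  · rw [← h0]; exact norm_nonneg w
  · exact le_of_mul_le_mul_right h1 h0

lemma norm_gradient_comp_le (hF : IsProperImmersion n F) {g : Euc (n + 1) → ℝ}
    (hg : Differentiable ℝ g) {ε : ℝ} (hε : ∀ z, ‖fderiv ℝ g z‖ ≤ ε) (p : M) :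
    ‖gradient F (fun q => g (F q)) p‖ ≤ ε := by
  rw [gradient_eq_toDual_symm hF, LinearIsometryEquiv.norm_map,
    tderiv_comp hF (hg _) (hF.mdifferentiableAt p)]
  refine (ContinuousLinearMap.opNorm_comp_le _ _).trans ?_
  have h1 : ‖tderiv F F p‖ ≤ 1 :=
    ContinuousLinearMap.opNorm_le_bound _ zero_le_one fun w => by
      rw [one_mul]; exact norm_tderiv_self_le hF p w
  calc _ ≤ ε * 1 := mul_le_mul (hε _) h1 (norm_nonneg _) ((norm_nonneg _).trans (hε 0))
    _ = ε := mul_one ε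

/-- A bump function β(x/R) of the ambient space restricted to Σ: properness of F makes its support
compact, and its tangential gradient is at most sup |dβ| / R. -/
lemma exists_cutoff [T2Space M] (hF : IsProperImmersion n F) (r : ℝ) {ε : ℝ} (hε : 0 < ε) :
    ∃ φ : M → ℝ, ContMDiff (𝓡 n) 𝓘(ℝ, ℝ) ∞ φ ∧ HasCompactSupport φ ∧
      (∀ p, ‖F p‖ < r → φ p = 1) ∧ ∀ p, ‖gradient F φ p‖ ≤ ε := by
  let β : ContDiffBump (0 : Euc (n + 1)) := ⟨1, 2, one_pos, one_lt_two⟩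
  have hβ : ContDiff ℝ ∞ β := β.contDiff
  obtain ⟨B, hB⟩ := (β.hasCompactSupport.fderiv ℝ).exists_bound_of_continuous
    (hβ.continuous_fderiv (by simp))
  have hB0 : 0 ≤ B := (norm_nonneg _).trans (hB 0)
  -- The term B/ε makes B/R ≤ ε; the maximum with 1 keeps R positive for every r.
  set R := max r 1 + B / ε with hR
  have hBε : 0 ≤ B / ε := by positivity
  have hR1 : 0 < R := by have := le_max_right r 1; linarith
  have hRr : r ≤ R := by have := le_max_left r 1; linarith
  have hRB : R⁻¹ * B ≤ ε := by
    rw [inv_mul_le_iff₀ hR1]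
    have h1 : B / ε ≤ R := by have := le_max_right r 1; linarith
    rwa [div_le_iff₀ hε] at h1
  let g : Euc (n + 1) → ℝ := fun z => β (R⁻¹ • z)
  have hg : ContDiff ℝ ∞ g := hβ.comp (contDiff_const_smul R⁻¹)
  refine ⟨fun q => g (F q), hg.contMDiff.comp hF.smooth, ?_, fun p hp => ?_, ?_⟩
  · refine HasCompactSupport.intro
      (hF.proper.isCompact_preimage (isCompact_closedBall (0 : Euc (n + 1)) (2 * R)))
      fun p hp => ?_
    apply β.zero_of_le_dist
    simp only [Set.mem_preimage, Metric.mem_closedBall, dist_zero_right, not_le] at hp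
    rw [dist_zero_right, norm_smul, Real.norm_of_nonneg (by positivity)]
    change 2 ≤ _
    rw [inv_mul_eq_div, le_div_iff₀ hR1]
    exact hp.le
  · apply β.one_of_mem_closedBall
    rw [mem_closedBall_zero_iff, norm_smul, Real.norm_of_nonneg (by positivity)]
    change _ ≤ (1 : ℝ)
    rw [inv_mul_le_iff₀ hR1, mul_one]
    linarith
  · refine norm_gradient_comp_le hF (hg.differentiable (by simp)) fun z => ?_
    have h1 : HasFDerivAt g _ z := HasFDerivAt.comp (g := β) (f := fun z => R⁻¹ • z) z
      (hβ.differentiable (by simp) (R⁻¹ • z)).hasFDerivAt ((hasFDerivAt_id z).const_smul R⁻¹)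
    rw [h1.fderiv, ContinuousLinearMap.comp_smul, norm_smul, ContinuousLinearMap.comp_id,
      Real.norm_of_nonneg (by positivity)]
    exact (mul_le_mul_of_nonneg_left (hB _) (by positivity)).trans hRB

lemma affineNormal_smul (a c : ℝ) (v : Euc (n + 1)) (p : M) :
    affineNormal N (a * c) (a • v) p = a * affineNormal N c v p := by
  rw [affineNormal, affineNormal, inner_smul_left]
  simp only [conj_trivial]
  ring

variable [T2Space M] [MeasurableSpace M] [BorelSpace M]

/-- A positive lower bound for the `L²` norm on a large ball of the functions `c + ⟨v, N⟩`. -/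
lemma exists_integral_affineNormal_ge (hF : IsProperImmersion n F) (hN : IsUnitNormal F N)
    [IsFiniteMeasure (gaussianArea F)] (V : Submodule ℝ (Euc (n + 1)))
    (hinj : ∀ z : ℝ × V, (∀ p, affineNormal N z.1 z.2 p = 0) → z = 0) :
    ∃ r δ : ℝ, 0 < δ ∧ ∀ z : ℝ × V, δ * ‖z‖ ^ 2 ≤
      ∫ p in {p | ‖F p‖ < r}, affineNormal N z.1 z.2 p ^ 2 ∂(gaussianArea F) := by
  have hpos := isOpenPosMeasure_gaussianArea hF
  have hcz : ∀ p, Continuous fun z : ℝ × V => affineNormal N z.1 z.2 p := fun p => by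
    unfold affineNormal; fun_prop
  have hcompact : IsCompact (Metric.sphere (0 : ℝ × V) 1) := isCompact_sphere _ _
  -- Each unit z has a point where its function is nonzero. By compactness finitely many points
  -- serve for all z, and r is chosen so that the ball contains them.
  obtain ⟨t, ht⟩ := hcompact.elim_finite_subcover
    (fun p : M => {z : ℝ × V | affineNormal N z.1 z.2 p ≠ 0})
    (fun p => isOpen_ne_fun (hcz p) continuous_const) (fun z hz => by
      by_contra h
      have : z = 0 := hinj z fun p => by
        by_contra hp
        exact h (Set.mem_iUnion.2 ⟨p, hp⟩)
      rw [this] at hz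
      simp at hz)
  set r := ∑ p ∈ t, ‖F p‖ + 1 with hr
  have hrt : ∀ p ∈ t, ‖F p‖ < r := fun p hp => by
    have := Finset.single_le_sum (f := fun p => ‖F p‖) (fun _ _ => norm_nonneg _) hp
    linarith
  set B := {p | ‖F p‖ < r} with hB
  have hBo : IsOpen B := isOpen_lt hF.smooth.continuous.norm continuous_const
  let q : ℝ × V → ℝ := fun z => ∫ p in B, affineNormal N z.1 z.2 p ^ 2 ∂(gaussianArea F)
  have hcp : ∀ z : ℝ × V, Continuous (affineNormal N z.1 (z.2 : Euc (n + 1))) := fun z =>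
    (contMDiff_affineNormal hN z.1 (z.2 : Euc (n + 1))).continuous
  have hbound : ∀ (z : ℝ × V) p, ‖affineNormal N z.1 z.2 p ^ 2‖ ≤ 4 * ‖z‖ ^ 2 := by
    intro z p
    rw [Real.norm_of_nonneg (sq_nonneg _)]
    have h1 := affineNormal_sq_le hN z.1 (z.2 : Euc (n + 1)) p
    have h2 : z.1 ^ 2 ≤ ‖z‖ ^ 2 := by
      rw [← sq_abs]; exact pow_le_pow_left₀ (abs_nonneg _) (norm_fst_le z) 2
    have h3 : ‖(z.2 : Euc (n + 1))‖ ^ 2 ≤ ‖z‖ ^ 2 :=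
      pow_le_pow_left₀ (norm_nonneg _) (norm_snd_le z) 2
    linarith
  have hqc : ContinuousOn q (Metric.sphere 0 1) := by
    refine continuousOn_of_dominated (bound := fun _ => 4)
      (fun z _ => ((hcp z).pow 2).aestronglyMeasurable) (fun z hz => ?_) (integrable_const _) ?_
    · refine Filter.Eventually.of_forall fun p => (hbound z p).trans ?_
      rw [mem_sphere_zero_iff_norm.1 hz]; norm_num
    · exact Filter.Eventually.of_forall fun p => ((hcz p).pow 2).continuousOn
  have hqpos : ∀ z ∈ Metric.sphere (0 : ℝ × V) 1, 0 < q z := by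
    intro z hz
    have hint : Integrable (fun p => affineNormal N z.1 z.2 p ^ 2)
        ((gaussianArea F).restrict B) :=
      Integrable.of_bound ((hcp z).pow 2).aestronglyMeasurable (4 * ‖z‖ ^ 2)
        (Filter.Eventually.of_forall (hbound z))
    rw [show q z = ∫ p in B, affineNormal N z.1 z.2 p ^ 2 ∂(gaussianArea F) from rfl,
      integral_pos_iff_support_of_nonneg (fun p => sq_nonneg _) hint]
    have hz' := ht hz
    simp only [Set.mem_iUnion] at hz'
    obtain ⟨p, hp, hpz⟩ := hz'
    have hopen : IsOpen (Function.support fun p => affineNormal N z.1 z.2 p ^ 2) :=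
      isOpen_ne_fun ((hcp z).pow 2) continuous_const
    rw [Measure.restrict_apply hopen.measurableSet]
    exact (hopen.inter hBo).measure_pos _ ⟨p, pow_ne_zero 2 hpz, hrt p hp⟩
  have hne : (Metric.sphere (0 : ℝ × V) 1).Nonempty := ⟨(1, 0), by simp⟩
  obtain ⟨z₀, hz₀, hmin⟩ := hcompact.exists_isMinOn hne hqc
  refine ⟨r, q z₀, hqpos z₀ hz₀, fun z => ?_⟩
  rcases eq_or_ne z 0 with rfl | hz
  · simp [affineNormal]
  · have hz' : 0 < ‖z‖ := norm_pos_iff.2 hz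
    have hmem : ‖z‖⁻¹ • z ∈ Metric.sphere (0 : ℝ × V) 1 := by
      rw [mem_sphere_zero_iff_norm, norm_smul, norm_inv, norm_norm, inv_mul_cancel₀ hz'.ne']
    have h1 : q z₀ ≤ q (‖z‖⁻¹ • z) := hmin hmem
    -- Both sides are homogeneous of degree 2, so the minimum on the unit sphere gives the bound for
    -- all z.
    have h2 : q (‖z‖⁻¹ • z) = (‖z‖⁻¹) ^ 2 * q z := by
      simp only [q]
      rw [← integral_const_mul]
      refine integral_congr_ae (Filter.Eventually.of_forall fun p => ?_)
      simp only [Prod.smul_fst, Prod.smul_snd, smul_eq_mul, Submodule.coe_smul, affineNormal_smul]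
      ring
    rw [h2, inv_pow, inv_mul_eq_div, le_div_iff₀ (by positivity)] at h1
    exact h1

/-- It matters that φ does not depend on z: the functions φ(c + ⟨v, N⟩) then form a linear space on
which Q is negative definite. -/
lemma exists_cutoff_negative (hF : IsProperImmersion n F) (hN : IsUnitNormal F N) {C : ℝ}
    (hH : ∀ p, meanCurvature F N p = ⟪F p, N p⟫ / 2 + C) [IsFiniteMeasure (gaussianArea F)]
    (V : Submodule ℝ (Euc (n + 1)))
    (hinj : ∀ z : ℝ × V, (∀ p, affineNormal N z.1 z.2 p = 0) → z = 0) :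
    ∃ φ : M → ℝ, ContMDiff (𝓡 n) 𝓘(ℝ, ℝ) ∞ φ ∧ HasCompactSupport φ ∧ ∀ z : ℝ × V, z ≠ 0 →
      Q F N (fun p => φ p * affineNormal N z.1 z.2 p)
        (fun p => φ p * affineNormal N z.1 z.2 p) < 0 := by
  obtain ⟨r, δ, hδ, hr⟩ := exists_integral_affineNormal_ge hF hN V hinj
  set m := (gaussianArea F).real Set.univ with hm
  have hm0 : 0 ≤ m := measureReal_nonneg
  -- In the maximum norm c² + |v|² ≤ 2‖z‖², so this ε makes the error at most δ‖z‖²/4, below the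
  -- gain δ‖z‖²/2. Using m + 1 avoids division by zero.
  set ε := √(δ / (24 * (m + 1))) with hε
  have hε2 : ε ^ 2 = δ / (24 * (m + 1)) := Real.sq_sqrt (by positivity)
  obtain ⟨φ, hφ, hφs, hφ1, hφε⟩ := exists_cutoff hF r (ε := ε) (Real.sqrt_pos.2 (by positivity))
  refine ⟨φ, hφ, hφs, fun z hz => ?_⟩
  have hz' : 0 < ‖z‖ := norm_pos_iff.2 hz
  have h1 := Q_mul_affineNormal_le hF hN hH hφ hφs hφε z.1 (z.2 : Euc (n + 1))
  have h2 := hr z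
  have hui : Integrable (fun p => (φ p * affineNormal N z.1 z.2 p) ^ 2) (gaussianArea F) := by
    have hc : Continuous fun p => (φ p * affineNormal N z.1 z.2 p) ^ 2 :=
      (hφ.continuous.mul (contMDiff_affineNormal hN z.1 (z.2 : Euc (n + 1))).continuous).pow 2
    refine hc.integrable_of_hasCompactSupport (HasCompactSupport.intro hφs fun p hp => ?_)
    rw [image_eq_zero_of_notMem_tsupport hp]
    simp
  have h3 : ∫ p in {p | ‖F p‖ < r}, affineNormal N z.1 z.2 p ^ 2 ∂(gaussianArea F) ≤
      ∫ p, (φ p * affineNormal N z.1 z.2 p) ^ 2 ∂(gaussianArea F) := by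
    have hBo : IsOpen {p | ‖F p‖ < r} := isOpen_lt hF.smooth.continuous.norm continuous_const
    rw [setIntegral_congr_fun (g := fun p => (φ p * affineNormal N z.1 z.2 p) ^ 2)
      hBo.measurableSet (fun p hp => by
        simp only
        rw [hφ1 p hp, one_mul])]
    exact setIntegral_le_integral hui (Filter.Eventually.of_forall fun p => sq_nonneg _)
  have h4 : z.1 ^ 2 ≤ ‖z‖ ^ 2 := by
    rw [← sq_abs]; exact pow_le_pow_left₀ (abs_nonneg _) (norm_fst_le z) 2
  have h5 : ‖(z.2 : Euc (n + 1))‖ ^ 2 ≤ ‖z‖ ^ 2 :=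
    pow_le_pow_left₀ (norm_nonneg _) (norm_snd_le z) 2
  have h6 : 3 * (z.1 ^ 2 + ‖(z.2 : Euc (n + 1))‖ ^ 2) * ε ^ 2 * m ≤ δ / 4 * ‖z‖ ^ 2 := by
    calc 3 * (z.1 ^ 2 + ‖(z.2 : Euc (n + 1))‖ ^ 2) * ε ^ 2 * m
        ≤ 3 * (‖z‖ ^ 2 + ‖z‖ ^ 2) * ε ^ 2 * (m + 1) := by gcongr; linarith
      _ = δ / 4 * ‖z‖ ^ 2 := by rw [hε2]; field_simp; ring
  have h7 : 0 < δ * ‖z‖ ^ 2 := by positivity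
  rw [← hm] at h1
  linarith

/-- The functions `φ (c + ⟨v, N⟩)`, as a linear map. -/
def cutoffNormal (N : M → Euc (n + 1)) (φ : M → ℝ) (V : Submodule ℝ (Euc (n + 1))) :
    (ℝ × V) →ₗ[ℝ] (M → ℝ) where
  toFun z p := φ p * affineNormal N z.1 z.2 p
  map_add' z z' := by
    funext p
    simp only [affineNormal, Prod.fst_add, Prod.snd_add, Submodule.coe_add, inner_add_left,
      Pi.add_apply]
    ring
  map_smul' a z := by
    funext p
    simp only [Prod.smul_fst, Prod.smul_snd, smul_eq_mul, Submodule.coe_smul, affineNormal_smul,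
      RingHom.id_apply, Pi.smul_apply]
    ring

/-- The extra factor ℝ of constants compensates for the mean-zero condition: the integral is one
linear functional on ℝ × V, so its kernel has dimension at least dim V. -/
lemma finrank_le_indexQ (hF : IsProperImmersion n F) (hN : IsUnitNormal F N) {C : ℝ}
    (hH : ∀ p, meanCurvature F N p = ⟪F p, N p⟫ / 2 + C) [IsFiniteMeasure (gaussianArea F)]
    (V : Submodule ℝ (Euc (n + 1)))
    (hinj : ∀ z : ℝ × V, (∀ p, affineNormal N z.1 z.2 p = 0) → z = 0) :
    (Module.finrank ℝ V : ℕ∞) ≤ indexQ F N := by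
  obtain ⟨φ, hφ, hφs, hneg⟩ := exists_cutoff_negative hF hN hH V hinj
  set Ψ := cutoffNormal N φ V with hΨ
  have hsmooth : ∀ z, ContMDiff (𝓡 n) 𝓘(ℝ, ℝ) ∞ (Ψ z) := fun z =>
    hφ.mul (contMDiff_affineNormal hN z.1 (z.2 : Euc (n + 1)))
  have hsupp : ∀ z, HasCompactSupport (Ψ z) := fun z => hφs.mul_right
  have hint : ∀ z, Integrable (Ψ z) (gaussianArea F) := fun z =>
    (hsmooth z).continuous.integrable_of_hasCompactSupport (hsupp z)
  have hΨneg : ∀ z, z ≠ 0 → Q F N (Ψ z) (Ψ z) < 0 := hneg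
  -- Injectivity after multiplication by φ is a consequence of negativity, as Q(0, 0) = 0.
  have hΨinj : Function.Injective Ψ := by
    rw [injective_iff_map_eq_zero]
    intro z hz
    by_contra h0
    have h := hΨneg z h0
    rw [hz] at h
    simp [Q] at h
  let l : (ℝ × V) →ₗ[ℝ] ℝ :=
    { toFun := fun z => ∫ p, Ψ z p ∂(gaussianArea F)
      map_add' := fun z z' => by
        rw [map_add]
        exact integral_add (hint z) (hint z')
      map_smul' := fun a z => by
        rw [map_smul]
        exact integral_const_mul a _ }
  let W : Submodule ℝ (M → ℝ) := (LinearMap.ker l).map Ψ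
  have hW : IsNegativeSubspace F N W := by
    constructor
    · rintro _ ⟨z, hz, rfl⟩
      exact ⟨hsmooth z, hsupp z, hz⟩
    · rintro _ ⟨z, hz, rfl⟩ h0
      exact hΨneg z fun h => h0 (by rw [h, map_zero])
  have hker : Module.finrank ℝ V ≤ Module.finrank ℝ (LinearMap.ker l) := by
    have h1 := LinearMap.finrank_range_add_finrank_ker l
    have h2 : Module.finrank ℝ (LinearMap.range l) ≤ 1 := by
      simpa using Submodule.finrank_le (LinearMap.range l)
    rw [Module.finrank_prod, Module.finrank_self] at h1
    omega
  have hrank : Module.rank ℝ W = Module.finrank ℝ (LinearMap.ker l) := by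
    rw [(Submodule.equivMapOfInjective Ψ hΨinj (LinearMap.ker l)).finrank_eq]
    exact (Module.finrank_eq_rank ℝ _).symm
  calc (Module.finrank ℝ V : ℕ∞) ≤ Module.finrank ℝ (LinearMap.ker l) := by exact_mod_cast hker
    _ = Cardinal.toENat (Module.rank ℝ W) := by rw [hrank]; simp
    _ ≤ indexQ F N := le_iSup₂_of_le W hW le_rfl

/-- On a non-planar hypersurface with `H = ⟨x, N⟩ / 2 + C` the constants are not combinations of
the components of the normal. -/
lemma eq_zero_of_affineNormal_eq_zero (hF : IsProperImmersion n F) (hN : IsUnitNormal F N) {C : ℝ}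
    (hH : ∀ p, meanCurvature F N p = ⟪F p, N p⟫ / 2 + C) (hplanar : ¬ IsPlanar F)
    (z : ℝ × (tangentDirections N)ᗮ) (hz : ∀ p, affineNormal N z.1 z.2 p = 0) : z = 0 := by
  obtain ⟨c, v, hv⟩ := z
  simp only [affineNormal] at hz
  have hc : c = 0 := by
    by_contra hc
    refine hplanar (isPlanar_of_normSqA_eq_zero hF hN fun p => ?_)
    -- If ⟨v, N⟩ is the constant -c, its drift Laplacian vanishes, so the drift equation gives c|A|²
    -- = 0.
    have h1 := driftLaplacian_inner_normal hF hN hH v p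
    have h2 : (fun q => ⟪v, N q⟫) = fun _ : M => -c := funext fun q => by linarith [hz q]
    have h3 : gradient F (fun _ : M => -c) = fun _ => 0 := funext fun q => by
      rw [gradient_eq_toDual_symm hF, tderiv_const, map_zero]
    rw [h2, driftLaplacian, laplacian, h3, divergence_eq_trace (injective_coordDeriv hF p),
      tderiv_const, map_zero, inner_zero_right, congrFun h2 p] at h1
    have h4 : normSqA F N p * c = 0 := by linarith
    exact (mul_eq_zero.1 h4).resolve_right hc
  subst hc
  have hvK : v ∈ tangentDirections N := mem_tangentDirections.2 fun p => by simpa using hz p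
  have hv0 : v = 0 := by
    have := Submodule.inner_right_of_mem_orthogonal hvK hv
    rwa [inner_self_eq_zero] at this
  simp [hv0]

end IndexBound

/-! ### Charts given by projection to a tangent plane. -/

section GraphChart

variable {n : ℕ} {M : Type u} [TopologicalSpace M] [ChartedSpace (Euc n) M]
  [IsManifold (𝓡 n) ∞ M] {F N : M → Euc (n + 1)}

/-- A smooth map which has an invertible derivative at a point is near this point an open partial
homeomorphism with a smooth inverse. -/
lemma exists_openPartialHomeomorph {E E' : Type*} [NormedAddCommGroup E] [NormedSpace ℝ E]
    [NormedAddCommGroup E'] [NormedSpace ℝ E'] [CompleteSpace E] {g : E → E'} {U : Set E}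
    (hU : IsOpen U) (hg : ContDiffOn ℝ ∞ g U) {a : E} (ha : a ∈ U)
    (hinv : (fderiv ℝ g a).IsInvertible) :
    ∃ e : OpenPartialHomeomorph E E', a ∈ e.source ∧ e.source ⊆ U ∧ ⇑e = g ∧
      ContDiffOn ℝ ∞ e.symm e.target := by
  obtain ⟨A, hA⟩ := hinv
  have hda : ∀ y ∈ U, ContDiffAt ℝ ∞ g y := fun y hy => hg.contDiffAt (hU.mem_nhds hy)
  have hA' : HasFDerivAt g (A : E →L[ℝ] E') a := by
    rw [hA]; exact ((hda a ha).differentiableAt (by simp)).hasFDerivAt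
  let e₀ := (hda a ha).toOpenPartialHomeomorph g hA' (by simp)
  have hcont : ContinuousOn (fderiv ℝ g) U :=
    (hg.fderiv_of_isOpen (m := ∞) hU (by simp)).continuousOn
  -- Shrinking to the open set of points with invertible derivative makes the inverse smooth on its
  -- whole target, and not only near the image of `a`.
  have hopen : IsOpen (U ∩ fderiv ℝ g ⁻¹' Set.range ((↑) : (E ≃L[ℝ] E') → (E →L[ℝ] E'))) :=
    hcont.isOpen_inter_preimage hU ContinuousLinearEquiv.isOpen
  let e := e₀.restrOpen _ hopen
  have hsub : e.source ⊆ U ∩ fderiv ℝ g ⁻¹' Set.range ((↑) : (E ≃L[ℝ] E') → (E →L[ℝ] E')) := by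
    rw [OpenPartialHomeomorph.restrOpen_source]
    exact Set.inter_subset_right
  refine ⟨e, ⟨(hda a ha).mem_toOpenPartialHomeomorph_source hA' (by simp), ha, A, hA⟩,
    fun y hy => (hsub hy).1, rfl, fun z hz => ?_⟩
  obtain ⟨hyU, B, hB⟩ := hsub (e.map_target hz)
  refine (e.contDiffAt_symm hz (f₀' := B) ?_ (hda _ hyU)).contDiffWithinAt
  rw [hB]
  exact ((hda _ hyU).differentiableAt (by simp)).hasFDerivAt

/-- The tangent hyperplane, as a subspace of the ambient space. -/
abbrev tangentPlane (N : M → Euc (n + 1)) (p : M) : Submodule ℝ (Euc (n + 1)) := (ℝ ∙ N p)ᗮ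

lemma IsUnitNormal.ne_zero (hN : IsUnitNormal F N) (p : M) : N p ≠ 0 := fun h => by
  have := hN.norm_eq_one p
  simp [h] at this

lemma finrank_tangentPlane (hN : IsUnitNormal F N) (p : M) :
    Module.finrank ℝ (tangentPlane N p) = n := by
  have h2 : Module.finrank ℝ (ℝ ∙ N p) + Module.finrank ℝ (tangentPlane N p) = _ :=
    (ℝ ∙ N p).finrank_add_finrank_orthogonal
  rw [finrank_span_singleton (hN.ne_zero p), finrank_euclideanSpace, Fintype.card_fin] at h2
  omega

/-- The inverse function theorem applied to P ∘ F in the preferred chart at p. -/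
lemma exists_smooth_projection_chart (hF : IsProperImmersion n F) (p : M)
    {L : Type*} [NormedAddCommGroup L] [NormedSpace ℝ L] (P : Euc (n + 1) →L[ℝ] L)
    (hP : (P ∘L fderiv ℝ (inChart F p) (chartAt (Euc n) p p)).IsInvertible) :
    ∃ e : OpenPartialHomeomorph M L, p ∈ e.source ∧ (∀ q ∈ e.source, e q = P (F q)) ∧
      ContMDiffOn 𝓘(ℝ, L) (𝓡 n) ∞ e.symm e.target := by
  set c := chartAt (Euc n) p
  have hp : c p ∈ c.target := mem_chart_target _ p
  have hcd : ContDiffOn ℝ ∞ (inChart F p) c.target := contDiffOn_inChart hF.smooth p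
  have hg : ContDiffOn ℝ ∞ (P ∘ inChart F p) c.target := P.contDiff.comp_contDiffOn hcd
  have hd : DifferentiableAt ℝ (inChart F p) (c p) :=
    (hcd.contDiffAt (c.open_target.mem_nhds hp)).differentiableAt (by simp)
  have hfd : fderiv ℝ (P ∘ inChart F p) (c p) = P ∘L fderiv ℝ (inChart F p) (c p) :=
    (P.hasFDerivAt.comp (c p) hd.hasFDerivAt).fderiv
  obtain ⟨e, hae, hesub, hefun, hes⟩ :=
    exists_openPartialHomeomorph c.open_target hg hp (by rw [hfd]; exact hP)
  refine ⟨c.trans e, ?_, ?_, ?_⟩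
  · rw [OpenPartialHomeomorph.trans_source]
    exact ⟨mem_chart_source _ p, hae⟩
  · intro q hq
    rw [OpenPartialHomeomorph.trans_source] at hq
    have h : c.symm (c q) = q := c.left_inv hq.1
    rw [OpenPartialHomeomorph.coe_trans, Function.comp_apply, hefun]
    exact congrArg (fun x => P (F x)) h
  · have h1 : ContMDiffOn 𝓘(ℝ, L) 𝓘(ℝ, Euc n) ∞ e.symm (c.trans e).target := by
      refine contMDiffOn_iff_contDiffOn.2 (hes.mono ?_)
      rw [OpenPartialHomeomorph.trans_target]
      exact Set.inter_subset_left
    refine (contMDiffOn_chart_symm (I := 𝓡 n) (n := ∞) (x := p)).comp h1 fun z hz => ?_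
    rw [OpenPartialHomeomorph.trans_target] at hz
    exact hz.2

/-- The orthogonal projection to the tangent hyperplane at `p`. -/
abbrev tangentProj (N : M → Euc (n + 1)) (p : M) : Euc (n + 1) →L[ℝ] tangentPlane N p :=
  (tangentPlane N p).orthogonalProjectionOnto

lemma fderiv_inChart_self (hF : IsProperImmersion n F) (p : M) (v : Euc n) :
    ∃ u, fderiv ℝ (inChart F p) (chartAt (Euc n) p p) v = coordDeriv n F p u := by
  obtain ⟨u, rfl⟩ := (isInvertible_mfderiv_chartAt (mem_chart_source (Euc n) p)).surjective v
  exact ⟨u, by rw [coordDeriv_eq_fderiv_comp (hF.mdifferentiableAt p) p (mem_chart_source _ p)]; rfl⟩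

lemma isInvertible_tangentProj_comp (hF : IsProperImmersion n F) (hN : IsUnitNormal F N) (p : M) :
    (tangentProj N p ∘L fderiv ℝ (inChart F p) (chartAt (Euc n) p p)).IsInvertible := by
  have hinj : Function.Injective
      (tangentProj N p ∘L fderiv ℝ (inChart F p) (chartAt (Euc n) p p)) := by
    rw [injective_iff_map_eq_zero]
    intro v hv
    obtain ⟨u, hu⟩ := fderiv_inChart_self hF p v
    have hmem : fderiv ℝ (inChart F p) (chartAt (Euc n) p p) v ∈ tangentPlane N p := by
      rw [hu, Submodule.mem_orthogonal_singleton_iff_inner_right]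
      exact inner_coordDeriv_normal hN p u
    have h0 : fderiv ℝ (inChart F p) (chartAt (Euc n) p p) v = 0 := by
      have h := congrArg Subtype.val hv
      rw [ContinuousLinearMap.comp_apply] at h
      rwa [Submodule.coe_orthogonalProjectionOnto_apply,
        Submodule.starProjection_eq_self_iff.2 hmem] at h
    exact injective_fderiv_inChart hF (mem_chart_target _ p) (by rw [h0, map_zero])
  have hfin : Module.finrank ℝ (Euc n) = Module.finrank ℝ (tangentPlane N p) := by
    rw [finrank_tangentPlane hN p, finrank_euclideanSpace, Fintype.card_fin]
  exact ⟨(LinearEquiv.ofInjectiveOfFinrankEq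
    (tangentProj N p ∘L fderiv ℝ (inChart F p) (chartAt (Euc n) p p) :
      Euc n →ₗ[ℝ] tangentPlane N p) hinj hfin).toContinuousLinearEquiv, by ext; rfl⟩

/-- A chart around `p` given by the orthogonal projection of the hypersurface to its tangent
hyperplane at `p`, with a ball as target. -/
structure IsGraphChart (F N : M → Euc (n + 1)) (p : M)
    (e : OpenPartialHomeomorph M (tangentPlane N p)) (r : ℝ) : Prop where
  pos : 0 < r
  mem_source : p ∈ e.source
  apply_eq : ∀ q ∈ e.source, e q = tangentProj N p (F q)
  target_eq : e.target = Metric.ball (e p) r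
  smooth_symm : ContMDiffOn 𝓘(ℝ, tangentPlane N p) (𝓡 n) ∞ e.symm e.target

lemma exists_isGraphChart (hF : IsProperImmersion n F) (hN : IsUnitNormal F N) (p : M) :
    ∃ e r, IsGraphChart F N p e r := by
  obtain ⟨e, hpe, hef, hes⟩ :=
    exists_smooth_projection_chart hF p (tangentProj N p) (isInvertible_tangentProj_comp hF hN p)
  obtain ⟨r, hr, hball⟩ := Metric.isOpen_iff.1 e.open_target (e p) (e.map_source hpe)
  refine ⟨(e.symm.restrOpen (Metric.ball (e p) r) Metric.isOpen_ball).symm, r, hr, ?_, ?_, ?_, ?_⟩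
  · simp [OpenPartialHomeomorph.restrOpen, hpe, hr]
  · intro q hq
    exact hef q (by simp [OpenPartialHomeomorph.restrOpen] at hq; exact hq.1)
  · simpa [OpenPartialHomeomorph.restrOpen] using hball
  · refine hes.mono ?_
    simp [OpenPartialHomeomorph.restrOpen]

namespace IsGraphChart

variable {p : M} {e : OpenPartialHomeomorph M (tangentPlane N p)} {r : ℝ}

lemma tangentProj_symm (he : IsGraphChart F N p e r) {z : tangentPlane N p} (hz : z ∈ e.target) :
    tangentProj N p (F (e.symm z)) = z := by
  rw [← he.apply_eq _ (e.map_target hz), e.right_inv hz]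

lemma differentiableAt (hF : IsProperImmersion n F) (he : IsGraphChart F N p e r)
    {z : tangentPlane N p} (hz : z ∈ e.target) : DifferentiableAt ℝ (F ∘ e.symm) z := by
  have h : ContMDiffOn 𝓘(ℝ, tangentPlane N p) 𝓘(ℝ, Euc (n + 1)) ∞ (F ∘ e.symm) e.target :=
    hF.smooth.comp_contMDiffOn he.smooth_symm
  exact ((contMDiffOn_iff_contDiffOn.1 h).contDiffAt
    (e.open_target.mem_nhds hz)).differentiableAt (by simp)

lemma tangentProj_fderiv (hF : IsProperImmersion n F) (he : IsGraphChart F N p e r)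
    {z : tangentPlane N p} (hz : z ∈ e.target) (v : tangentPlane N p) :
    tangentProj N p (fderiv ℝ (F ∘ e.symm) z v) = v := by
  have h1 : HasFDerivAt (tangentProj N p ∘ (F ∘ e.symm))
      (tangentProj N p ∘L fderiv ℝ (F ∘ e.symm) z) z :=
    (tangentProj N p).hasFDerivAt.comp z (he.differentiableAt hF hz).hasFDerivAt
  have h2 : tangentProj N p ∘ (F ∘ e.symm) =ᶠ[nhds z] id := by
    filter_upwards [e.open_target.mem_nhds hz] with y hy
    exact he.tangentProj_symm hy
  have h3 := h1.unique ((hasFDerivAt_id z).congr_of_eventuallyEq h2)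
  exact DFunLike.congr_fun h3 v

lemma inner_normal_fderiv (hF : IsProperImmersion n F) (hN : IsUnitNormal F N)
    (he : IsGraphChart F N p e r) {z : tangentPlane N p} (hz : z ∈ e.target)
    (v : tangentPlane N p) : ⟪N (e.symm z), fderiv ℝ (F ∘ e.symm) z v⟫ = 0 := by
  have h1 : MDifferentiableAt 𝓘(ℝ, tangentPlane N p) (𝓡 n) e.symm z :=
    ((he.smooth_symm z hz).contMDiffAt (e.open_target.mem_nhds hz)).mdifferentiableAt (by simp)
  have h2 := mfderiv_comp z (hF.mdifferentiableAt (e.symm z)) h1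
  rw [mfderiv_eq_fderiv] at h2
  rw [h2]
  exact inner_coordDeriv_normal hN (e.symm z) _

/-- The derivative of the graph parametrization is a section of the projection to the tangent plane
at p, and its range is the tangent plane at `e.symm z`. A vector lying in both planes is its own
projection, hence is fixed. -/
lemma fderiv_eq_of_inner_eq_zero (hF : IsProperImmersion n F) (hN : IsUnitNormal F N)
    (he : IsGraphChart F N p e r) {z : tangentPlane N p} (hz : z ∈ e.target)
    (w : tangentPlane N p) (hw : ⟪N (e.symm z), (w : Euc (n + 1))⟫ = 0) :
    fderiv ℝ (F ∘ e.symm) z w = w := by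
  set D : tangentPlane N p →L[ℝ] Euc (n + 1) := fderiv ℝ (F ∘ e.symm) z
  have hproj : ∀ v, tangentProj N p (D v) = v := he.tangentProj_fderiv hF hz
  have hinj : Function.Injective D := fun a b hab => by rw [← hproj a, ← hproj b, hab]
  have hrange : LinearMap.range (D : tangentPlane N p →ₗ[ℝ] Euc (n + 1)) =
      tangentPlane N (e.symm z) := by
    apply Submodule.eq_of_le_of_finrank_eq
    · rintro _ ⟨v, rfl⟩
      rw [Submodule.mem_orthogonal_singleton_iff_inner_right]
      exact he.inner_normal_fderiv hF hN hz v
    · rw [LinearMap.finrank_range_of_inj hinj, finrank_tangentPlane hN, finrank_tangentPlane hN]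
  have hwm : (w : Euc (n + 1)) ∈ tangentPlane N (e.symm z) := by
    rwa [Submodule.mem_orthogonal_singleton_iff_inner_right]
  rw [← hrange] at hwm
  obtain ⟨v, hv⟩ := hwm
  have hv' : D v = w := hv
  have hvw : v = w := by
    rw [← hproj v, hv', Submodule.orthogonalProjectionOnto_mem_subspace_eq_self]
  rw [← hvw, hv', hvw]

/-- In a graph chart, the directions tangent to the whole hypersurface act by translations. -/
lemma apply_symm_add (hF : IsProperImmersion n F) (hN : IsUnitNormal F N)
    (he : IsGraphChart F N p e r) {z w : tangentPlane N p} (hz : z ∈ e.target)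
    (hzw : z + w ∈ e.target) (hw : (w : Euc (n + 1)) ∈ tangentDirections N) :
    F (e.symm (z + w)) = F (e.symm z) + w := by
  have hseg : ∀ t ∈ Set.Icc (0 : ℝ) 1, z + t • w ∈ e.target := by
    intro t ht
    have hconv : Convex ℝ e.target := by rw [he.target_eq]; exact convex_ball _ _
    exact hconv.add_smul_mem hz hzw ht
  -- A vector w in K lies in all tangent planes, so F ∘ e⁻¹ has derivative exactly w along the
  -- segment, which stays in the target because a ball is convex.
  have hderiv : ∀ t ∈ Set.Icc (0 : ℝ) 1,
      HasDerivAt (fun t : ℝ => (F ∘ e.symm) (z + t • w) - t • (w : Euc (n + 1))) 0 t := by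
    intro t ht
    have h1 : HasDerivAt (fun t : ℝ => z + t • w) w t := by
      simpa using ((hasDerivAt_id t).smul_const w).const_add z
    have h2 := (he.differentiableAt hF (hseg t ht)).hasFDerivAt.comp_hasDerivAt t h1
    rw [he.fderiv_eq_of_inner_eq_zero hF hN (hseg t ht) w
      (by rw [real_inner_comm]; exact mem_tangentDirections.1 hw _)] at h2
    have h3 : HasDerivAt (fun t : ℝ => t • (w : Euc (n + 1))) (w : Euc (n + 1)) t := by
      simpa using (hasDerivAt_id t).smul_const (w : Euc (n + 1))
    have h4 := h2.sub h3
    rw [sub_self] at h4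
    exact h4
  have h := constant_of_has_deriv_right_zero
    (fun t ht => (hderiv t ht).continuousAt.continuousWithinAt)
    (fun t ht => (hderiv t ⟨ht.1, ht.2.le⟩).hasDerivWithinAt) 1 (by simp)
  simp only [one_smul, zero_smul, add_zero, sub_zero, Function.comp_apply] at h
  rw [← h]; simp

end IsGraphChart

end GraphChart

/-! ### Lifting the translations by K to the hypersurface. -/

section Translations

variable {n : ℕ} {M : Type u} [TopologicalSpace M] [ChartedSpace (Euc n) M]
  [IsManifold (𝓡 n) ∞ M] {F N : M → Euc (n + 1)}

lemma isLocallyInjective_of_immersion (hF : IsProperImmersion n F) (hN : IsUnitNormal F N) :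
    IsLocallyInjective F := by
  rw [isLocallyInjective_iff_nhds]
  intro p
  obtain ⟨e, r, he⟩ := exists_isGraphChart hF hN p
  refine ⟨e.source, e.open_source.mem_nhds he.mem_source, fun a ha b hb hab => ?_⟩
  exact e.injOn ha hb (by rw [he.apply_eq a ha, he.apply_eq b hb, hab])

/-- A continuous map whose composition with an immersion is smooth is smooth. -/
lemma contMDiff_of_comp_immersion (hF : IsProperImmersion n F) (hN : IsUnitNormal F N)
    {E H Z : Type*} [NormedAddCommGroup E] [NormedSpace ℝ E] [TopologicalSpace H]
    [TopologicalSpace Z] [ChartedSpace H Z] {I : ModelWithCorners ℝ E H} {G : Z → M}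
    (hG : Continuous G) (hFG : ContMDiff I 𝓘(ℝ, Euc (n + 1)) ∞ (F ∘ G)) :
    ContMDiff I (𝓡 n) ∞ G := by
  intro z
  obtain ⟨e, r, he⟩ := exists_isGraphChart hF hN (G z)
  have h1 : ContMDiffAt I 𝓘(ℝ, tangentPlane N (G z)) ∞
      (fun y => tangentProj N (G z) (F (G y))) z :=
    (tangentProj N (G z)).contMDiff.contMDiffAt.comp z (hFG z)
  have hz : tangentProj N (G z) (F (G z)) ∈ e.target := by
    rw [← he.apply_eq _ he.mem_source]; exact e.map_source he.mem_source
  have h2 : ContMDiffAt I (𝓡 n) ∞ (e.symm ∘ fun y => tangentProj N (G z) (F (G y))) z :=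
    ContMDiffAt.comp z ((he.smooth_symm _ hz).contMDiffAt (e.open_target.mem_nhds hz)) h1
  refine h2.congr_of_eventuallyEq ?_
  filter_upwards [hG.continuousAt.preimage_mem_nhds (e.open_source.mem_nhds he.mem_source)]
    with y hy
  rw [Function.comp_apply, ← he.apply_eq _ hy, e.left_inv hy]

/-- `τ` lifts the translations by the small vectors tangent to the whole hypersurface to
the points of `A`. -/
structure IsLift (F N : M → Euc (n + 1)) (A : Set M) (r : ℝ)
    (τ : M → tangentDirections N → M) : Prop where
  continuousOn : ContinuousOn (fun x : M × tangentDirections N => τ x.1 x.2)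
    (A ×ˢ Metric.ball 0 r)
  apply_zero : ∀ q ∈ A, τ q 0 = q
  map_apply : ∀ q ∈ A, ∀ w ∈ Metric.ball (0 : tangentDirections N) r, F (τ q w) = F q + w

namespace IsLift

variable {A B : Set M} {r s : ℝ} {τ σ : M → tangentDirections N → M}

lemma mono (h : IsLift F N A r τ) (hB : B ⊆ A) (hs : s ≤ r) : IsLift F N B s τ where
  continuousOn := h.continuousOn.mono (Set.prod_mono hB (Metric.ball_subset_ball hs))
  apply_zero q hq := h.apply_zero q (hB hq)
  map_apply q hq w hw := h.map_apply q (hB hq) w (Metric.ball_subset_ball hs hw)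

lemma continuousOn_apply (h : IsLift F N A r τ) {q : M} (hq : q ∈ A) :
    ContinuousOn (τ q) (Metric.ball 0 r) :=
  h.continuousOn.comp (f := fun w => (q, w)) (by fun_prop) fun _ hw => ⟨hq, hw⟩

/-- Unique lifting: both sides are continuous lifts of w ↦ F q + w through a locally injective map,
they agree at 0, and balls are connected. -/
lemma eq_of_mem [T2Space M] (hF : IsProperImmersion n F) (hN : IsUnitNormal F N)
    (h : IsLift F N A r τ) (h' : IsLift F N B s σ) {q : M} (hqA : q ∈ A) (hqB : q ∈ B)
    {w : tangentDirections N} (hr : ‖w‖ < r) (hs : ‖w‖ < s) : τ q w = σ q w := by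
  have hr0 := (norm_nonneg w).trans_lt hr
  have hs0 := (norm_nonneg w).trans_lt hs
  have h1 := h.mono subset_rfl (min_le_left r s)
  have h2 := h'.mono subset_rfl (min_le_right r s)
  refine (T2Space.isSeparatedMap F).eqOn_of_comp_eqOn (isLocallyInjective_of_immersion hF hN)
    (convex_ball (0 : tangentDirections N) (min r s)).isPreconnected
    (h1.continuousOn_apply hqA) (h2.continuousOn_apply hqB) ?_ (a := 0) ?_ ?_ ?_
  · intro v hv
    rw [Function.comp_apply, Function.comp_apply, h1.map_apply q hqA v hv, h2.map_apply q hqB v hv]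
  · simp [hr0, hs0]
  · rw [h.apply_zero q hqA, h'.apply_zero q hqB]
  · exact mem_ball_zero_iff.2 (lt_min hr hs)

/-- Near q, the diagonal choice `σ q q` agrees with the single local lift centred at q, by
uniqueness; this gives its continuity. -/
lemma exists_of_locally [T2Space M] (hF : IsProperImmersion n F) (hN : IsUnitNormal F N)
    (h : ∀ p ∈ A, ∃ B ∈ nhds p, ∃ τ, IsLift F N B r τ) : ∃ τ, IsLift F N A r τ := by
  choose! B hB σ hσ using h
  refine ⟨fun q w => σ q q w, ?_, fun q hq => (hσ q hq).apply_zero q (mem_of_mem_nhds (hB q hq)),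
    fun q hq w hw => (hσ q hq).map_apply q (mem_of_mem_nhds (hB q hq)) w hw⟩
  rintro ⟨q, w⟩ ⟨hq, hw⟩
  have hmem : B q ×ˢ Metric.ball (0 : tangentDirections N) r ∈
      nhdsWithin (q, w) (A ×ˢ Metric.ball 0 r) :=
    mem_nhdsWithin_of_mem_nhds (prod_mem_nhds (hB q hq) (Metric.isOpen_ball.mem_nhds hw))
  have hc : ContinuousWithinAt (fun x : M × tangentDirections N => σ q x.1 x.2)
      (A ×ˢ Metric.ball 0 r) (q, w) :=
    ((hσ q hq).continuousOn (q, w) ⟨mem_of_mem_nhds (hB q hq), hw⟩).mono_of_mem_nhdsWithin hmem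
  refine hc.congr_of_eventuallyEq ?_ rfl
  filter_upwards [hmem, self_mem_nhdsWithin] with x hx hx'
  have hxr : ‖x.2‖ < r := by simpa using hx.2
  exact (hσ x.1 hx'.1).eq_of_mem hF hN (hσ q hq) (mem_of_mem_nhds (hB _ hx'.1)) hx.1 hxr hxr

/-- A translation by w is made in two steps of w/2, which doubles the radius provided the first step
stays in A. -/
lemma comp_half (h : IsLift F N A r τ) (hB : ∀ q ∈ B, q ∈ A)
    (hBA : ∀ q ∈ B, ∀ w ∈ Metric.ball (0 : tangentDirections N) r, τ q w ∈ A) :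
    IsLift F N B (2 * r) fun q w => τ (τ q ((1 / 2 : ℝ) • w)) ((1 / 2 : ℝ) • w) := by
  have hhalf : ∀ w ∈ Metric.ball (0 : tangentDirections N) (2 * r),
      (1 / 2 : ℝ) • w ∈ Metric.ball (0 : tangentDirections N) r := by
    intro w hw
    rw [mem_ball_zero_iff] at hw ⊢
    rw [norm_smul, Real.norm_of_nonneg (by norm_num)]
    linarith
  refine ⟨?_, fun q hq => ?_, fun q hq w hw => ?_⟩
  · have h1 : ContinuousOn (fun x : M × tangentDirections N => τ x.1 ((1 / 2 : ℝ) • x.2))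
        (B ×ˢ Metric.ball 0 (2 * r)) :=
      h.continuousOn.comp (f := fun x : M × tangentDirections N => (x.1, (1 / 2 : ℝ) • x.2))
        (by fun_prop) fun x hx => ⟨hB _ hx.1, hhalf _ hx.2⟩
    exact h.continuousOn.comp
      (f := fun x : M × tangentDirections N => (τ x.1 ((1 / 2 : ℝ) • x.2), (1 / 2 : ℝ) • x.2))
      (h1.prodMk (by fun_prop)) fun x hx => ⟨hBA _ hx.1 _ (hhalf _ hx.2), hhalf _ hx.2⟩
  · simp only [smul_zero]
    rw [h.apply_zero q (hB q hq), h.apply_zero q (hB q hq)]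
  · rw [h.map_apply _ (hBA q hq _ (hhalf w hw)) _ (hhalf w hw),
      h.map_apply q (hB q hq) _ (hhalf w hw), add_assoc, ← Submodule.coe_add, ← add_smul]
    norm_num

end IsLift

/-- The inclusion of the constant tangential fields in a tangent hyperplane. -/
def inclTangent (N : M → Euc (n + 1)) (p : M) : tangentDirections N →L[ℝ] tangentPlane N p :=
  (tangentDirections N).subtypeL.codRestrict (tangentPlane N p)
    fun v => (Submodule.mem_iInf _).1 v.2 p

lemma norm_inclTangent (p : M) (w : tangentDirections N) : ‖inclTangent N p w‖ = ‖w‖ := rfl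

lemma exists_isLift_nhds (hF : IsProperImmersion n F) (hN : IsUnitNormal F N) (p : M) :
    ∃ B ∈ nhds p, ∃ ε > 0, ∃ τ, IsLift F N B ε τ := by
  obtain ⟨e, r, he⟩ := exists_isGraphChart hF hN p
  have hr := he.pos
  have hopen : IsOpen (e.source ∩ e ⁻¹' Metric.ball (e p) (r / 2)) :=
    e.continuousOn.isOpen_inter_preimage e.open_source Metric.isOpen_ball
  have hmem : ∀ q ∈ e.source ∩ e ⁻¹' Metric.ball (e p) (r / 2),
      ∀ w ∈ Metric.ball (0 : tangentDirections N) (r / 2), e q + inclTangent N p w ∈ e.target := by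
    intro q hq w hw
    have h1 : ‖e q - e p‖ < r / 2 := by simpa [dist_eq_norm] using hq.2
    have h2 : ‖inclTangent N p w‖ < r / 2 := by
      rw [norm_inclTangent]; simpa using hw
    rw [he.target_eq, Metric.mem_ball, dist_eq_norm, add_sub_right_comm]
    exact (norm_add_le _ _).trans_lt (by linarith)
  refine ⟨_, hopen.mem_nhds ⟨he.mem_source, by simp [hr]⟩, r / 2, by positivity,
    fun q w => e.symm (e q + inclTangent N p w), ?_, ?_, ?_⟩
  · refine e.continuousOn_symm.comp (f := fun x : M × tangentDirections N =>
      e x.1 + inclTangent N p x.2) ?_ fun x hx => hmem _ hx.1 _ hx.2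
    refine ContinuousOn.add ?_ (by fun_prop)
    exact e.continuousOn.comp continuousOn_fst fun x hx => hx.1.1
  · intro q hq
    rw [map_zero, add_zero, e.left_inv hq.1]
  · intro q hq w hw
    rw [he.apply_symm_add hF hN (e.map_source hq.1) (hmem q hq w hw) w.2, e.left_inv hq.1]
    rfl

/-- The points over a closed ball. -/
def sublevel (F : M → Euc (n + 1)) (R : ℝ) : Set M := {q | ‖F q‖ ≤ R}

lemma isCompact_sublevel (hF : IsProperImmersion n F) (R : ℝ) : IsCompact (sublevel F R) := by
  have h := hF.proper.isCompact_preimage (isCompact_closedBall (0 : Euc (n + 1)) R)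
  convert h using 1
  ext q
  simp [sublevel]

/-- Compactness, that is, properness of F, makes the local radii uniform. The induction is on the
property of having local lifts of a common radius, which passes to unions. -/
lemma exists_isLift_sublevel_pos [T2Space M] (hF : IsProperImmersion n F) (hN : IsUnitNormal F N)
    (R : ℝ) : ∃ ε > 0, ∃ τ, IsLift F N (sublevel F R) ε τ := by
  have h : ∃ ε > 0, ∀ p ∈ sublevel F R, ∃ B ∈ nhds p, ∃ τ, IsLift F N B ε τ := by
    refine (isCompact_sublevel hF R).induction_on
      (p := fun S => ∃ ε > 0, ∀ p ∈ S, ∃ B ∈ nhds p, ∃ τ, IsLift F N B ε τ) ?_ ?_ ?_ ?_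
    · exact ⟨1, one_pos, by simp⟩
    · rintro S T hST ⟨ε, hε, h⟩
      exact ⟨ε, hε, fun p hp => h p (hST hp)⟩
    · rintro S T ⟨ε, hε, h⟩ ⟨δ, hδ, h'⟩
      refine ⟨min ε δ, lt_min hε hδ, ?_⟩
      rintro p (hp | hp)
      · obtain ⟨B, hB, τ, hτ⟩ := h p hp
        exact ⟨B, hB, τ, hτ.mono subset_rfl (min_le_left _ _)⟩
      · obtain ⟨B, hB, τ, hτ⟩ := h' p hp
        exact ⟨B, hB, τ, hτ.mono subset_rfl (min_le_right _ _)⟩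
    · intro p _
      obtain ⟨B, hB, ε, hε, τ, hτ⟩ := exists_isLift_nhds hF hN p
      obtain ⟨U, hUB, hU, hpU⟩ := mem_nhds_iff.1 hB
      exact ⟨U, mem_nhdsWithin_of_mem_nhds (hU.mem_nhds hpU), ε, hε, fun q hq =>
        ⟨U, hU.mem_nhds hq, τ, hτ.mono hUB le_rfl⟩⟩
  obtain ⟨ε, hε, h⟩ := h
  exact ⟨ε, hε, IsLift.exists_of_locally hF hN h⟩

lemma exists_isLift_sublevel_double {R r : ℝ} (hr : 0 ≤ r)
    (h : ∃ τ, IsLift F N (sublevel F (R + r)) r τ) :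
    ∃ τ, IsLift F N (sublevel F R) (2 * r) τ := by
  obtain ⟨τ, hτ⟩ := h
  have hsub : ∀ q ∈ sublevel F R, q ∈ sublevel F (R + r) := fun q hq =>
    le_trans (b := R) hq (by linarith)
  refine ⟨_, hτ.comp_half hsub fun q hq w hw => ?_⟩
  change ‖F (τ q w)‖ ≤ R + r
  rw [hτ.map_apply q (hsub q hq) w hw]
  have h2 : ‖(w : Euc (n + 1))‖ < r := by simpa using hw
  exact (norm_add_le _ _).trans (add_le_add hq h2.le)

/-- The successive doublings consume ε + 2ε + ⋯ + 2^{k-1}ε = (2^k - 1)ε of the sublevel radius. -/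
lemma exists_isLift_sublevel_pow {ε : ℝ} (hε : 0 ≤ ε) (k : ℕ) :
    ∀ R : ℝ, (∃ τ, IsLift F N (sublevel F (R + (2 ^ k - 1) * ε)) ε τ) →
      ∃ τ, IsLift F N (sublevel F R) (2 ^ k * ε) τ := by
  induction k with
  | zero => intro R h; simpa using h
  | succ k ih =>
    intro R h
    have h1 := exists_isLift_sublevel_double (R := R) (r := 2 ^ k * ε) (by positivity)
      (ih (R + 2 ^ k * ε) (by
        rwa [show R + 2 ^ k * ε + (2 ^ k - 1) * ε = R + (2 ^ (k + 1) - 1) * ε by ring]))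
    rwa [show (2 : ℝ) ^ (k + 1) * ε = 2 * (2 ^ k * ε) by ring]

/-- The sublevel radius consumed to reach radius r is less than r, whatever the number of doublings.
So the initial uniform radius is taken on the sublevel R + r, fixed beforehand. -/
lemma exists_isLift_sublevel [T2Space M] (hF : IsProperImmersion n F) (hN : IsUnitNormal F N)
    (R : ℝ) {r : ℝ} (hr : 0 < r) : ∃ τ, IsLift F N (sublevel F R) r τ := by
  obtain ⟨ε, hε, τ, hτ⟩ := exists_isLift_sublevel_pos hF hN (R + r)
  obtain ⟨k, hk⟩ := pow_unbounded_of_one_lt (r / ε) (one_lt_two (α := ℝ))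
  have hk0 : (0 : ℝ) < 2 ^ k := by positivity
  have hle : r / 2 ^ k ≤ ε := by
    rw [div_lt_iff₀ hε] at hk
    rw [div_le_iff₀ hk0]
    linarith
  have hmul : 2 ^ k * (r / 2 ^ k) = r := by field_simp
  have h := exists_isLift_sublevel_pow (F := F) (N := N) (ε := r / 2 ^ k) (by positivity) k R
    ⟨τ, hτ.mono (fun q hq => le_trans (b := R + (2 ^ k - 1) * (r / 2 ^ k)) hq ?_) hle⟩
  · rwa [hmul] at h
  · have : 0 < r / 2 ^ k := by positivity
    rw [sub_mul, hmul]
    linarith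

/-- The translations by the vectors tangent to the whole hypersurface lift to it. -/
lemma exists_translation [T2Space M] (hF : IsProperImmersion n F) (hN : IsUnitNormal F N) :
    ∃ τ : M → tangentDirections N → M, Continuous (fun x : M × tangentDirections N => τ x.1 x.2) ∧
      (∀ q, τ q 0 = q) ∧ ∀ q w, F (τ q w) = F q + w := by
  have h : ∀ r : ℝ, 0 < r → ∃ τ, IsLift F N Set.univ r τ := by
    intro r hr
    refine IsLift.exists_of_locally hF hN fun p _ => ⟨sublevel F (‖F p‖ + 1), ?_,
      exists_isLift_sublevel hF hN _ hr⟩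
    have hc : Continuous fun q => ‖F q‖ := hF.smooth.continuous.norm
    exact hc.continuousAt.preimage_mem_nhds (Iic_mem_nhds (lt_add_one _))
  have : Nonempty (M → tangentDirections N → M) := ⟨fun q _ => q⟩
  choose! σ hσ using h
  have hpos : ∀ w : tangentDirections N, 0 < ‖w‖ + 1 := fun w => by positivity
  -- Lifts of all radii exist on Σ; for each w one of radius larger than ‖w‖ is used, and uniqueness
  -- makes the choice immaterial.
  refine ⟨fun q w => σ (‖w‖ + 1) q w, ?_, fun q => (hσ _ (hpos 0)).apply_zero q trivial,
    fun q w => (hσ _ (hpos w)).map_apply q trivial w (by simp)⟩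
  rw [continuous_iff_continuousAt]
  rintro ⟨q, w⟩
  have hmem : Set.univ ×ˢ Metric.ball (0 : tangentDirections N) (‖w‖ + 1) ∈ nhds (q, w) :=
    prod_mem_nhds Filter.univ_mem (Metric.isOpen_ball.mem_nhds (by simp))
  have hc := ((hσ _ (hpos w)).continuousOn).continuousAt hmem
  refine hc.congr ?_
  filter_upwards [hmem] with x hx
  exact (hσ _ (hpos w)).eq_of_mem hF hN (hσ _ (hpos x.2)) trivial trivial (by simpa using hx.2)
    (by simp)

/-- Uniqueness of lifts again, now on all of K: both sides lift w ↦ F q + v + w. -/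
lemma translation_add [T2Space M] (hF : IsProperImmersion n F) (hN : IsUnitNormal F N)
    {τ : M → tangentDirections N → M}
    (hc : Continuous fun x : M × tangentDirections N => τ x.1 x.2) (h0 : ∀ q, τ q 0 = q)
    (hτ : ∀ q w, F (τ q w) = F q + w) (q : M) (v w : tangentDirections N) :
    τ (τ q v) w = τ q (v + w) := by
  refine (T2Space.isSeparatedMap F).eqOn_of_comp_eqOn (isLocallyInjective_of_immersion hF hN)
    isPreconnected_univ (g₁ := fun w => τ (τ q v) w) (g₂ := fun w => τ q (v + w)) ?_ ?_ ?_
    (Set.mem_univ 0) ?_ (Set.mem_univ w)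
  · exact (hc.comp (by fun_prop : Continuous fun w => (τ q v, w))).continuousOn
  · exact (hc.comp (by fun_prop : Continuous fun w => (q, v + w))).continuousOn
  · intro u _
    simp only [Function.comp_apply, hτ, Submodule.coe_add, add_assoc]
  · simp [h0]

end Translations

/-! ### The slice F⁻¹(Kᗮ) as a manifold, and the product decomposition. -/

section Slice

variable {n : ℕ} {M : Type u} [TopologicalSpace M] [ChartedSpace (Euc n) M]
  [IsManifold (𝓡 n) ∞ M] {F N : M → Euc (n + 1)}

lemma tangentDirections_le_tangentPlane (N : M → Euc (n + 1)) (p : M) :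
    tangentDirections N ≤ tangentPlane N p :=
  iInf_le _ p

/-- The projection changes x only by a multiple of N, and N lies in Kᗮ. So a graph chart of Σ
straightens the slice to a linear subspace. -/
lemma tangentProj_mem_orthogonal_iff (N : M → Euc (n + 1)) (p : M) (x : Euc (n + 1)) :
    (tangentProj N p x : Euc (n + 1)) ∈ (tangentDirections N)ᗮ ↔ x ∈ (tangentDirections N)ᗮ := by
  have h : x - tangentProj N p x ∈ (tangentDirections N)ᗮ :=
    Submodule.orthogonal_le (tangentDirections_le_tangentPlane N p)
      (Submodule.sub_starProjection_mem_orthogonal x)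
  constructor
  · intro hx
    simpa using add_mem h hx
  · intro hx
    simpa using sub_mem hx h

/-- The tangent space at `p` of the slice orthogonal to the constant tangential fields. -/
abbrev slicePlane (N : M → Euc (n + 1)) (p : M) : Submodule ℝ (Euc (n + 1)) :=
  (tangentDirections N ⊔ ℝ ∙ N p)ᗮ

lemma slicePlane_eq (N : M → Euc (n + 1)) (p : M) :
    slicePlane N p = (tangentDirections N)ᗮ ⊓ tangentPlane N p :=
  (Submodule.inf_orthogonal _ _).symm

lemma finrank_slicePlane (hN : IsUnitNormal F N) (p : M) :
    Module.finrank ℝ (slicePlane N p) = n - Module.finrank ℝ (tangentDirections N) := by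
  have h1 : Module.finrank ℝ (tangentDirections N ⊔ ℝ ∙ N p : Submodule ℝ (Euc (n + 1))) +
      Module.finrank ℝ (slicePlane N p) = n + 1 := by
    rw [Submodule.finrank_add_finrank_orthogonal, finrank_euclideanSpace, Fintype.card_fin]
  have h2 := Submodule.finrank_sup_add_finrank_inf_eq (tangentDirections N) (ℝ ∙ N p)
  have h3 : tangentDirections N ⊓ ℝ ∙ N p = ⊥ := by
    refine eq_bot_iff.2 ((inf_le_inf_left _ ?_).trans
      (Submodule.inf_orthogonal_eq_bot (tangentDirections N)).le)
    rw [Submodule.span_singleton_le_iff_mem]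
    exact normal_mem_orthogonal N p
  rw [h3, finrank_bot, finrank_span_singleton (hN.ne_zero p)] at h2
  omega

/-- The orthogonal projection to the tangent space of the slice. -/
abbrev sliceProj (N : M → Euc (n + 1)) (p : M) : Euc (n + 1) →L[ℝ] slicePlane N p :=
  (slicePlane N p).orthogonalProjectionOnto

/-- The inclusion of the tangent space of the slice. -/
def sliceIncl (N : M → Euc (n + 1)) (p : M) : slicePlane N p →L[ℝ] tangentPlane N p :=
  (slicePlane N p).subtypeL.codRestrict (tangentPlane N p)
    fun v => ((slicePlane_eq N p).le v.2).2

lemma coe_sliceIncl (p : M) (v : slicePlane N p) : (sliceIncl N p v : Euc (n + 1)) = v := rfl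

lemma sliceIncl_sliceProj (p : M) {x : Euc (n + 1)} (hx : x ∈ (tangentDirections N)ᗮ) :
    sliceIncl N p (sliceProj N p x) = tangentProj N p x := by
  apply Subtype.ext
  rw [coe_sliceIncl, Submodule.coe_orthogonalProjectionOnto_apply]
  refine Submodule.eq_starProjection_of_mem_of_inner_eq_zero ?_ ?_
  · rw [slicePlane_eq]
    exact ⟨(tangentProj_mem_orthogonal_iff N p x).2 hx, (tangentProj N p x).2⟩
  · intro w hw
    rw [slicePlane_eq] at hw
    exact Submodule.starProjection_inner_eq_zero x w hw.2

/-- The points of the hypersurface whose position is orthogonal to all constant tangential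
fields. -/
def Slice (_ : IsProperImmersion n F) (_ : IsUnitNormal F N) : Type u :=
  {q : M // F q ∈ (tangentDirections N)ᗮ}

variable (hF : IsProperImmersion n F) (hN : IsUnitNormal F N)

instance : TopologicalSpace (Slice hF hN) :=
  inferInstanceAs (TopologicalSpace {q : M // F q ∈ (tangentDirections N)ᗮ})

instance [T2Space M] : T2Space (Slice hF hN) :=
  inferInstanceAs (T2Space {q : M // F q ∈ (tangentDirections N)ᗮ})

/-- A graph chart at `p`. -/
def graphChart (p : M) : OpenPartialHomeomorph M (tangentPlane N p) :=
  (exists_isGraphChart hF hN p).choose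

lemma exists_isGraphChart_graphChart (p : M) : ∃ r, IsGraphChart F N p (graphChart hF hN p) r :=
  (exists_isGraphChart hF hN p).choose_spec

/-- Linear coordinates of the tangent space of the slice. -/
def sliceCoord (p : M) :
    slicePlane N p ≃L[ℝ] Euc (n - Module.finrank ℝ (tangentDirections N)) :=
  ContinuousLinearEquiv.ofFinrankEq (by
    rw [finrank_slicePlane hN p, finrank_euclideanSpace, Fintype.card_fin])

/-- The coordinates of the slice in the ambient space. -/
def sliceCoordProj (p : M) :
    Euc (n + 1) →L[ℝ] Euc (n - Module.finrank ℝ (tangentDirections N)) :=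
  (sliceCoord hN p : slicePlane N p →L[ℝ] _) ∘L sliceProj N p

/-- The tangent vector of given coordinates. -/
def sliceVec (p : M) :
    Euc (n - Module.finrank ℝ (tangentDirections N)) →L[ℝ] tangentPlane N p :=
  sliceIncl N p ∘L ((sliceCoord hN p).symm : _ →L[ℝ] slicePlane N p)

lemma sliceVec_mem_orthogonal (p : M) (y) :
    (sliceVec hN p y : Euc (n + 1)) ∈ (tangentDirections N)ᗮ :=
  ((slicePlane_eq N p).le ((sliceCoord hN p).symm y).2).1

lemma sliceVec_sliceCoordProj (p : M) {x : Euc (n + 1)} (hx : x ∈ (tangentDirections N)ᗮ) :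
    sliceVec hN p (sliceCoordProj hN p x) = tangentProj N p x := by
  rw [← sliceIncl_sliceProj p hx]
  simp [sliceVec, sliceCoordProj]

lemma sliceCoordProj_eq (p : M) {x : Euc (n + 1)} (hx : x ∈ (tangentDirections N)ᗮ) {y}
    (hy : tangentProj N p x = sliceVec hN p y) : sliceCoordProj hN p x = y := by
  have hinj : Function.Injective (sliceVec hN p) := by
    intro a b hab
    apply (sliceCoord hN p).symm.injective
    have h : (sliceVec hN p a : Euc (n + 1)) = sliceVec hN p b := congrArg Subtype.val hab
    exact Subtype.ext h
  exact hinj (by rw [sliceVec_sliceCoordProj hN p hx, hy])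

/-- The inverse of the chart of the slice, as a map to the hypersurface. -/
def sliceParam (p : M) (y : Euc (n - Module.finrank ℝ (tangentDirections N))) : M :=
  (graphChart hF hN p).symm (sliceVec hN p y)

lemma tangentProj_sliceParam (p : M) {y} (hy : sliceVec hN p y ∈ (graphChart hF hN p).target) :
    tangentProj N p (F (sliceParam hF hN p y)) = sliceVec hN p y := by
  obtain ⟨r, he⟩ := exists_isGraphChart_graphChart hF hN p
  exact he.tangentProj_symm hy

lemma map_sliceParam_mem (p : M) {y} (hy : sliceVec hN p y ∈ (graphChart hF hN p).target) :
    F (sliceParam hF hN p y) ∈ (tangentDirections N)ᗮ := by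
  rw [← tangentProj_mem_orthogonal_iff N p, tangentProj_sliceParam hF hN p hy]
  exact sliceVec_mem_orthogonal hN p y

lemma contMDiffOn_sliceParam (p : M) :
    ContMDiffOn 𝓘(ℝ, Euc (n - Module.finrank ℝ (tangentDirections N))) (𝓡 n) ∞
      (sliceParam hF hN p) (sliceVec hN p ⁻¹' (graphChart hF hN p).target) := by
  obtain ⟨r, he⟩ := exists_isGraphChart_graphChart hF hN p
  exact he.smooth_symm.comp (sliceVec hN p).contMDiff.contMDiffOn subset_rfl

lemma sliceParam_sliceCoordProj (p : M) {q : M} (hq : q ∈ (graphChart hF hN p).source)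
    (hqF : F q ∈ (tangentDirections N)ᗮ) :
    sliceVec hN p (sliceCoordProj hN p (F q)) ∈ (graphChart hF hN p).target ∧
      sliceParam hF hN p (sliceCoordProj hN p (F q)) = q := by
  obtain ⟨r, he⟩ := exists_isGraphChart_graphChart hF hN p
  rw [sliceParam, sliceVec_sliceCoordProj hN p hqF, ← he.apply_eq q hq]
  exact ⟨(graphChart hF hN p).map_source hq, (graphChart hF hN p).left_inv hq⟩

open Classical in
/-- The inverse of the chart of the slice. -/
def sliceChartInv (p : Slice hF hN) (y : Euc (n - Module.finrank ℝ (tangentDirections N))) :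
    Slice hF hN :=
  -- The value p is a dummy, not taken on the chart target by `map_sliceParam_mem`.
  if h : F (sliceParam hF hN p.1 y) ∈ (tangentDirections N)ᗮ then ⟨sliceParam hF hN p.1 y, h⟩ else p

lemma val_sliceChartInv (p : Slice hF hN) {y}
    (hy : sliceVec hN p.1 y ∈ (graphChart hF hN p.1).target) :
    (sliceChartInv hF hN p y).1 = sliceParam hF hN p.1 y := by
  exact congrArg Subtype.val (dif_pos (map_sliceParam_mem hF hN p.1 hy))

lemma continuous_val_slice : Continuous (fun q : Slice hF hN => q.1) := continuous_subtype_val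

/-- The chart of the slice at `p`. -/
def sliceChart (p : Slice hF hN) :
    OpenPartialHomeomorph (Slice hF hN) (Euc (n - Module.finrank ℝ (tangentDirections N))) where
  toFun q := sliceCoordProj hN p.1 (F q.1)
  invFun := sliceChartInv hF hN p
  source := {q | q.1 ∈ (graphChart hF hN p.1).source}
  target := sliceVec hN p.1 ⁻¹' (graphChart hF hN p.1).target
  map_source' q hq := (sliceParam_sliceCoordProj hF hN p.1 hq q.2).1
  map_target' y hy := by
    change (sliceChartInv hF hN p y).1 ∈ (graphChart hF hN p.1).source
    rw [val_sliceChartInv hF hN p hy]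
    exact (graphChart hF hN p.1).map_target hy
  left_inv' q hq := by
    have h := sliceParam_sliceCoordProj hF hN p.1 hq q.2
    apply Subtype.ext
    rw [val_sliceChartInv hF hN p h.1, h.2]
  right_inv' y hy := by
    apply sliceCoordProj_eq hN p.1 (sliceChartInv hF hN p y).2
    rw [val_sliceChartInv hF hN p hy, tangentProj_sliceParam hF hN p.1 hy]
  open_source := (graphChart hF hN p.1).open_source.preimage (continuous_val_slice hF hN)
  open_target := (graphChart hF hN p.1).open_target.preimage (sliceVec hN p.1).continuous
  continuousOn_toFun := ((sliceCoordProj hN p.1).continuous.comp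
    (hF.smooth.continuous.comp (continuous_val_slice hF hN))).continuousOn
  continuousOn_invFun := by
    refine (Topology.IsInducing.subtypeVal
      (t := {q | F q ∈ (tangentDirections N)ᗮ})).continuousOn_iff.2 ?_
    exact (contMDiffOn_sliceParam hF hN p.1).continuousOn.congr fun y hy =>
      val_sliceChartInv hF hN p hy

lemma mem_sliceChart_source (p : Slice hF hN) : p ∈ (sliceChart hF hN p).source :=
  (exists_isGraphChart_graphChart hF hN p.1).choose_spec.mem_source

instance : ChartedSpace (Euc (n - Module.finrank ℝ (tangentDirections N))) (Slice hF hN) where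
  atlas := Set.range (sliceChart hF hN)
  chartAt := sliceChart hF hN
  mem_chart_source := mem_sliceChart_source hF hN
  chart_mem_atlas p := ⟨p, rfl⟩

lemma contDiffOn_comp_sliceChartInv (p : Slice hF hN) :
    ContDiffOn ℝ ∞ (fun y => F (sliceChartInv hF hN p y).1) (sliceChart hF hN p).target := by
  have h := contMDiffOn_iff_contDiffOn.1
    (hF.smooth.comp_contMDiffOn (contMDiffOn_sliceParam hF hN p.1))
  exact h.congr fun y hy => congrArg F (val_sliceChartInv hF hN p hy)

instance : IsManifold (𝓡 (n - Module.finrank ℝ (tangentDirections N))) ∞ (Slice hF hN) := by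
  apply isManifold_of_contDiffOn
  rintro _ _ ⟨p, rfl⟩ ⟨p', rfl⟩
  have h : ContDiffOn ℝ ∞ (fun y => sliceCoordProj hN p'.1 (F (sliceChartInv hF hN p y).1))
      (sliceChart hF hN p).target :=
    (sliceCoordProj hN p'.1).contDiff.comp_contDiffOn (contDiffOn_comp_sliceChartInv hF hN p)
  refine h.mono ?_
  rintro y ⟨hy, -⟩
  exact (((sliceChart hF hN p).symm.trans_source _).le hy).1

lemma contMDiff_val_slice :
    ContMDiff (𝓡 (n - Module.finrank ℝ (tangentDirections N))) (𝓡 n) ∞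
      (fun q : Slice hF hN => q.1) := by
  intro p
  have h1 : ContMDiffAt (𝓡 (n - Module.finrank ℝ (tangentDirections N)))
      (𝓡 (n - Module.finrank ℝ (tangentDirections N))) ∞
      (sliceChart hF hN p) p :=
    (contMDiffOn_chart (I := 𝓡 (n - Module.finrank ℝ (tangentDirections N))) (x := p)).contMDiffAt
      ((sliceChart hF hN p).open_source.mem_nhds (mem_sliceChart_source hF hN p))
  have hp : sliceChart hF hN p p ∈ (sliceChart hF hN p).target :=
    (sliceChart hF hN p).map_source (mem_sliceChart_source hF hN p)
  have h2 : ContMDiffAt (𝓡 (n - Module.finrank ℝ (tangentDirections N))) (𝓡 n) ∞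
      (sliceParam hF hN p.1) (sliceChart hF hN p p) :=
    (contMDiffOn_sliceParam hF hN p.1).contMDiffAt
      ((sliceChart hF hN p).open_target.mem_nhds hp)
  refine (h2.comp p h1).congr_of_eventuallyEq ?_
  filter_upwards [(sliceChart hF hN p).open_source.mem_nhds (mem_sliceChart_source hF hN p)]
    with q hq
  exact (sliceParam_sliceCoordProj hF hN p.1 hq q.2).2.symm

/-- The charts of the slice are restrictions of linear functions of F, so smoothness into Σ is
enough. -/
lemma contMDiff_slice_of_val {E H Z : Type*} [NormedAddCommGroup E] [NormedSpace ℝ E]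
    [TopologicalSpace H] [TopologicalSpace Z] [ChartedSpace H Z] {I : ModelWithCorners ℝ E H}
    {G : Z → Slice hF hN} (hG : ContMDiff I (𝓡 n) ∞ fun z => (G z).1) :
    ContMDiff I (𝓡 (n - Module.finrank ℝ (tangentDirections N))) ∞ G := by
  have hGc : Continuous G := Continuous.subtype_mk hG.continuous fun z => (G z).2
  intro z
  set p := G z
  have h1 : ContMDiffAt I 𝓘(ℝ, Euc (n - Module.finrank ℝ (tangentDirections N))) ∞
      (fun y => sliceCoordProj hN p.1 (F (G y).1)) z :=
    ((sliceCoordProj hN p.1).contMDiff.comp (hF.smooth.comp hG)) z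
  have hp : sliceChart hF hN p p ∈ (sliceChart hF hN p).target :=
    (sliceChart hF hN p).map_source (mem_sliceChart_source hF hN p)
  have h2 : ContMDiffAt (𝓡 (n - Module.finrank ℝ (tangentDirections N)))
      (𝓡 (n - Module.finrank ℝ (tangentDirections N))) ∞
      (sliceChart hF hN p).symm (sliceChart hF hN p p) :=
    (contMDiffOn_chart_symm (I := 𝓡 (n - Module.finrank ℝ (tangentDirections N)))
      (x := p)).contMDiffAt ((sliceChart hF hN p).open_target.mem_nhds hp)
  refine (ContMDiffAt.comp z h2 h1).congr_of_eventuallyEq ?_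
  filter_upwards [hGc.continuousAt.preimage_mem_nhds
    ((sliceChart hF hN p).open_source.mem_nhds (mem_sliceChart_source hF hN p))] with y hy
  exact ((sliceChart hF hN p).left_inv hy).symm

/-- The immersion of the slice. -/
def sliceImmersion (q : Slice hF hN) : (tangentDirections N)ᗮ := ⟨F q.1, q.2⟩

lemma contMDiff_sliceImmersion :
    ContMDiff (𝓡 (n - Module.finrank ℝ (tangentDirections N)))
      𝓘(ℝ, (tangentDirections N)ᗮ) ∞ (sliceImmersion hF hN) := by
  have h := ((tangentDirections N)ᗮ.orthogonalProjectionOnto).contMDiff.comp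
    (hF.smooth.comp (contMDiff_val_slice hF hN))
  refine h.congr fun q => ?_
  exact (Submodule.orthogonalProjectionOnto_mem_subspace_eq_self (sliceImmersion hF hN q)).symm

/-- A chart of the slice factors as a linear map after the immersion, and charts have injective
derivative. -/
lemma injective_mfderiv_sliceImmersion (p : Slice hF hN) :
    Function.Injective (mfderiv (𝓡 (n - Module.finrank ℝ (tangentDirections N)))
      𝓘(ℝ, (tangentDirections N)ᗮ) (sliceImmersion hF hN) p) := by
  let A : (tangentDirections N)ᗮ →L[ℝ] Euc (n - Module.finrank ℝ (tangentDirections N)) :=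
    sliceCoordProj hN p.1 ∘L (tangentDirections N)ᗮ.subtypeL
  have h1 := mfderiv_comp p (I' := 𝓘(ℝ, (tangentDirections N)ᗮ)) (g := A)
    (A.contMDiff (n := ∞) |>.contMDiffAt.mdifferentiableAt (by simp))
    ((contMDiff_sliceImmersion hF hN p).mdifferentiableAt (by simp))
  have h2 : Function.Injective (mfderiv (𝓡 (n - Module.finrank ℝ (tangentDirections N)))
      (𝓡 (n - Module.finrank ℝ (tangentDirections N))) (A ∘ sliceImmersion hF hN) p) :=
    (mdifferentiable_chart (I := 𝓡 (n - Module.finrank ℝ (tangentDirections N)))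
      p).mfderiv_injective (mem_sliceChart_source hF hN p)
  rw [h1] at h2
  exact Function.Injective.of_comp h2

lemma isProperImmersion_sliceImmersion :
    IsProperImmersion (n - Module.finrank ℝ (tangentDirections N)) (sliceImmersion hF hN) where
  smooth := contMDiff_sliceImmersion hF hN
  injective_mfderiv := injective_mfderiv_sliceImmersion hF hN
  proper := by
    have hclosed : IsClosed {q : M | F q ∈ (tangentDirections N)ᗮ} :=
      (Submodule.isClosed_orthogonal _).preimage hF.smooth.continuous
    have hval : IsProperMap (fun q : Slice hF hN => q.1) :=
      hclosed.isClosedEmbedding_subtypeVal.isProperMap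
    -- Composed with the inclusion of Kᗮ, the slice immersion is F restricted to a closed set, which
    -- is proper.
    exact isProperMap_of_comp_of_inj (contMDiff_sliceImmersion hF hN).continuous
      continuous_subtype_val (hF.proper.comp hval) Subtype.val_injective

/-- The hypersurface is the product of its slice and the space of constant tangential fields. -/
lemma splitsOff_tangentDirections [T2Space M] (hF : IsProperImmersion n F)
    (hN : IsUnitNormal F N) : SplitsOff F (Module.finrank ℝ (tangentDirections N)) := by
  obtain ⟨τ, hc, h0, hτ⟩ := exists_translation hF hN
  have hadd := translation_add hF hN hc h0 hτ
  let π : M → tangentDirections N := fun q => (tangentDirections N).orthogonalProjectionOnto (F q)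
  have hπ : ContMDiff (𝓡 n) 𝓘(ℝ, tangentDirections N) ∞ π :=
    ((tangentDirections N).orthogonalProjectionOnto).contMDiff.comp hF.smooth
  have hmem : ∀ q, F (τ q (-π q)) ∈ (tangentDirections N)ᗮ := by
    intro q
    rw [hτ, Submodule.coe_neg, ← sub_eq_add_neg]
    exact Submodule.sub_starProjection_mem_orthogonal (F q)
  have hπτ : ∀ (p : Slice hF hN) w, π (τ p.1 w) = w := by
    intro p w
    change (tangentDirections N).orthogonalProjectionOnto (F (τ p.1 w)) = w
    rw [hτ, map_add, Submodule.orthogonalProjectionOnto_eq_zero_iff.2 p.2,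
      Submodule.orthogonalProjectionOnto_mem_subspace_eq_self, zero_add]
  have hto : ContMDiff ((𝓡 (n - Module.finrank ℝ (tangentDirections N))).prod
      𝓘(ℝ, tangentDirections N)) (𝓡 n) ∞
      (fun x : Slice hF hN × tangentDirections N => τ x.1.1 x.2) := by
    refine contMDiff_of_comp_immersion hF hN
      (hc.comp (((continuous_val_slice hF hN).comp continuous_fst).prodMk continuous_snd)) ?_
    have h : ContMDiff ((𝓡 (n - Module.finrank ℝ (tangentDirections N))).prod
        𝓘(ℝ, tangentDirections N)) 𝓘(ℝ, Euc (n + 1)) ∞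
        (fun x : Slice hF hN × tangentDirections N => F x.1.1 + (tangentDirections N).subtypeL x.2) :=
      (hF.smooth.comp ((contMDiff_val_slice hF hN).comp contMDiff_fst)).add
        ((tangentDirections N).subtypeL.contMDiff.comp contMDiff_snd)
    exact h.congr fun x => hτ _ _
  have hinv : ContMDiff (𝓡 n) (𝓡 n) ∞ fun q => τ q (-π q) := by
    refine contMDiff_of_comp_immersion hF hN (hc.comp (continuous_id.prodMk hπ.continuous.neg)) ?_
    have h : ContMDiff (𝓡 n) 𝓘(ℝ, Euc (n + 1)) ∞
        (fun q => F q - (tangentDirections N).subtypeL (π q)) :=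
      hF.smooth.sub ((tangentDirections N).subtypeL.contMDiff.comp hπ)
    refine h.congr fun q => ?_
    simp [hτ, sub_eq_add_neg]
  refine ⟨tangentDirections N, rfl, Slice hF hN, inferInstance, inferInstance, inferInstance,
    inferInstance, sliceImmersion hF hN,
    -- The inverse translates q back by the K-component π q of its position; the group law for
    -- translations shows that the two maps are mutually inverse.
    { toFun := fun x => τ x.1.1 x.2
      invFun := fun q => (⟨τ q (-π q), hmem q⟩, π q)
      left_inv := ?_
      right_inv := ?_
      contMDiff_toFun := hto
      contMDiff_invFun := ContMDiff.prodMk (contMDiff_slice_of_val hF hN hinv) hπ },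
    isProperImmersion_sliceImmersion hF hN, fun p w => hτ _ _⟩
  · rintro ⟨p, w⟩
    refine Prod.ext (Subtype.ext ?_) (hπτ p w)
    change τ (τ p.1 w) (-π (τ p.1 w)) = p.1
    rw [hπτ, hadd, add_neg_cancel, h0]
  · intro q
    change τ (τ q (-π q)) (π q) = q
    rw [hadd, neg_add_cancel, h0]

end Slice

/-! ### The dimension count. -/

section Conclusion

variable {n : ℕ} {M : Type u} [TopologicalSpace M] [T2Space M] [ChartedSpace (Euc n) M]
  [IsManifold (𝓡 n) ∞ M] [MeasurableSpace M] [BorelSpace M] {F N : M → Euc (n + 1)}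

/-- The index bound is applied to V = Kᗮ, the largest convenient space on which v ↦ ⟨v, N⟩ is
injective. -/
lemma le_finrank_tangentDirections_add_indexQ (hF : IsProperImmersion n F)
    (hN : IsUnitNormal F N) [IsFiniteMeasure (gaussianArea F)] {C : ℝ}
    (hH : ∀ p, meanCurvature F N p = ⟪F p, N p⟫ / 2 + C) (hplanar : ¬ IsPlanar F) :
    (n : ℕ∞) + 1 ≤ Module.finrank ℝ (tangentDirections N) + indexQ F N := by
  have h1 := finrank_le_indexQ hF hN hH (tangentDirections N)ᗮ
    (eq_zero_of_affineNormal_eq_zero hF hN hH hplanar)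
  have h2 := (tangentDirections N).finrank_add_finrank_orthogonal
  rw [finrank_euclideanSpace, Fintype.card_fin] at h2
  calc (n : ℕ∞) + 1 = ((n + 1 : ℕ) : ℕ∞) := by push_cast; rfl
    _ = (Module.finrank ℝ (tangentDirections N) : ℕ∞) +
        Module.finrank ℝ (tangentDirections N)ᗮ := by exact_mod_cast h2.symm
    _ ≤ _ := add_le_add_right h1 _

lemma not_indexQ_le_one (hF : IsProperImmersion n F)
    (hN : IsUnitNormal F N) [IsFiniteMeasure (gaussianArea F)] {C : ℝ}
    (hH : ∀ p, meanCurvature F N p = ⟪F p, N p⟫ / 2 + C) (hplanar : ¬ IsPlanar F) :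
    ¬ indexQ F N ≤ 1 := by
  intro hle
  have h := (le_finrank_tangentDirections_add_indexQ hF hN hH hplanar).trans
    (add_le_add_right hle _)
  refine hplanar (isPlanar_of_le_finrank hF hN ?_)
  have h' : n + 1 ≤ Module.finrank ℝ (tangentDirections N) + 1 := by exact_mod_cast h
  omega

end Conclusion

end GaussianHypersurface

end

theorem theorem4p5 {n : ℕ} {M : Type u} [TopologicalSpace M] [T2Space M]
    [ChartedSpace (GaussianHypersurface.Euc n) M] [IsManifold (𝓡 n) ∞ M]
    [MeasurableSpace M] [BorelSpace M]
    (F N : M → GaussianHypersurface.Euc (n + 1)) (C : ℝ)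
    (hF : GaussianHypersurface.IsProperImmersion n F)
    (hN : GaussianHypersurface.IsUnitNormal F N)
    (hplanar : ¬ GaussianHypersurface.IsPlanar F)
    (harea : GaussianHypersurface.gaussianArea F Set.univ < ⊤)
    (hH : ∀ p, GaussianHypersurface.meanCurvature F N p = ⟪F p, N p⟫ / 2 + C) :
    (GaussianHypersurface.indexQ F N ≤ n →
      ∃ i : ℕ, (n : ℕ∞) + 1 - GaussianHypersurface.indexQ F N ≤ i ∧ i ≤ n ∧
        GaussianHypersurface.SplitsOff F i) ∧
    GaussianHypersurface.indexQ F N ≠ 0 ∧ GaussianHypersurface.indexQ F N ≠ 1 := by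
  have hfin : IsFiniteMeasure (GaussianHypersurface.gaussianArea F) := ⟨harea⟩
  -- An empty Σ is vacuously planar. A point of Σ is needed for dim K ≤ n.
  have hne : Nonempty M := by
    by_contra h
    exact hplanar fun p => (h ⟨p⟩).elim
  have hind := GaussianHypersurface.not_indexQ_le_one hF hN hH hplanar
  -- The integer i is dim K.
  refine ⟨fun _ => ⟨_, tsub_le_iff_right.2
      (GaussianHypersurface.le_finrank_tangentDirections_add_indexQ hF hN hH hplanar),
      GaussianHypersurface.finrank_tangentDirections_le hN,
      GaussianHypersurface.splitsOff_tangentDirections hF hN⟩, fun h => hind ?_, fun h => hind ?_⟩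
  · rw [h]; exact zero_le_one
  · rw [h]
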